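/- Let $\mathcal E,h,\mu,\omega\in\mathbb R$ with $\mu,\omega>0$, $\mathcal E+h>0$, $\mathcal E>\omega^2$, and put $V_E(z)=\mathcal E-\frac{\omega^2}{2}|z|^2$ and $V_I(z)=\mathcal E+h+\frac{\mu}{|z|}$ on $\mathbb R^2\simeq\mathbb C$. Assume $V_E<V_I$ on the unit circle, i.e. $\mathcal E-\frac{\omega^2}2<\mathcal E+h+\mu$ (automatic if $h>0$). **Unperturbed shift.** Let $I_c=\sqrt{\mathcal E-\omega^2/2}$, $\mathcal I=(-I_c,I_c)$, and let $\bar\theta=\bar\theta_E+\bar\theta_I$ on $\mathcal I$, where $\bar\theta_E(0)=\bar\theta_I(0)=0$ and, for $I\ne0$, $$\bar\theta_E(I)=\operatorname{arccot}\!\left(\frac{\mathcal E-2I^2}{I\sqrt{4\mathcal E-2(2I^2+\omega^2)}}\right)-\begin{cases}0&I>0\\ \pi&I<0\end{cases},\qquad \bar\theta_I(I)=\operatorname{sgn}(I)\left(2\arccos\!\left(\frac{2I^2-\mu}{\sqrt{4(\mathcal E+h)I^2+\mu^2}}\right)-2\pi\right),$$ with $\operatorname{arccot}$ valued in $(0,\pi)$.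 Let $\bar{\mathcal I}=\{I\in\mathcal I:\bar\theta'(I)=0\}$. **Perturbed domain.** Let $k\ge 2$ be an integer, $C>0$, and $f\in C^k(\mathbb R/2\pi\mathbb Z\times[-C,C])$. For small $|\varepsilon|$ let $D_\varepsilon\ni 0$ be the domain bounded by $\gamma_\varepsilon(\xi)=(1+\varepsilon f(\xi,\varepsilon))e^{i\xi}$. **First return map.** All motions solve $z''=\nabla V(z)$ with $\frac12|z'|^2=V(z)$, where $V=V_E$ outside and $V=V_I$ inside $D_\varepsilon$. A point $(\xi_0,I_0)$ stands for the particle leaving $D_\varepsilon$ from $\gamma_\varepsilon(\xi_0)$ with the velocity $v_0$ that points strictly outwards and satisfies $\frac12|v_0|^2=V_E(\gamma_\varepsilon(\xi_0))$ and $I_0=\frac1{\sqrt2}\,v_0\cdot\gamma_\varepsilon'(\xi_0)$ (the momentum conjugate to $\xi$). The particle follows the outer motion, outside $\overline{D_\varepsilon}$, until it first hits $\partial D_\varepsilon$. There it is refracted: the tangential component of the velocity is conserved, and the new velocity points strictly inwards, with speed given by $V_I$. It then follows the inner motion, inside $D_\varepsilon$, until it next hits $\partial D_\varepsilon$, at $\gamma_\varepsilon(\xi_1)$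 say; an inner motion that falls into the origin is continued by bouncing back along the same path (ejection-collision). There it is refracted to the outside, again with conservation of the tangential component, to a velocity $v_1$ with coordinates $(\xi_1,I_1)$. The map is defined at $(\xi_0,I_0)$ if all these steps are possible, and then $\mathcal F(\xi_0,I_0;\varepsilon)=(\xi_1,I_1)$. **Proposition.** Let $a<b$ with $[a,b]\subset\mathcal I\setminus\bar{\mathcal I}$. Then there is $\bar\varepsilon>0$ such that, for every $\varepsilon\in\mathbb R$ with $|\varepsilon|<\bar\varepsilon$: 1. $\mathcal F(\cdot,\cdot;\varepsilon)$ is well defined on $\mathbb R/2\pi\mathbb Z\times[a,b]$: every $(\xi_0,I_0)$ has an image $(\xi_1,I_1)\in\mathbb R/2\pi\mathbb Z\times\mathbb R$, and only one. 2. $\mathcal F(\cdot,\cdot;\varepsilon)$ is of class $C^{k-2}$; that is, it has a lift to $\mathbb R\times[a,b]$ of class $C^{k-2}$ which commutes with $(\xi,I)\mapsto(\xi+2\pi,I)$. 3. This lift is differentiable at every point of $\mathbb R\times[a,b]$ (relative to this strip), and there it is conservative (area-preserving), $\det D\mathcal F(\xi_0,I_0;\varepsilon)=1$, and satisfies the twist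 condition $\dfrac{\partial\xi_1}{\partial I_0}(\xi_0,I_0;\varepsilon)\neq0$. -/

import Mathlib

/-!
The plane is identified with `ℂ`, with its Euclidean inner product `inner ℝ`.
A domain is star-shaped with respect to the origin and is given by the (positive, `2π`-periodic)
radius `ρ` of its boundary as a function of the polar angle.
-/

namespace RefractionBilliard

noncomputable section

/-- The harmonic potential `V_E(z) = E - (ω² / 2) |z|²`, in force outside the domain. -/
def outerPotential (E ω : ℝ) (z : ℂ) : ℝ := E - ω ^ 2 / 2 * ‖z‖ ^ 2

/-- The Keplerian potential `V_I(z) = E + h + μ / |z|`, in force inside the domain. -/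
def innerPotential (E h μ : ℝ) (z : ℂ) : ℝ := E + h + μ / ‖z‖

/-- The boundary curve `γ(ξ) = ρ(ξ) e^{iξ}`. -/
def boundaryCurve (ρ : ℝ → ℝ) (ξ : ℝ) : ℂ := (ρ ξ : ℂ) * Complex.exp (ξ * Complex.I)

/-- The velocity `γ'(ξ)` of the boundary curve, a (not normalised) tangent vector. -/
def tangentVec (ρ : ℝ → ℝ) (ξ : ℝ) : ℂ := deriv (boundaryCurve ρ) ξ

/-- The (not normalised) outward normal vector `-i γ'(ξ)`. -/
def normalVec (ρ : ℝ → ℝ) (ξ : ℝ) : ℂ := -Complex.I * tangentVec ρ ξ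

/-- The open domain `D` bounded by the curve. -/
def interiorDomain (ρ : ℝ → ℝ) : Set ℂ := {z | ‖z‖ < ρ (Complex.arg z)}

/-- The complement of the closure of `D`. -/
def exteriorDomain (ρ : ℝ → ℝ) : Set ℂ := {z | ρ (Complex.arg z) < ‖z‖}

/-- On the time set `J`, the curve `z` has velocity `v`, satisfies Newton's equation
`z'' = ∇V(z)` and lies on the zero energy level `|z'|² / 2 - V(z) = 0`. -/
def IsMotion (V : ℂ → ℝ) (J : Set ℝ) (z v : ℝ → ℂ) : Prop :=
  ∀ s ∈ J, HasDerivWithinAt z (v s) J s ∧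
    HasDerivWithinAt v (gradient (𝕜 := ℝ) V (z s)) J s ∧
    ‖v s‖ ^ 2 / 2 - V (z s) = 0

/-- An outer arc: a motion in the outer potential during `[0, T]` that stays outside the closed
domain for the times in `(0, T)`. -/
def IsOuterArc (E ω : ℝ) (ρ : ℝ → ℝ) (T : ℝ) (z v : ℝ → ℂ) : Prop :=
  0 < T ∧ IsMotion (outerPotential E ω) (Set.Icc 0 T) z v ∧
    ∀ s ∈ Set.Ioo 0 T, z s ∈ exteriorDomain ρ

/-- A motion in the Keplerian potential during `[0, T]` that avoids the centre. -/
def IsClassicalKepler (E h μ T : ℝ) (z v : ℝ → ℂ) : Prop :=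
  IsMotion (innerPotential E h μ) (Set.Icc 0 T) z v ∧ ∀ s ∈ Set.Icc 0 T, z s ≠ 0

/-- An ejection-collision motion (the Levi-Civita regularisation of a collision): the particle
falls into the centre at time `T / 2` and comes back along the same path. -/
def IsEjectionCollision (E h μ T : ℝ) (z v : ℝ → ℂ) : Prop :=
  ContinuousOn z (Set.Icc 0 T) ∧ z (T / 2) = 0 ∧
    (∀ s ∈ Set.Icc 0 T \ {T / 2}, z s ≠ 0) ∧
    IsMotion (innerPotential E h μ) (Set.Icc 0 T \ {T / 2}) z v ∧
    ∀ s ∈ Set.Icc 0 T, z (T - s) = z s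

/-- An inner arc: a Keplerian motion during `[0, T]`, possibly of ejection-collision type, that
stays in the open domain for the times in `(0, T)`. -/
def IsInnerArc (E h μ : ℝ) (ρ : ℝ → ℝ) (T : ℝ) (z v : ℝ → ℂ) : Prop :=
  0 < T ∧ (IsClassicalKepler E h μ T z v ∨ IsEjectionCollision E h μ T z v) ∧
    ∀ s ∈ Set.Ioo 0 T, z s ∈ interiorDomain ρ

/-- `v` is the velocity with which the particle leaves the domain when its angle-action
coordinates are `p = (ξ, I)`: it starts from `γ(ξ)` on the zero energy level of the outer
potential, points strictly outwards, and `I = v · γ'(ξ) / √2`. -/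
def IsLaunchVelocity (E ω : ℝ) (ρ : ℝ → ℝ) (p : ℝ × ℝ) (v : ℂ) : Prop :=
  ‖v‖ ^ 2 / 2 - outerPotential E ω (boundaryCurve ρ p.1) = 0 ∧
    0 < inner ℝ v (normalVec ρ p.1) ∧
    p.2 = inner ℝ v (tangentVec ρ p.1) / √2

/-- `q = (ξ₁, I₁)` is reached from `p = (ξ₀, I₀)` after one outer arc, a refraction at the boundary
point `γ(η)`, one inner arc, and a refraction at `γ(ξ₁)` back to the outside. By Snell's law a
refraction conserves the tangential component of the velocity. -/
def FirstReturn (E h μ ω : ℝ) (ρ : ℝ → ℝ) (p q : ℝ × ℝ) : Prop :=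
  ∃ (zE vE zI vI : ℝ → ℂ) (TE TI η : ℝ) (v₁ : ℂ),
    IsOuterArc E ω ρ TE zE vE ∧
    zE 0 = boundaryCurve ρ p.1 ∧ IsLaunchVelocity E ω ρ p (vE 0) ∧
    zE TE = boundaryCurve ρ η ∧
    IsInnerArc E h μ ρ TI zI vI ∧
    zI 0 = boundaryCurve ρ η ∧
    inner ℝ (vI 0) (normalVec ρ η) < 0 ∧
    inner ℝ (vI 0) (tangentVec ρ η) = inner ℝ (vE TE) (tangentVec ρ η) ∧
    zI TI = boundaryCurve ρ q.1 ∧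
    IsLaunchVelocity E ω ρ q v₁ ∧
    inner ℝ v₁ (tangentVec ρ q.1) = inner ℝ (vI TI) (tangentVec ρ q.1)

/-- The inverse cotangent with values in `(0, π)`. -/
def arccot (x : ℝ) : ℝ := Real.pi / 2 - Real.arctan x

/-- The angle spanned by an outer arc of the unit disk, as a function of the action. -/
def outerShift (E ω I : ℝ) : ℝ :=
  if I = 0 then 0
  else
    arccot ((E - 2 * I ^ 2) / (I * √(4 * E - 2 * (2 * I ^ 2 + ω ^ 2)))) -
      if 0 < I then 0 else Real.pi

/-- The angle (modulo `2π`) spanned by an inner arc of the unit disk, as a function of the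
action. -/
def innerShift (E h μ I : ℝ) : ℝ :=
  if I = 0 then 0
  else if 0 < I then
    2 * Real.arccos ((2 * I ^ 2 - μ) / √(4 * (E + h) * I ^ 2 + μ ^ 2)) - 2 * Real.pi
  else
    -2 * Real.arccos ((2 * I ^ 2 - μ) / √(4 * (E + h) * I ^ 2 + μ ^ 2)) + 2 * Real.pi

/-- The total shift of the unit disk. -/
def totalShift (E h μ ω I : ℝ) : ℝ := outerShift E ω I + innerShift E h μ I

/-- The interval `(-I_c, I_c)` of actions of the unit disk, `I_c = √(E - ω² / 2)`. -/
def actionInterval (E ω : ℝ) : Set ℝ := Set.Ioo (-√(E - ω ^ 2 / 2)) (√(E - ω ^ 2 / 2))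

/-- The set of critical points of the total shift. -/
def criticalActions (E h μ ω : ℝ) : Set ℝ :=
  {I ∈ actionInterval E ω | deriv (totalShift E h μ ω) I = 0}

end

end RefractionBilliard

/-! ### Area-preserving charts: points of a near-circular curve versus orbits of a central force. -/

namespace RefractionBilliard

open Set Filter Topology

/-! Both potentials are rotation invariant, so an orbit on the zero energy level is described by its
angular momentum L and the direction g of its symmetry axis. At a point γ(ξ) of the curve with
radius ρ, a velocity with signed radial speed P(r, L), r = ρ(ξ), has tangential momentum J = v ·
γ'(ξ) = L + P ρ'(ξ), and the axis of its orbit is g = ξ + Θ(r, L). The decisive identity is ∂P/∂L =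
∂Θ/∂r = -L/(r² P) =: Q; both sides are the mixed derivative of the radial action. Hence ∂J/∂L at
fixed ξ and ∂g/∂ξ at fixed L are the same number 1 + Q ρ', positive when ρ' is small, and (ξ, J) ↦
(g, L) is an area-preserving change of coordinates (`exists_hasFDerivAt_charts`).

An arc is symmetric about its axis: from one end to the other g and L persist, while P and Θ change
sign. A refraction keeps ξ and J. So the first return map is a composition of such coordinate
changes and inverses of them. Its determinant is 1 without differentiating any flow, and by the
implicit function theorem it is as smooth as ρ and ρ', that is C^(k-1), one class better than
required.

These formulas describe genuine arcs. The same positivity of 1 + Q ρ' shows that each half of an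
orbit crosses the curve only once (`strictMonoOn_radius`). Outer orbits are explicit ellipses; inner
ones are squares of hyperbolas in the Levi-Civita plane, where the collision L = 0 is not singular
(`exists_isOuterArc`, `exists_isInnerArc`). Conversely, every arc with the same initial data has the
same end, by linearity of the outer equation and by conservation of the angular momentum and the
Lenz vector inside (`IsOuterArc.end_unique`, `IsInnerArc.end_unique`).

For ε = 0 the map is (ξ, I) ↦ (ξ + θ(I), I) with θ the total shift, so its twist is θ'(I), nonzero
on [a, b]. The map is C¹ jointly in (ξ, I, ε), and compactness of a period times [a, b] preserves
the twist for small ε (`eventually_twist`). -/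

/-- A scalar function that is locally the only solution of a nondegenerate implicit equation of
class `C^n` is of class `C^n`. -/
theorem contDiffAt_of_implicit {E : Type*} [NormedAddCommGroup E] [NormedSpace ℝ E]
    [CompleteSpace E] {n : WithTop ℕ∞} (hn : n ≠ 0) {G : E × ℝ → ℝ} {φ : E → ℝ} {x : E} {c : ℝ}
    (hG : ContDiffAt ℝ n G (x, φ x)) (hd : HasDerivAt (fun y => G (x, y)) c (φ x)) (hc : c ≠ 0)
    {V : Set ℝ} (hV : V ∈ 𝓝 (φ x))
    (huniq : ∀ᶠ x' in 𝓝 x, ∀ y ∈ V, G (x', y) = G (x, φ x) → y = φ x') :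
    ContDiffAt ℝ n φ x := by
  have hfd : HasFDerivAt G (fderiv ℝ G (x, φ x)) (x, φ x) :=
    (hG.differentiableAt hn).hasFDerivAt
  have h1 : HasDerivAt (fun y : ℝ => (x, y)) ((0 : E), (1 : ℝ)) (φ x) :=
    (hasDerivAt_const _ _).prodMk (hasDerivAt_id _)
  have h2 : fderiv ℝ G (x, φ x) (0, 1) = c := (hfd.comp_hasDerivAt (φ x) h1).unique hd
  have hinv : (fderiv ℝ G (x, φ x) ∘L .inr ℝ E ℝ).IsInvertible := by
    refine ⟨ContinuousLinearEquiv.unitsEquivAut ℝ (Units.mk0 c hc), ?_⟩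
    ext
    simp [h2]
  have hψ := hG.contDiffAt_implicitFunction hn hinv
  -- The implicit function is continuous with value `φ x` at `x`, so it stays in `V` nearby, where
  -- uniqueness identifies it with `φ`.
  refine hψ.congr_of_eventuallyEq ?_
  have ht : Tendsto (hG.implicitFunction hn hinv) (𝓝 x) (𝓝 (φ x)) := by
    have := hψ.continuousAt.tendsto
    rwa [show (hG.implicitFunction hn hinv) (x, φ x).1 = φ x from
      hG.implicitFunction_apply_self hn hinv] at this
  filter_upwards [huniq, ht hV, hG.eventually_apply_implicitFunction hn hinv] with x' h1 h2 h3
  exact (h1 _ h2 h3).symm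

theorem det_prod_real (A : ℝ × ℝ →L[ℝ] ℝ × ℝ) :
    A.det = (A (1, 0)).1 * (A (0, 1)).2 - (A (0, 1)).1 * (A (1, 0)).2 := by
  rw [ContinuousLinearMap.det, ← LinearMap.det_toMatrix (Module.Basis.finTwoProd ℝ),
    Matrix.det_fin_two]
  simp [LinearMap.toMatrix_apply]

/-- Data attached to a rotation invariant force: the signed radial speed `P r L` of the orbits with
angular momentum `L` at the distance `r`, the angle `Θ r L` from there to their axis, and the
common value `Q` of `∂P/∂L` and `∂Θ/∂r`. -/
structure SectionChart (Λ r₁ r₂ δ M : ℝ) (P Θ Q : ℝ → ℝ → ℝ) : Prop where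
  nonneg : 0 ≤ M
  mul_lt_one : δ * M < 1
  contDiffAt_P : ∀ r ∈ Icc r₁ r₂, ∀ L ∈ Icc (-Λ) Λ, ContDiffAt ℝ ⊤ (Function.uncurry P) (r, L)
  contDiffAt_Θ : ∀ r ∈ Icc r₁ r₂, ∀ L ∈ Icc (-Λ) Λ, ContDiffAt ℝ ⊤ (Function.uncurry Θ) (r, L)
  hasDerivAt_P : ∀ r ∈ Icc r₁ r₂, ∀ L ∈ Icc (-Λ) Λ, HasDerivAt (P r) (Q r L) L
  hasDerivAt_Θ : ∀ r ∈ Icc r₁ r₂, ∀ L ∈ Icc (-Λ) Λ, HasDerivAt (fun r => Θ r L) (Q r L) r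
  abs_P_le : ∀ r ∈ Icc r₁ r₂, ∀ L ∈ Icc (-Λ) Λ, |P r L| ≤ M
  abs_Q_le : ∀ r ∈ Icc r₁ r₂, ∀ L ∈ Icc (-Λ) Λ, |Q r L| ≤ M
  abs_Θ_le : ∀ r L, |Θ r L| ≤ Real.pi

/-- The radius function of a closed curve that is `C¹`-close to a circle around the origin. -/
structure NearCircle (r₁ r₂ δ : ℝ) (ρ : ℝ → ℝ) : Prop where
  pos : 0 < r₁
  mem_Ioo : ∀ ξ, ρ ξ ∈ Ioo r₁ r₂
  differentiable : Differentiable ℝ ρ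
  abs_deriv_lt : ∀ ξ, |deriv ρ ξ| < δ
  periodic : Function.Periodic ρ (2 * Real.pi)

/-- A family of radius functions, of class `C^n` at the parameter `ε` together with its angular
derivative. -/
structure SmoothFamilyAt (n : WithTop ℕ∞) (r₁ r₂ δ : ℝ) (ρ : ℝ → ℝ → ℝ) (ε : ℝ) : Prop where
  nearCircle : ∀ᶠ e in 𝓝 ε, NearCircle r₁ r₂ δ (ρ e)
  contDiffAt : ∀ ξ, ContDiffAt ℝ n (fun x : ℝ × ℝ => ρ x.2 x.1) (ξ, ε)
  contDiffAt_deriv : ∀ ξ, ContDiffAt ℝ n (fun x : ℝ × ℝ => deriv (ρ x.2) x.1) (ξ, ε)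

/-- The angular momentum `L ∈ [-Λ, Λ]` with `L + P r L * s = J`. -/
noncomputable def solveMomentum (P : ℝ → ℝ → ℝ) (Λ r s J : ℝ) : ℝ :=
  Classical.epsilon fun L => L ∈ Icc (-Λ) Λ ∧ L + P r L * s = J

/-- The polar angle `ξ` with `ξ + Θ (ρ ξ) L = g`. -/
noncomputable def solveAngle (Θ : ℝ → ℝ → ℝ) (ρ : ℝ → ℝ) (g L : ℝ) : ℝ :=
  Classical.epsilon fun ξ => ξ + Θ (ρ ξ) L = g

/-- From the position and the tangential momentum on the curve to the orbit, given by the angle of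
its axis and its angular momentum. -/
noncomputable def toOrbit (P Θ : ℝ → ℝ → ℝ) (Λ : ℝ) (ρ : ℝ → ℝ) (p : ℝ × ℝ) : ℝ × ℝ :=
  (p.1 + Θ (ρ p.1) (solveMomentum P Λ (ρ p.1) (deriv ρ p.1) p.2),
    solveMomentum P Λ (ρ p.1) (deriv ρ p.1) p.2)

/-- From the orbit to the position and the tangential momentum on the curve. -/
noncomputable def ofOrbit (P Θ : ℝ → ℝ → ℝ) (ρ : ℝ → ℝ) (q : ℝ × ℝ) : ℝ × ℝ :=
  (solveAngle Θ ρ q.1 q.2,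
    q.2 + P (ρ (solveAngle Θ ρ q.1 q.2)) q.2 * deriv ρ (solveAngle Θ ρ q.1 q.2))

variable {Λ r₁ r₂ δ M : ℝ} {P Θ Q : ℝ → ℝ → ℝ}

theorem NearCircle.mem_Icc {ρ : ℝ → ℝ} (N : NearCircle r₁ r₂ δ ρ) (ξ : ℝ) :
    ρ ξ ∈ Icc r₁ r₂ := Ioo_subset_Icc_self (N.mem_Ioo ξ)

theorem NearCircle.radius_pos {ρ : ℝ → ℝ} (N : NearCircle r₁ r₂ δ ρ) (ξ : ℝ) : 0 < ρ ξ :=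
  N.pos.trans (N.mem_Ioo ξ).1

theorem NearCircle.deriv_periodic {ρ : ℝ → ℝ} (N : NearCircle r₁ r₂ δ ρ) :
    Function.Periodic (deriv ρ) (2 * Real.pi) := by
  intro x
  rw [← deriv_comp_add_const]
  congr 1
  exact funext N.periodic

namespace SectionChart

/-- This is the chart at the other end of an arc: reflection in the axis reverses the radial speed
and the angle to the axis. -/
theorem neg (D : SectionChart Λ r₁ r₂ δ M P Θ Q) :
    SectionChart Λ r₁ r₂ δ M (-P) (-Θ) (-Q) where
  nonneg := D.nonneg
  mul_lt_one := D.mul_lt_one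
  contDiffAt_P r hr L hL := (D.contDiffAt_P r hr L hL).neg
  contDiffAt_Θ r hr L hL := (D.contDiffAt_Θ r hr L hL).neg
  hasDerivAt_P r hr L hL := (D.hasDerivAt_P r hr L hL).neg
  hasDerivAt_Θ r hr L hL := (D.hasDerivAt_Θ r hr L hL).neg
  abs_P_le r hr L hL := by simpa using D.abs_P_le r hr L hL
  abs_Q_le r hr L hL := by simpa using D.abs_Q_le r hr L hL
  abs_Θ_le r L := by simpa using D.abs_Θ_le r L

theorem abs_mul_lt_one (D : SectionChart Λ r₁ r₂ δ M P Θ Q) {r L s : ℝ} (hr : r ∈ Icc r₁ r₂)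
    (hL : L ∈ Icc (-Λ) Λ) (hs : |s| < δ) : |Q r L * s| < 1 := by
  have h1 := D.abs_Q_le r hr L hL
  have h2 := D.mul_lt_one
  rw [abs_mul]
  nlinarith [abs_nonneg (Q r L), abs_nonneg s]

theorem one_add_mul_pos (D : SectionChart Λ r₁ r₂ δ M P Θ Q) {r L s : ℝ} (hr : r ∈ Icc r₁ r₂)
    (hL : L ∈ Icc (-Λ) Λ) (hs : |s| < δ) : 0 < 1 + Q r L * s := by
  linarith [(abs_lt.1 (D.abs_mul_lt_one hr hL hs)).1]

theorem abs_P_mul_le (D : SectionChart Λ r₁ r₂ δ M P Θ Q) {r L s : ℝ} (hr : r ∈ Icc r₁ r₂)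
    (hL : L ∈ Icc (-Λ) Λ) (hs : |s| < δ) : |P r L * s| ≤ δ * M := by
  rw [abs_mul, mul_comm]
  exact mul_le_mul hs.le (D.abs_P_le r hr L hL) (abs_nonneg _) ((abs_nonneg s).trans hs.le)

theorem hasDerivAt_momentum (D : SectionChart Λ r₁ r₂ δ M P Θ Q) {r L : ℝ} (s : ℝ)
    (hr : r ∈ Icc r₁ r₂) (hL : L ∈ Icc (-Λ) Λ) :
    HasDerivAt (fun L => L + P r L * s) (1 + Q r L * s) L :=
  (hasDerivAt_id L).add ((D.hasDerivAt_P r hr L hL).mul_const s)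

theorem strictMonoOn_momentum (D : SectionChart Λ r₁ r₂ δ M P Θ Q) {r s : ℝ}
    (hr : r ∈ Icc r₁ r₂) (hs : |s| < δ) :
    StrictMonoOn (fun L => L + P r L * s) (Icc (-Λ) Λ) := by
  refine strictMonoOn_of_deriv_pos (convex_Icc _ _)
    (fun L hL => (D.hasDerivAt_momentum s hr hL).continuousAt.continuousWithinAt) ?_
  intro L hL
  have hL' := interior_subset hL
  rw [(D.hasDerivAt_momentum s hr hL').deriv]
  exact D.one_add_mul_pos hr hL' hs

/-- The correction `P r L * s` is at most `δ * M`, so the margin in `hJ` puts `J` between the values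
at `L = -Λ` and `L = Λ`. -/
theorem exists_momentum (D : SectionChart Λ r₁ r₂ δ M P Θ Q) {r s J : ℝ}
    (hr : r ∈ Icc r₁ r₂) (hs : |s| < δ) (hJ : |J| + δ * M < Λ) :
    ∃ L ∈ Icc (-Λ) Λ, L + P r L * s = J := by
  have hJ' := abs_lt.1 (show |J| < Λ - δ * M by linarith)
  have h0 : 0 ≤ δ * M := mul_nonneg ((abs_nonneg s).trans hs.le) D.nonneg
  have hΛ : -Λ ≤ Λ := by linarith [abs_nonneg J]
  have hc : ContinuousOn (fun L => L + P r L * s) (Icc (-Λ) Λ) := fun L hL =>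
    (D.hasDerivAt_momentum s hr hL).continuousAt.continuousWithinAt
  refine intermediate_value_Icc hΛ hc ⟨?_, ?_⟩
  · have := abs_le.1 (D.abs_P_mul_le hr (left_mem_Icc.2 hΛ) hs)
    linarith
  · have := abs_le.1 (D.abs_P_mul_le hr (right_mem_Icc.2 hΛ) hs)
    linarith

theorem solveMomentum_spec (D : SectionChart Λ r₁ r₂ δ M P Θ Q) {r s J : ℝ}
    (hr : r ∈ Icc r₁ r₂) (hs : |s| < δ) (hJ : |J| + δ * M < Λ) :
    solveMomentum P Λ r s J ∈ Icc (-Λ) Λ ∧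
      solveMomentum P Λ r s J + P r (solveMomentum P Λ r s J) * s = J :=
  Classical.epsilon_spec (D.exists_momentum hr hs hJ)

theorem abs_solveMomentum_sub_le (D : SectionChart Λ r₁ r₂ δ M P Θ Q) {r s J : ℝ}
    (hr : r ∈ Icc r₁ r₂) (hs : |s| < δ) (hJ : |J| + δ * M < Λ) :
    |solveMomentum P Λ r s J - J| ≤ δ * M := by
  obtain ⟨h1, h2⟩ := D.solveMomentum_spec hr hs hJ
  have := D.abs_P_mul_le hr h1 hs
  rw [abs_sub_comm]
  convert! this using 2
  linarith

theorem eq_solveMomentum (D : SectionChart Λ r₁ r₂ δ M P Θ Q) {r s J L : ℝ}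
    (hr : r ∈ Icc r₁ r₂) (hs : |s| < δ) (hJ : |J| + δ * M < Λ) (hL : L ∈ Icc (-Λ) Λ)
    (h : L + P r L * s = J) : L = solveMomentum P Λ r s J := by
  obtain ⟨h1, h2⟩ := D.solveMomentum_spec hr hs hJ
  exact (D.strictMonoOn_momentum hr hs).injOn hL h1 (h.trans h2.symm)

theorem contDiffAt_solveMomentum (D : SectionChart Λ r₁ r₂ δ M P Θ Q) {n : WithTop ℕ∞}
    (hn : n ≠ 0) {r s J : ℝ} (hr : r ∈ Ioo r₁ r₂) (hs : |s| < δ) (hJ : |J| + δ * M < Λ) :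
    ContDiffAt ℝ n (fun x : ℝ × ℝ × ℝ => solveMomentum P Λ x.1 x.2.1 x.2.2) (r, s, J) := by
  have hr' := Ioo_subset_Icc_self hr
  obtain ⟨h1, h2⟩ := D.solveMomentum_spec hr' hs hJ
  have h3 := abs_le.1 (D.abs_solveMomentum_sub_le hr' hs hJ)
  -- The strict margin in `hJ` keeps the solution in the interior of the range.
  have hV : Icc (-Λ) Λ ∈ 𝓝 (solveMomentum P Λ r s J) := by
    apply Icc_mem_nhds <;> cases abs_cases J <;> linarith
  have hP : ContDiffAt ℝ n (Function.uncurry P) (r, solveMomentum P Λ r s J) :=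
    (D.contDiffAt_P r hr' _ h1).of_le le_top
  refine contDiffAt_of_implicit hn (c := 1 + Q r (solveMomentum P Λ r s J) * s)
    (G := fun y : (ℝ × ℝ × ℝ) × ℝ => y.2 + P y.1.1 y.2 * y.1.2.1 - y.1.2.2) ?_ ?_
    (D.one_add_mul_pos hr' h1 hs).ne' hV ?_
  · have : ContDiffAt ℝ n (fun y : (ℝ × ℝ × ℝ) × ℝ => Function.uncurry P (y.1.1, y.2))
        ((r, s, J), solveMomentum P Λ r s J) :=
      ContDiffAt.comp (f := fun y : (ℝ × ℝ × ℝ) × ℝ => (y.1.1, y.2))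
        ((r, s, J), solveMomentum P Λ r s J) hP (by fun_prop)
    exact (contDiffAt_snd.add (this.mul (by fun_prop))).sub (by fun_prop)
  · exact (D.hasDerivAt_momentum s hr' h1).sub_const J
  · have e1 : ∀ᶠ x : ℝ × ℝ × ℝ in 𝓝 (r, s, J), x.1 ∈ Ioo r₁ r₂ :=
      continuousAt_fst.eventually (isOpen_Ioo.mem_nhds hr)
    have e2 : ∀ᶠ x : ℝ × ℝ × ℝ in 𝓝 (r, s, J), |x.2.1| < δ :=
      ContinuousAt.eventually_lt (by fun_prop) continuousAt_const hs
    have e3 : ∀ᶠ x : ℝ × ℝ × ℝ in 𝓝 (r, s, J), |x.2.2| + δ * M < Λ :=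
      ContinuousAt.eventually_lt (by fun_prop) continuousAt_const hJ
    filter_upwards [e1, e2, e3] with x h4 h5 h6 y hy hxy
    refine D.eq_solveMomentum (Ioo_subset_Icc_self h4) h5 h6 hy ?_
    simp only [h2] at hxy
    linarith

section Angle

variable {ρ : ℝ → ℝ} {L : ℝ}

theorem hasDerivAt_angle (D : SectionChart Λ r₁ r₂ δ M P Θ Q) (N : NearCircle r₁ r₂ δ ρ)
    (hL : L ∈ Icc (-Λ) Λ) (ξ : ℝ) :
    HasDerivAt (fun ξ => ξ + Θ (ρ ξ) L) (1 + Q (ρ ξ) L * deriv ρ ξ) ξ :=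
  (hasDerivAt_id ξ).add
    ((D.hasDerivAt_Θ _ (N.mem_Icc ξ) L hL).comp ξ (N.differentiable ξ).hasDerivAt)

theorem strictMono_angle (D : SectionChart Λ r₁ r₂ δ M P Θ Q) (N : NearCircle r₁ r₂ δ ρ)
    (hL : L ∈ Icc (-Λ) Λ) : StrictMono fun ξ => ξ + Θ (ρ ξ) L := by
  refine strictMono_of_deriv_pos fun ξ => ?_
  rw [(D.hasDerivAt_angle N hL ξ).deriv]
  exact D.one_add_mul_pos (N.mem_Icc ξ) hL (N.abs_deriv_lt ξ)

/-- Since Θ is bounded by π, the left side is at most `g` at `g - π` and at least `g` at `g + π`. -/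
theorem solveAngle_spec (D : SectionChart Λ r₁ r₂ δ M P Θ Q) (N : NearCircle r₁ r₂ δ ρ)
    (hL : L ∈ Icc (-Λ) Λ) (g : ℝ) :
    solveAngle Θ ρ g L + Θ (ρ (solveAngle Θ ρ g L)) L = g := by
  refine Classical.epsilon_spec (p := fun ξ => ξ + Θ (ρ ξ) L = g) ?_
  have hc : Continuous fun ξ => ξ + Θ (ρ ξ) L :=
    continuous_iff_continuousAt.2 fun ξ => (D.hasDerivAt_angle N hL ξ).continuousAt
  have hπ := Real.pi_pos
  obtain ⟨ξ, -, h⟩ := intermediate_value_Icc (show g - Real.pi ≤ g + Real.pi by linarith)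
    hc.continuousOn (show g ∈ _ from
      ⟨by linarith [(abs_le.1 (D.abs_Θ_le (ρ (g - Real.pi)) L)).2],
        by linarith [(abs_le.1 (D.abs_Θ_le (ρ (g + Real.pi)) L)).1]⟩)
  exact ⟨ξ, h⟩

theorem eq_solveAngle (D : SectionChart Λ r₁ r₂ δ M P Θ Q) (N : NearCircle r₁ r₂ δ ρ)
    (hL : L ∈ Icc (-Λ) Λ) {g ξ : ℝ} (h : ξ + Θ (ρ ξ) L = g) : ξ = solveAngle Θ ρ g L :=
  (D.strictMono_angle N hL).injective (h.trans (D.solveAngle_spec N hL g).symm)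

theorem solveAngle_add_period (D : SectionChart Λ r₁ r₂ δ M P Θ Q) (N : NearCircle r₁ r₂ δ ρ)
    (hL : L ∈ Icc (-Λ) Λ) (g : ℝ) (m : ℤ) :
    solveAngle Θ ρ (g + m * (2 * Real.pi)) L = solveAngle Θ ρ g L + m * (2 * Real.pi) := by
  refine (D.eq_solveAngle N hL ?_).symm
  rw [N.periodic.int_mul m]
  linarith [D.solveAngle_spec N hL g]

end Angle

theorem contDiffAt_solveAngle (D : SectionChart Λ r₁ r₂ δ M P Θ Q) {n : WithTop ℕ∞} (hn : n ≠ 0)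
    {ρ : ℝ → ℝ → ℝ} {ε : ℝ} (S : SmoothFamilyAt n r₁ r₂ δ ρ ε) {g L : ℝ}
    (hL : L ∈ Ioo (-Λ) Λ) :
    ContDiffAt ℝ n (fun x : (ℝ × ℝ) × ℝ => solveAngle Θ (ρ x.2) x.1.1 x.1.2) ((g, L), ε) := by
  have N := S.nearCircle.self_of_nhds
  have hL' := Ioo_subset_Icc_self hL
  set ξ := solveAngle Θ (ρ ε) g L with hξ
  have h2 := D.solveAngle_spec N hL' g
  rw [← hξ] at h2
  refine contDiffAt_of_implicit hn (c := 1 + Q (ρ ε ξ) L * deriv (ρ ε) ξ)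
    (G := fun y : ((ℝ × ℝ) × ℝ) × ℝ => y.2 + Θ (ρ y.1.2 y.2) y.1.1.2 - y.1.1.1) ?_ ?_
    (D.one_add_mul_pos (N.mem_Icc ξ) hL' (N.abs_deriv_lt ξ)).ne' univ_mem ?_
  · have h1 : ContDiffAt ℝ n (fun y : ((ℝ × ℝ) × ℝ) × ℝ => ρ y.1.2 y.2) (((g, L), ε), ξ) :=
      ContDiffAt.comp (f := fun y : ((ℝ × ℝ) × ℝ) × ℝ => (y.2, y.1.2))
        (((g, L), ε), ξ) (S.contDiffAt ξ) (by fun_prop)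
    have hΘ : ContDiffAt ℝ n (Function.uncurry Θ) (ρ ε ξ, L) :=
      (D.contDiffAt_Θ _ (N.mem_Icc ξ) _ hL').of_le le_top
    have : ContDiffAt ℝ n (fun y : ((ℝ × ℝ) × ℝ) × ℝ => Function.uncurry Θ (ρ y.1.2 y.2, y.1.1.2))
        (((g, L), ε), ξ) :=
      ContDiffAt.comp (f := fun y : ((ℝ × ℝ) × ℝ) × ℝ => (ρ y.1.2 y.2, y.1.1.2))
        (((g, L), ε), ξ) hΘ (h1.prodMk (by fun_prop))
    exact (contDiffAt_snd.add this).sub (by fun_prop)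
  · exact (D.hasDerivAt_angle N hL' ξ).sub_const g
  · have e1 : ∀ᶠ x : (ℝ × ℝ) × ℝ in 𝓝 ((g, L), ε), x.1.2 ∈ Ioo (-Λ) Λ :=
      ContinuousAt.preimage_mem_nhds (f := fun x : (ℝ × ℝ) × ℝ => x.1.2) (by fun_prop)
        (isOpen_Ioo.mem_nhds hL)
    have e2 : ∀ᶠ x : (ℝ × ℝ) × ℝ in 𝓝 ((g, L), ε), NearCircle r₁ r₂ δ (ρ x.2) :=
      (continuousAt_snd (p := ((g, L), ε))).eventually S.nearCircle
    filter_upwards [e1, e2] with x h4 h5 y hy hxy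
    refine D.eq_solveAngle h5 (Ioo_subset_Icc_self h4) ?_
    simp only [← hξ, h2] at hxy
    linarith

theorem contDiffAt_toOrbit (D : SectionChart Λ r₁ r₂ δ M P Θ Q) {n : WithTop ℕ∞} (hn : n ≠ 0)
    {ρ : ℝ → ℝ → ℝ} {ε : ℝ} (S : SmoothFamilyAt n r₁ r₂ δ ρ ε) {ξ J : ℝ}
    (hJ : |J| + δ * M < Λ) :
    ContDiffAt ℝ n (fun x : (ℝ × ℝ) × ℝ => toOrbit P Θ Λ (ρ x.2) x.1) ((ξ, J), ε) := by
  have N := S.nearCircle.self_of_nhds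
  have h1 : ContDiffAt ℝ n (fun x : (ℝ × ℝ) × ℝ => ρ x.2 x.1.1) ((ξ, J), ε) :=
    ContDiffAt.comp (f := fun x : (ℝ × ℝ) × ℝ => (x.1.1, x.2)) ((ξ, J), ε)
      (S.contDiffAt ξ) (by fun_prop)
  have h2 : ContDiffAt ℝ n (fun x : (ℝ × ℝ) × ℝ => deriv (ρ x.2) x.1.1) ((ξ, J), ε) :=
    ContDiffAt.comp (f := fun x : (ℝ × ℝ) × ℝ => (x.1.1, x.2)) ((ξ, J), ε)
      (S.contDiffAt_deriv ξ) (by fun_prop)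
  have h3 : ContDiffAt ℝ n (fun x : (ℝ × ℝ) × ℝ =>
      solveMomentum P Λ (ρ x.2 x.1.1) (deriv (ρ x.2) x.1.1) x.1.2) ((ξ, J), ε) :=
    ContDiffAt.comp (f := fun x : (ℝ × ℝ) × ℝ => (ρ x.2 x.1.1, deriv (ρ x.2) x.1.1, x.1.2))
      ((ξ, J), ε) (D.contDiffAt_solveMomentum hn (N.mem_Ioo ξ) (N.abs_deriv_lt ξ) hJ)
      (h1.prodMk (h2.prodMk (by fun_prop)))
  have hΘ : ContDiffAt ℝ n (Function.uncurry Θ)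
      (ρ ε ξ, solveMomentum P Λ (ρ ε ξ) (deriv (ρ ε) ξ) J) :=
    (D.contDiffAt_Θ _ (N.mem_Icc ξ) _
      (D.solveMomentum_spec (N.mem_Icc ξ) (N.abs_deriv_lt ξ) hJ).1).of_le le_top
  have h4 : ContDiffAt ℝ n (fun x : (ℝ × ℝ) × ℝ => Function.uncurry Θ (ρ x.2 x.1.1,
      solveMomentum P Λ (ρ x.2 x.1.1) (deriv (ρ x.2) x.1.1) x.1.2)) ((ξ, J), ε) :=
    ContDiffAt.comp (f := fun x : (ℝ × ℝ) × ℝ => (ρ x.2 x.1.1,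
      solveMomentum P Λ (ρ x.2 x.1.1) (deriv (ρ x.2) x.1.1) x.1.2)) ((ξ, J), ε) hΘ
      (h1.prodMk h3)
  exact ContDiffAt.prodMk (ContDiffAt.add (by fun_prop) h4) h3

theorem contDiffAt_ofOrbit (D : SectionChart Λ r₁ r₂ δ M P Θ Q) {n : WithTop ℕ∞} (hn : n ≠ 0)
    {ρ : ℝ → ℝ → ℝ} {ε : ℝ} (S : SmoothFamilyAt n r₁ r₂ δ ρ ε) {g L : ℝ}
    (hL : L ∈ Ioo (-Λ) Λ) :
    ContDiffAt ℝ n (fun x : (ℝ × ℝ) × ℝ => ofOrbit P Θ (ρ x.2) x.1) ((g, L), ε) := by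
  have N := S.nearCircle.self_of_nhds
  have h0 := D.contDiffAt_solveAngle hn S (g := g) hL
  have h1 : ContDiffAt ℝ n (fun x : (ℝ × ℝ) × ℝ => ρ x.2 (solveAngle Θ (ρ x.2) x.1.1 x.1.2))
      ((g, L), ε) :=
    ContDiffAt.comp (f := fun x : (ℝ × ℝ) × ℝ => (solveAngle Θ (ρ x.2) x.1.1 x.1.2, x.2))
      ((g, L), ε) (S.contDiffAt _) (h0.prodMk (by fun_prop))
  have h2 : ContDiffAt ℝ n (fun x : (ℝ × ℝ) × ℝ =>
      deriv (ρ x.2) (solveAngle Θ (ρ x.2) x.1.1 x.1.2)) ((g, L), ε) :=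
    ContDiffAt.comp (f := fun x : (ℝ × ℝ) × ℝ => (solveAngle Θ (ρ x.2) x.1.1 x.1.2, x.2))
      ((g, L), ε) (S.contDiffAt_deriv _) (h0.prodMk (by fun_prop))
  have hP : ContDiffAt ℝ n (Function.uncurry P) (ρ ε (solveAngle Θ (ρ ε) g L), L) :=
    (D.contDiffAt_P _ (N.mem_Icc _) _ (Ioo_subset_Icc_self hL)).of_le le_top
  have h4 : ContDiffAt ℝ n (fun x : (ℝ × ℝ) × ℝ => Function.uncurry P
      (ρ x.2 (solveAngle Θ (ρ x.2) x.1.1 x.1.2), x.1.2)) ((g, L), ε) :=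
    ContDiffAt.comp (f := fun x : (ℝ × ℝ) × ℝ =>
      (ρ x.2 (solveAngle Θ (ρ x.2) x.1.1 x.1.2), x.1.2)) ((g, L), ε) hP
      (h1.prodMk (by fun_prop))
  exact h0.prodMk (ContDiffAt.add (by fun_prop) (h4.mul h2))

/-- The two charts of the phase space over a curve, `(ξ, L) ↦ (ξ, J)` and `(ξ, L) ↦ (g, L)`, have
the same nonvanishing Jacobian determinant. -/
theorem exists_hasFDerivAt_charts (D : SectionChart Λ r₁ r₂ δ M P Θ Q) {ρ : ℝ → ℝ}
    (N : NearCircle r₁ r₂ δ ρ) {ξ L : ℝ} (hρ : DifferentiableAt ℝ (deriv ρ) ξ)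
    (hL : L ∈ Icc (-Λ) Λ) :
    ∃ A B : ℝ × ℝ →L[ℝ] ℝ × ℝ,
      HasFDerivAt (fun p : ℝ × ℝ => (p.1, p.2 + P (ρ p.1) p.2 * deriv ρ p.1)) A (ξ, L) ∧
      HasFDerivAt (fun p : ℝ × ℝ => (p.1 + Θ (ρ p.1) p.2, p.2)) B (ξ, L) ∧
      A.det = B.det := by
  have hr := N.mem_Icc ξ
  have d1 : DifferentiableAt ℝ (fun p : ℝ × ℝ => ρ p.1) (ξ, L) :=
    (N.differentiable ξ).comp (ξ, L) differentiableAt_fst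
  have d2 : DifferentiableAt ℝ (fun p : ℝ × ℝ => deriv ρ p.1) (ξ, L) :=
    DifferentiableAt.comp (f := fun p : ℝ × ℝ => p.1) (ξ, L) hρ differentiableAt_fst
  have d3 : DifferentiableAt ℝ (fun p : ℝ × ℝ => Function.uncurry P (ρ p.1, p.2)) (ξ, L) :=
    DifferentiableAt.comp (f := fun p : ℝ × ℝ => (ρ p.1, p.2)) (ξ, L)
      ((D.contDiffAt_P _ hr _ hL).differentiableAt (by simp)) (d1.prodMk differentiableAt_snd)
  have d4 : DifferentiableAt ℝ (fun p : ℝ × ℝ => Function.uncurry Θ (ρ p.1, p.2)) (ξ, L) :=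
    DifferentiableAt.comp (f := fun p : ℝ × ℝ => (ρ p.1, p.2)) (ξ, L)
      ((D.contDiffAt_Θ _ hr _ hL).differentiableAt (by simp)) (d1.prodMk differentiableAt_snd)
  have dA : DifferentiableAt ℝ (fun p : ℝ × ℝ => (p.1, p.2 + P (ρ p.1) p.2 * deriv ρ p.1))
      (ξ, L) := differentiableAt_fst.prodMk (differentiableAt_snd.add (d3.mul d2))
  have dB : DifferentiableAt ℝ (fun p : ℝ × ℝ => (p.1 + Θ (ρ p.1) p.2, p.2)) (ξ, L) :=
    (differentiableAt_fst.add d4).prodMk differentiableAt_snd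
  have c1 : HasDerivAt (fun t : ℝ => (t, L)) ((1 : ℝ), (0 : ℝ)) ξ :=
    (hasDerivAt_id ξ).prodMk (hasDerivAt_const ξ L)
  have c2 : HasDerivAt (fun t : ℝ => (ξ, t)) ((0 : ℝ), (1 : ℝ)) L :=
    (hasDerivAt_const L ξ).prodMk (hasDerivAt_id L)
  refine ⟨_, _, dA.hasFDerivAt, dB.hasFDerivAt, ?_⟩
  have a1 := DFunLike.congr_fun (dA.hasFDerivAt.fst.unique hasFDerivAt_fst) ((1 : ℝ), (0 : ℝ))
  have a2 := (dA.hasFDerivAt.comp_hasDerivAt L c2).unique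
    ((hasDerivAt_const L ξ).prodMk (D.hasDerivAt_momentum (deriv ρ ξ) hr hL))
  have b1 := (dB.hasFDerivAt.comp_hasDerivAt ξ c1).unique
    ((D.hasDerivAt_angle N hL ξ).prodMk (hasDerivAt_const ξ L))
  have b2 := DFunLike.congr_fun (dB.hasFDerivAt.snd.unique hasFDerivAt_snd) ((0 : ℝ), (1 : ℝ))
  simp only [ContinuousLinearMap.coe_comp, Function.comp_apply, ContinuousLinearMap.coe_fst',
    ContinuousLinearMap.coe_snd'] at a1 b2
  -- Each chart keeps one coordinate, so both matrices are triangular; the remaining diagonal entry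
  -- is ∂J/∂L for the first and ∂g/∂ξ for the second, and both equal 1 + Q ρ'.
  rw [det_prod_real, det_prod_real, a1, a2, b1, b2]
  simp

/-- `A` and `B` will be the derivatives of the two charts and `T` that of the inverse of the first
chart, so `B.comp T` is the change of coordinates. -/
theorem det_comp_eq_one {A B T : ℝ × ℝ →L[ℝ] ℝ × ℝ} (hAB : A.det = B.det)
    (hA : A.comp T = .id ℝ (ℝ × ℝ)) : (B.comp T).det = 1 := by
  have h1 : (A.comp T).det = A.det * T.det := LinearMap.det_comp _ _
  have h2 : (B.comp T).det = B.det * T.det := LinearMap.det_comp _ _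
  rw [h2, ← hAB, ← h1, hA]
  exact LinearMap.det_id

end SectionChart

theorem SmoothFamilyAt.differentiableAt_deriv {n : WithTop ℕ∞} (hn : n ≠ 0) {ρ : ℝ → ℝ → ℝ}
    {ε : ℝ} (S : SmoothFamilyAt n r₁ r₂ δ ρ ε) (ξ : ℝ) :
    DifferentiableAt ℝ (deriv (ρ ε)) ξ :=
  DifferentiableAt.comp (f := fun t : ℝ => (t, ε)) ξ
    ((S.contDiffAt_deriv ξ).differentiableAt hn) (by fun_prop)

namespace SectionChart

/-- The map factors through (ξ, L): it is the chart (ξ, L) ↦ (g, L) after the inverse of (ξ, L) ↦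
(ξ, J). -/
theorem exists_det_toOrbit (D : SectionChart Λ r₁ r₂ δ M P Θ Q) {n : WithTop ℕ∞} (hn : n ≠ 0)
    {ρ : ℝ → ℝ → ℝ} {ε : ℝ} (S : SmoothFamilyAt n r₁ r₂ δ ρ ε) {ξ J : ℝ}
    (hJ : |J| + δ * M < Λ) :
    ∃ T : ℝ × ℝ →L[ℝ] ℝ × ℝ, HasFDerivAt (toOrbit P Θ Λ (ρ ε)) T (ξ, J) ∧ T.det = 1 := by
  have N := S.nearCircle.self_of_nhds
  have hL := (D.solveMomentum_spec (N.mem_Icc ξ) (N.abs_deriv_lt ξ) hJ).1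
  obtain ⟨A, B, hA, hB, hAB⟩ := D.exists_hasFDerivAt_charts N (S.differentiableAt_deriv hn ξ) hL
  have hT : DifferentiableAt ℝ (toOrbit P Θ Λ (ρ ε)) (ξ, J) :=
    DifferentiableAt.comp (f := fun p : ℝ × ℝ => (p, ε)) (ξ, J)
      ((D.contDiffAt_toOrbit hn S hJ).differentiableAt hn) (by fun_prop)
  have hR : HasFDerivAt (fun p : ℝ × ℝ => (p.1, (toOrbit P Θ Λ (ρ ε) p).2))
      ((ContinuousLinearMap.fst ℝ ℝ ℝ).prod ((ContinuousLinearMap.snd ℝ ℝ ℝ).comp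
        (fderiv ℝ (toOrbit P Θ Λ (ρ ε)) (ξ, J)))) (ξ, J) :=
    hasFDerivAt_fst.prodMk hT.hasFDerivAt.snd
  refine ⟨_, HasFDerivAt.comp (g := fun p : ℝ × ℝ => (p.1 + Θ (ρ ε p.1) p.2, p.2))
    (ξ, J) hB hR, det_comp_eq_one hAB ?_⟩
  refine (HasFDerivAt.comp
    (g := fun p : ℝ × ℝ => (p.1, p.2 + P (ρ ε p.1) p.2 * deriv (ρ ε) p.1)) (ξ, J) hA hR).unique
    ((hasFDerivAt_id (ξ, J)).congr_of_eventuallyEq ?_)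
  have e : ∀ᶠ p : ℝ × ℝ in 𝓝 (ξ, J), |p.2| + δ * M < Λ :=
    ContinuousAt.eventually_lt (by fun_prop) continuousAt_const hJ
  filter_upwards [e] with p hp
  exact Prod.ext rfl (D.solveMomentum_spec (N.mem_Icc p.1) (N.abs_deriv_lt p.1) hp).2

theorem exists_det_ofOrbit (D : SectionChart Λ r₁ r₂ δ M P Θ Q) {n : WithTop ℕ∞} (hn : n ≠ 0)
    {ρ : ℝ → ℝ → ℝ} {ε : ℝ} (S : SmoothFamilyAt n r₁ r₂ δ ρ ε) {g L : ℝ}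
    (hL : L ∈ Ioo (-Λ) Λ) :
    ∃ T : ℝ × ℝ →L[ℝ] ℝ × ℝ, HasFDerivAt (ofOrbit P Θ (ρ ε)) T (g, L) ∧ T.det = 1 := by
  have N := S.nearCircle.self_of_nhds
  obtain ⟨A, B, hA, hB, hAB⟩ := D.exists_hasFDerivAt_charts N
    (S.differentiableAt_deriv hn (solveAngle Θ (ρ ε) g L)) (Ioo_subset_Icc_self hL)
  have hT : DifferentiableAt ℝ (ofOrbit P Θ (ρ ε)) (g, L) :=
    DifferentiableAt.comp (f := fun p : ℝ × ℝ => (p, ε)) (g, L)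
      ((D.contDiffAt_ofOrbit hn S hL).differentiableAt hn) (by fun_prop)
  have hR : HasFDerivAt (fun p : ℝ × ℝ => ((ofOrbit P Θ (ρ ε) p).1, p.2))
      (((ContinuousLinearMap.fst ℝ ℝ ℝ).comp (fderiv ℝ (ofOrbit P Θ (ρ ε)) (g, L))).prod
        (ContinuousLinearMap.snd ℝ ℝ ℝ)) (g, L) :=
    hT.hasFDerivAt.fst.prodMk hasFDerivAt_snd
  refine ⟨_, HasFDerivAt.comp
    (g := fun p : ℝ × ℝ => (p.1, p.2 + P (ρ ε p.1) p.2 * deriv (ρ ε) p.1)) (g, L) hA hR,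
    det_comp_eq_one hAB.symm ?_⟩
  refine (HasFDerivAt.comp
    (g := fun p : ℝ × ℝ => (p.1 + Θ (ρ ε p.1) p.2, p.2)) (g, L) hB hR).unique
    ((hasFDerivAt_id (g, L)).congr_of_eventuallyEq ?_)
  have e : ∀ᶠ p : ℝ × ℝ in 𝓝 (g, L), p.2 ∈ Ioo (-Λ) Λ :=
    continuousAt_snd.eventually (isOpen_Ioo.mem_nhds hL)
  filter_upwards [e] with p hp
  exact Prod.ext (D.solveAngle_spec N (Ioo_subset_Icc_self hp) p.1) rfl

end SectionChart
end RefractionBilliard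

/-! ### Radial speeds and axis angles of the two potentials. -/

namespace RefractionBilliard

open Set Filter Topology

/-- The radial speed on the zero energy level of the outer potential. -/
noncomputable def outerSpeed (E ω r L : ℝ) : ℝ := √(2 * E - ω ^ 2 * r ^ 2 - L ^ 2 / r ^ 2)

/-- The radial speed on the zero energy level of the inner potential. -/
noncomputable def innerSpeed (E h μ r L : ℝ) : ℝ := √(2 * (E + h) + 2 * μ / r - L ^ 2 / r ^ 2)

/-- The angle between a point of an outer orbit and its apocentre. -/
noncomputable def outerAngle (E ω r L : ℝ) : ℝ :=
  Complex.arg ⟨E - L ^ 2 / r ^ 2, L * outerSpeed E ω r L / r⟩ / 2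

/-- The angle between a point of an inner orbit and the direction opposite to its pericentre. -/
noncomputable def innerAngle (E h μ r L : ℝ) : ℝ :=
  Complex.arg ⟨μ - L ^ 2 / r, L * innerSpeed E h μ r L⟩

theorem contDiffAt_arg {z : ℂ} (hz : z ∈ Complex.slitPlane) {n : WithTop ℕ∞} :
    ContDiffAt ℝ n Complex.arg z :=
  (Complex.imCLM.contDiff.contDiffAt.comp z
    ((Complex.contDiffAt_log hz).restrict_scalars ℝ)).congr_of_eventuallyEq
    (Eventually.of_forall fun z => (Complex.log_im z).symm)

theorem contDiff_mk {n : WithTop ℕ∞} : ContDiff ℝ n fun p : ℝ × ℝ => (⟨p.1, p.2⟩ : ℂ) :=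
  Complex.equivRealProdCLM.symm.contDiff

theorem hasDerivAt_mk {A B : ℝ → ℝ} {A' B' t : ℝ} (hA : HasDerivAt A A' t)
    (hB : HasDerivAt B B' t) : HasDerivAt (fun t => (⟨A t, B t⟩ : ℂ)) ⟨A', B'⟩ t :=
  HasFDerivAt.comp_hasDerivAt t Complex.equivRealProdCLM.symm.hasFDerivAt (hA.prodMk hB)

theorem hasDerivAt_arg {A B : ℝ → ℝ} {A' B' t : ℝ} (hA : HasDerivAt A A' t)
    (hB : HasDerivAt B B' t) (h : (⟨A t, B t⟩ : ℂ) ∈ Complex.slitPlane) :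
    HasDerivAt (fun t => Complex.arg ⟨A t, B t⟩)
      ((A t * B' - B t * A') / (A t ^ 2 + B t ^ 2)) t := by
  have h1 : HasDerivAt (fun t => (Complex.log ⟨A t, B t⟩).im) _ t :=
    Complex.imCLM.hasFDerivAt.comp_hasDerivAt t ((hasDerivAt_mk hA hB).clog_real h)
  simp only [Complex.log_im] at h1
  convert! h1 using 1
  simp only [Complex.imCLM_apply, Complex.div_im, Complex.normSq_mk]
  ring

variable {E h μ ω Λ : ℝ}

/-- For L ≠ 0 the imaginary part does not vanish because the radial speed is positive; for L = 0 the
number is E > 0. So the branch cut is never met and the angle is smooth through radial orbits. -/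
theorem outerAngle_mem_slitPlane (hE : 0 < E) {r L : ℝ} (hr : 0 < r)
    (hq : 0 < 2 * E - ω ^ 2 * r ^ 2 - L ^ 2 / r ^ 2) :
    (⟨E - L ^ 2 / r ^ 2, L * outerSpeed E ω r L / r⟩ : ℂ) ∈ Complex.slitPlane := by
  rw [Complex.mem_slitPlane_iff]
  have hp : outerSpeed E ω r L ≠ 0 := (Real.sqrt_pos.2 hq).ne'
  rcases eq_or_ne L 0 with rfl | hL
  · left; simpa using hE
  · right; simp only; positivity

theorem innerAngle_mem_slitPlane (hμ : 0 < μ) {r L : ℝ}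
    (hq : 0 < 2 * (E + h) + 2 * μ / r - L ^ 2 / r ^ 2) :
    (⟨μ - L ^ 2 / r, L * innerSpeed E h μ r L⟩ : ℂ) ∈ Complex.slitPlane := by
  rw [Complex.mem_slitPlane_iff]
  have hp : innerSpeed E h μ r L ≠ 0 := (Real.sqrt_pos.2 hq).ne'
  rcases eq_or_ne L 0 with rfl | hL
  · left; simpa using hμ
  · right; simp only; positivity

/-- Both radial speeds have this form. This is the ∂P/∂L side of the identity ∂P/∂L = ∂Θ/∂r;
`hasDerivAt_outerAngle` and `hasDerivAt_innerAngle` give the other side. -/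
theorem hasDerivAt_sqrt_sub_sq {c r L : ℝ} (hq : 0 < c - L ^ 2 / r ^ 2) :
    HasDerivAt (fun L => √(c - L ^ 2 / r ^ 2)) (-L / (r ^ 2 * √(c - L ^ 2 / r ^ 2))) L := by
  have h1 : HasDerivAt (fun L => c - L ^ 2 / r ^ 2) (-(2 * L / r ^ 2)) L := by
    simpa using ((hasDerivAt_pow 2 L).div_const (r ^ 2)).const_sub c
  convert! h1.sqrt hq.ne' using 1
  have := (Real.sqrt_pos.2 hq).ne'
  field_simp

theorem hasDerivAt_outerAngle (hE : 0 < E) {r L : ℝ} (hr : 0 < r)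
    (hq : 0 < 2 * E - ω ^ 2 * r ^ 2 - L ^ 2 / r ^ 2) :
    HasDerivAt (fun r => outerAngle E ω r L) (-L / (r ^ 2 * outerSpeed E ω r L)) r := by
  have hs := outerAngle_mem_slitPlane hE hr hq
  have hp : 0 < outerSpeed E ω r L := Real.sqrt_pos.2 hq
  have hp2 : outerSpeed E ω r L ^ 2 = 2 * E - ω ^ 2 * r ^ 2 - L ^ 2 / r ^ 2 := Real.sq_sqrt hq.le
  have d0 : HasDerivAt (fun r : ℝ => L ^ 2 / r ^ 2) (-(2 * L ^ 2 / r ^ 3)) r := by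
    convert! (hasDerivAt_const r (L ^ 2)).div (hasDerivAt_pow 2 r) (by positivity) using 1
    field_simp
    simp [mul_comm]
  have d1 : HasDerivAt (fun r => outerSpeed E ω r L)
      ((-ω ^ 2 * r + L ^ 2 / r ^ 3) / outerSpeed E ω r L) r := by
    have : HasDerivAt (fun r => 2 * E - ω ^ 2 * r ^ 2 - L ^ 2 / r ^ 2)
        (-(ω ^ 2 * (2 * r)) - -(2 * L ^ 2 / r ^ 3)) r := by
      refine HasDerivAt.sub ?_ d0
      simpa using ((hasDerivAt_pow 2 r).const_mul (ω ^ 2)).const_sub (2 * E)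
    convert! this.sqrt hq.ne' using 1
    rw [← outerSpeed]
    field_simp
    ring
  have d3 : HasDerivAt (fun r => L * outerSpeed E ω r L / r)
      ((L * ((-ω ^ 2 * r + L ^ 2 / r ^ 3) / outerSpeed E ω r L) * r -
        L * outerSpeed E ω r L) / r ^ 2) r := by
    simpa using (d1.const_mul L).fun_div (hasDerivAt_id' r) hr.ne'
  have d2 := (hasDerivAt_arg (d0.const_sub E) d3 hs).div_const 2
  convert! d2 using 1
  have hne : (E - L ^ 2 / r ^ 2) ^ 2 + (L * outerSpeed E ω r L / r) ^ 2 ≠ 0 := by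
    have := Complex.normSq_pos.2 (Complex.slitPlane_ne_zero hs)
    rw [Complex.normSq_apply] at this
    simp only at this
    nlinarith
  have e : outerSpeed E ω r L ^ 2 * r ^ 2 = 2 * E * r ^ 2 - ω ^ 2 * r ^ 4 - L ^ 2 := by
    rw [hp2]; field_simp
  generalize outerSpeed E ω r L = p at *
  rw [div_div, div_eq_div_iff (by positivity) (mul_ne_zero hne two_ne_zero)]
  field_simp
  linear_combination (L * (E * r ^ 2 - L ^ 2)) * e

theorem hasDerivAt_innerAngle (hμ : 0 < μ) {r L : ℝ} (hr : 0 < r)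
    (hq : 0 < 2 * (E + h) + 2 * μ / r - L ^ 2 / r ^ 2) :
    HasDerivAt (fun r => innerAngle E h μ r L) (-L / (r ^ 2 * innerSpeed E h μ r L)) r := by
  have hs := innerAngle_mem_slitPlane hμ hq
  have hp : 0 < innerSpeed E h μ r L := Real.sqrt_pos.2 hq
  have hp2 : innerSpeed E h μ r L ^ 2 = 2 * (E + h) + 2 * μ / r - L ^ 2 / r ^ 2 :=
    Real.sq_sqrt hq.le
  have d0 : HasDerivAt (fun r : ℝ => L ^ 2 / r) (-(L ^ 2 / r ^ 2)) r := by
    convert! (hasDerivAt_const r (L ^ 2)).div (hasDerivAt_id r) hr.ne' using 1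
    simp
    ring
  have d1 : HasDerivAt (fun r => innerSpeed E h μ r L)
      ((-μ / r ^ 2 + L ^ 2 / r ^ 3) / innerSpeed E h μ r L) r := by
    have : HasDerivAt (fun r => 2 * (E + h) + 2 * μ / r - L ^ 2 / r ^ 2)
        (-(2 * μ / r ^ 2) + 2 * L ^ 2 / r ^ 3) r := by
      have a1 := (((hasDerivAt_const r (2 * μ)).div (hasDerivAt_id r) hr.ne').const_add
        (2 * (E + h))).sub ((hasDerivAt_const r (L ^ 2)).div (hasDerivAt_pow 2 r) (by positivity))
      convert! a1 using 1
      simp only [id]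
      field_simp
      simp
      ring
    convert! this.sqrt hq.ne' using 1
    rw [← innerSpeed]
    field_simp
  have d2 := hasDerivAt_arg (d0.const_sub μ) (d1.const_mul L) hs
  convert! d2 using 1
  have hne : (μ - L ^ 2 / r) ^ 2 + (L * innerSpeed E h μ r L) ^ 2 ≠ 0 := by
    have := Complex.normSq_pos.2 (Complex.slitPlane_ne_zero hs)
    rw [Complex.normSq_apply] at this
    simp only at this
    nlinarith
  generalize innerSpeed E h μ r L = p at *
  rw [div_eq_div_iff (by positivity) hne]
  field_simp
  ring

/-- The common `L`-derivative of a radial speed `p` and `r`-derivative of its angle. -/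
noncomputable def speedDeriv (p : ℝ → ℝ → ℝ) (r L : ℝ) : ℝ := -L / (r ^ 2 * p r L)

theorem sub_sq_div_pos {c r L : ℝ} (hL : L ∈ Icc (-Λ) Λ) (hq : 0 < c - Λ ^ 2 / r ^ 2) :
    0 < c - L ^ 2 / r ^ 2 := by
  have h1 : L ^ 2 / r ^ 2 ≤ Λ ^ 2 / r ^ 2 := by
    have : L ^ 2 ≤ Λ ^ 2 := sq_le_sq' hL.1 hL.2
    gcongr
  linarith

theorem exists_bound_speed {p : ℝ → ℝ → ℝ} {r₁ r₂ : ℝ} (hr₁ : 0 < r₁)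
    (hp : ∀ r ∈ Icc r₁ r₂, ∀ L ∈ Icc (-Λ) Λ, 0 < p r L)
    (hc : ∀ r ∈ Icc r₁ r₂, ∀ L ∈ Icc (-Λ) Λ, ContinuousAt (Function.uncurry p) (r, L)) :
    ∃ M, 0 ≤ M ∧ ∀ r ∈ Icc r₁ r₂, ∀ L ∈ Icc (-Λ) Λ, |p r L| ≤ M ∧ |speedDeriv p r L| ≤ M := by
  have hK : IsCompact (Icc r₁ r₂ ×ˢ Icc (-Λ) Λ) := isCompact_Icc.prod isCompact_Icc
  have c1 : ContinuousOn (Function.uncurry p) (Icc r₁ r₂ ×ˢ Icc (-Λ) Λ) := fun x hx =>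
    (hc x.1 hx.1 x.2 hx.2).continuousWithinAt
  have c2 : ContinuousOn (fun x : ℝ × ℝ => -x.2 / (x.1 ^ 2 * Function.uncurry p x))
      (Icc r₁ r₂ ×ˢ Icc (-Λ) Λ) := by
    refine ContinuousOn.div (by fun_prop) (ContinuousOn.mul (by fun_prop) c1) fun x hx => ?_
    exact mul_ne_zero (pow_ne_zero 2 (hr₁.trans_le hx.1.1).ne') (hp x.1 hx.1 x.2 hx.2).ne'
  obtain ⟨M₁, h1⟩ := hK.exists_bound_of_continuousOn c1
  obtain ⟨M₂, h2⟩ := hK.exists_bound_of_continuousOn c2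
  refine ⟨max 0 (max M₁ M₂), le_max_left _ _, fun r hr L hL => ⟨?_, ?_⟩⟩
  · exact (h1 (r, L) ⟨hr, hL⟩).trans ((le_max_left _ _).trans (le_max_right _ _))
  · exact (h2 (r, L) ⟨hr, hL⟩).trans ((le_max_right _ _).trans (le_max_right _ _))

theorem contDiffAt_outerSpeed {n : WithTop ℕ∞} {r L : ℝ} (hr : 0 < r)
    (hq : 0 < 2 * E - ω ^ 2 * r ^ 2 - L ^ 2 / r ^ 2) :
    ContDiffAt ℝ n (Function.uncurry (outerSpeed E ω)) (r, L) := by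
  refine ContDiffAt.sqrt (f := fun x : ℝ × ℝ => 2 * E - ω ^ 2 * x.1 ^ 2 - x.2 ^ 2 / x.1 ^ 2)
    ?_ hq.ne'
  exact ContDiffAt.sub (by fun_prop) (ContDiffAt.div (by fun_prop) (by fun_prop)
    (pow_ne_zero 2 hr.ne'))

theorem contDiffAt_innerSpeed {n : WithTop ℕ∞} {r L : ℝ} (hr : 0 < r)
    (hq : 0 < 2 * (E + h) + 2 * μ / r - L ^ 2 / r ^ 2) :
    ContDiffAt ℝ n (Function.uncurry (innerSpeed E h μ)) (r, L) := by
  refine ContDiffAt.sqrt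
    (f := fun x : ℝ × ℝ => 2 * (E + h) + 2 * μ / x.1 - x.2 ^ 2 / x.1 ^ 2) ?_ hq.ne'
  exact ContDiffAt.sub (ContDiffAt.add (by fun_prop)
    (ContDiffAt.div (by fun_prop) (by fun_prop) hr.ne'))
    (ContDiffAt.div (by fun_prop) (by fun_prop) (pow_ne_zero 2 hr.ne'))

theorem contDiffAt_outerAngle {n : WithTop ℕ∞} (hE : 0 < E) {r L : ℝ} (hr : 0 < r)
    (hq : 0 < 2 * E - ω ^ 2 * r ^ 2 - L ^ 2 / r ^ 2) :
    ContDiffAt ℝ n (Function.uncurry (outerAngle E ω)) (r, L) := by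
  refine ContDiffAt.div_const (ContDiffAt.comp
    (f := fun x : ℝ × ℝ => (⟨E - x.2 ^ 2 / x.1 ^ 2,
      x.2 * Function.uncurry (outerSpeed E ω) x / x.1⟩ : ℂ)) (r, L)
    (contDiffAt_arg (outerAngle_mem_slitPlane hE hr hq))
    (contDiff_mk.contDiffAt.comp (r, L) (ContDiffAt.prodMk ?_ ?_))) 2
  · exact ContDiffAt.sub (by fun_prop) (ContDiffAt.div (by fun_prop) (by fun_prop)
      (pow_ne_zero 2 hr.ne'))
  · exact ContDiffAt.div (ContDiffAt.mul (by fun_prop) (contDiffAt_outerSpeed hr hq))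
      (by fun_prop) hr.ne'

theorem contDiffAt_innerAngle {n : WithTop ℕ∞} (hμ : 0 < μ) {r L : ℝ} (hr : 0 < r)
    (hq : 0 < 2 * (E + h) + 2 * μ / r - L ^ 2 / r ^ 2) :
    ContDiffAt ℝ n (Function.uncurry (innerAngle E h μ)) (r, L) := by
  refine ContDiffAt.comp
    (f := fun x : ℝ × ℝ => (⟨μ - x.2 ^ 2 / x.1,
      x.2 * Function.uncurry (innerSpeed E h μ) x⟩ : ℂ)) (r, L)
    (contDiffAt_arg (innerAngle_mem_slitPlane hμ hq))
    (contDiff_mk.contDiffAt.comp (r, L) (ContDiffAt.prodMk ?_ ?_))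
  · exact ContDiffAt.sub (by fun_prop) (ContDiffAt.div (by fun_prop) (by fun_prop) hr.ne')
  · exact ContDiffAt.mul (by fun_prop) (contDiffAt_innerSpeed hr hq)

/-- Bounds on distances and angular momenta that keep all orbits transversal to the circles. -/
structure TransversalRange (E h μ ω Λ r₁ r₂ : ℝ) : Prop where
  pos : 0 < r₁
  outer : ∀ r ∈ Icc r₁ r₂, 0 < 2 * E - ω ^ 2 * r ^ 2 - Λ ^ 2 / r ^ 2
  inner : ∀ r ∈ Icc r₁ r₂, 0 < 2 * (E + h) + 2 * μ / r - Λ ^ 2 / r ^ 2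

/-- At r = 1 the outer condition is `hΛ`, and V_E < V_I makes the inner one weaker. Both persist
near r = 1 by continuity. -/
theorem exists_transversalRange (hΛ : Λ ^ 2 < 2 * E - ω ^ 2) (hV : E - ω ^ 2 / 2 < E + h + μ) :
    ∃ r₁ r₂, r₁ < 1 ∧ 1 < r₂ ∧ TransversalRange E h μ ω Λ r₁ r₂ := by
  have c1 : ContinuousAt (fun r : ℝ => 2 * E - ω ^ 2 * r ^ 2 - Λ ^ 2 / r ^ 2) 1 :=
    ContinuousAt.sub (by fun_prop) (ContinuousAt.div (by fun_prop) (by fun_prop) (by norm_num))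
  have c2 : ContinuousAt (fun r : ℝ => 2 * (E + h) + 2 * μ / r - Λ ^ 2 / r ^ 2) 1 :=
    ContinuousAt.sub (ContinuousAt.add (by fun_prop) (ContinuousAt.div (by fun_prop)
      (by fun_prop) (by norm_num))) (ContinuousAt.div (by fun_prop) (by fun_prop) (by norm_num))
  have e1 : ∀ᶠ r in 𝓝 (1 : ℝ), 0 < 2 * E - ω ^ 2 * r ^ 2 - Λ ^ 2 / r ^ 2 :=
    continuousAt_const.eventually_lt c1 (by norm_num; linarith)
  have e2 : ∀ᶠ r in 𝓝 (1 : ℝ), 0 < 2 * (E + h) + 2 * μ / r - Λ ^ 2 / r ^ 2 :=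
    continuousAt_const.eventually_lt c2 (by norm_num; linarith)
  have e3 : ∀ᶠ r in 𝓝 (1 : ℝ), 0 < r := lt_mem_nhds one_pos
  obtain ⟨d, hd, hball⟩ := Metric.nhds_basis_closedBall.eventually_iff.1 (e1.and (e2.and e3))
  rw [Real.closedBall_eq_Icc] at hball
  exact ⟨1 - d, 1 + d, by linarith, by linarith,
    (hball (left_mem_Icc.2 (by linarith))).2.2, fun r hr => (hball hr).1,
    fun r hr => (hball hr).2.1⟩

theorem abs_half_arg_le (z : ℂ) : |z.arg / 2| ≤ Real.pi := by
  have := Complex.abs_arg_le_pi z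
  rw [abs_div, abs_two]
  linarith [Real.pi_pos]

variable {r₁ r₂ : ℝ}

namespace TransversalRange

theorem outer_pos (R : TransversalRange E h μ ω Λ r₁ r₂) {r L : ℝ} (hr : r ∈ Icc r₁ r₂)
    (hL : L ∈ Icc (-Λ) Λ) : 0 < 2 * E - ω ^ 2 * r ^ 2 - L ^ 2 / r ^ 2 :=
  sub_sq_div_pos hL (R.outer r hr)

theorem inner_pos (R : TransversalRange E h μ ω Λ r₁ r₂) {r L : ℝ} (hr : r ∈ Icc r₁ r₂)
    (hL : L ∈ Icc (-Λ) Λ) : 0 < 2 * (E + h) + 2 * μ / r - L ^ 2 / r ^ 2 :=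
  sub_sq_div_pos hL (R.inner r hr)

/-- `M` comes from compactness and does not depend on `δ`, so `δ * M` can be made small afterwards.
-/
theorem exists_sectionChart (R : TransversalRange E h μ ω Λ r₁ r₂) (hE : 0 < E) (hμ : 0 < μ) :
    ∃ M, ∀ δ, δ * M < 1 → 0 ≤ M ∧
      SectionChart Λ r₁ r₂ δ M (outerSpeed E ω) (outerAngle E ω) (speedDeriv (outerSpeed E ω)) ∧
      SectionChart Λ r₁ r₂ δ M (innerSpeed E h μ) (innerAngle E h μ)
        (speedDeriv (innerSpeed E h μ)) := by
  have hpos : ∀ r ∈ Icc r₁ r₂, 0 < r := fun r hr => R.pos.trans_le hr.1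
  obtain ⟨M₁, h1, hb1⟩ := exists_bound_speed (p := outerSpeed E ω) R.pos
    (fun r hr L hL => Real.sqrt_pos.2 (R.outer_pos hr hL)) fun r hr L hL =>
    (contDiffAt_outerSpeed (n := 0) (hpos r hr) (R.outer_pos hr hL)).continuousAt
  obtain ⟨M₂, h2, hb2⟩ := exists_bound_speed (p := innerSpeed E h μ) R.pos
    (fun r hr L hL => Real.sqrt_pos.2 (R.inner_pos hr hL)) fun r hr L hL =>
    (contDiffAt_innerSpeed (n := 0) (hpos r hr) (R.inner_pos hr hL)).continuousAt
  refine ⟨max M₁ M₂, fun δ hδ => ⟨h1.trans (le_max_left _ _), ?_, ?_⟩⟩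
  · exact
    { nonneg := h1.trans (le_max_left _ _)
      mul_lt_one := hδ
      contDiffAt_P := fun r hr L hL => contDiffAt_outerSpeed (hpos r hr) (R.outer_pos hr hL)
      contDiffAt_Θ := fun r hr L hL => contDiffAt_outerAngle hE (hpos r hr) (R.outer_pos hr hL)
      hasDerivAt_P := fun r hr L hL => hasDerivAt_sqrt_sub_sq (R.outer_pos hr hL)
      hasDerivAt_Θ := fun r hr L hL => hasDerivAt_outerAngle hE (hpos r hr) (R.outer_pos hr hL)
      abs_P_le := fun r hr L hL => (hb1 r hr L hL).1.trans (le_max_left _ _)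
      abs_Q_le := fun r hr L hL => (hb1 r hr L hL).2.trans (le_max_left _ _)
      abs_Θ_le := fun r L => abs_half_arg_le _ }
  · exact
    { nonneg := h1.trans (le_max_left _ _)
      mul_lt_one := hδ
      contDiffAt_P := fun r hr L hL => contDiffAt_innerSpeed (hpos r hr) (R.inner_pos hr hL)
      contDiffAt_Θ := fun r hr L hL => contDiffAt_innerAngle hμ (hpos r hr) (R.inner_pos hr hL)
      hasDerivAt_P := fun r hr L hL => hasDerivAt_sqrt_sub_sq (R.inner_pos hr hL)
      hasDerivAt_Θ := fun r hr L hL => hasDerivAt_innerAngle hμ (hpos r hr) (R.inner_pos hr hL)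
      abs_P_le := fun r hr L hL => (hb2 r hr L hL).1.trans (le_max_right _ _)
      abs_Q_le := fun r hr L hL => (hb2 r hr L hL).2.trans (le_max_right _ _)
      abs_Θ_le := fun r L => Complex.abs_arg_le_pi _ }

end TransversalRange

/-! ### The shift of the unit disk in terms of the axis angles. -/

theorem arccot_div_sub {A B : ℝ} (hB : B ≠ 0) :
    arccot (A / B) - (if 0 < B then 0 else Real.pi) = Complex.arg ⟨A, B⟩ := by
  set θ := Complex.arg ⟨A, B⟩ with hθ
  have ht : Real.tan θ = B / A := Complex.tan_arg _
  rcases hB.lt_or_gt with h | h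
  · have h1 : θ < 0 := Complex.arg_neg_iff.2 h
    have h2 : -Real.pi < θ := Complex.neg_pi_lt_arg _
    have h3 : Real.arctan (A / B) = Real.pi / 2 - (θ + Real.pi) := by
      rw [← Real.arctan_tan (x := Real.pi / 2 - (θ + Real.pi)) (by linarith) (by linarith),
        Real.tan_pi_div_two_sub, Real.tan_add_pi, ht, inv_div]
    rw [if_neg h.le.not_gt, arccot, h3]
    ring
  · have h1 : 0 < θ := by
      refine (Complex.arg_nonneg_iff.2 h.le).lt_of_ne fun h0 => ?_
      exact hB (Complex.arg_eq_zero_iff.1 h0.symm).2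
    have h2 : θ < Real.pi := by
      refine (Complex.arg_le_pi _).lt_of_ne fun h0 => ?_
      exact hB (Complex.arg_eq_pi_iff.1 h0).2
    have h3 : Real.arctan (A / B) = Real.pi / 2 - θ := by
      rw [← Real.arctan_tan (x := Real.pi / 2 - θ) (by linarith) (by linarith),
        Real.tan_pi_div_two_sub, ht, inv_div]
    rw [if_pos h, arccot, h3]
    ring

/-- The shift of the unit disk is the sum of the angles spanned by the two arcs. -/
theorem totalShift_eq (hE : 0 < E) (hμ : 0 < μ)
    (hV : E - ω ^ 2 / 2 < E + h + μ) {I : ℝ} (hI : I ∈ actionInterval E ω) :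
    totalShift E h μ ω I = 2 * outerAngle E ω 1 (√2 * I) - 2 * innerAngle E h μ 1 (√2 * I) := by
  have h2 : (√2 * I) ^ 2 = 2 * I ^ 2 := by
    rw [mul_pow, Real.sq_sqrt (by norm_num)]
  have hI2 : I ^ 2 < E - ω ^ 2 / 2 := by
    have h0 : 0 < E - ω ^ 2 / 2 := Real.sqrt_pos.1 (by linarith [hI.1, hI.2])
    have := sq_lt_sq' hI.1 hI.2
    rwa [Real.sq_sqrt h0.le] at this
  have ho : outerShift E ω I = 2 * outerAngle E ω 1 (√2 * I) := by
    have e : √2 * I * outerSpeed E ω 1 (√2 * I) = I * √(4 * E - 2 * (2 * I ^ 2 + ω ^ 2)) := by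
      rw [outerSpeed, h2, mul_comm √2 I, mul_assoc, ← Real.sqrt_mul (by norm_num)]
      ring_nf
    rw [outerAngle, h2, e, outerShift]
    split_ifs with h0 h1
    · subst h0
      have : Complex.arg ⟨E, 0⟩ = 0 := Complex.arg_ofReal_of_nonneg hE.le
      simp [this]
    all_goals
      have hs : 0 < √(4 * E - 2 * (2 * I ^ 2 + ω ^ 2)) := Real.sqrt_pos.2 (by linarith)
      -- `outerAngle` is half an argument, and the arccotangent with its jump by π is exactly that
      -- argument.
      have := arccot_div_sub (A := E - 2 * I ^ 2) (mul_ne_zero h0 hs.ne')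
      rw [if_congr (mul_pos_iff_of_pos_right hs) rfl rfl] at this
      simp only [h1, if_true, if_false] at this
      rw [this]
      norm_num
      ring
  have hi : innerShift E h μ I = -2 * innerAngle E h μ 1 (√2 * I) := by
    have hs : 0 < 2 * (E + h) + 2 * μ / 1 - (√2 * I) ^ 2 / 1 ^ 2 := by
      rw [h2]; norm_num; linarith
    have hp : 0 < innerSpeed E h μ 1 (√2 * I) := Real.sqrt_pos.2 hs
    have hp2 : innerSpeed E h μ 1 (√2 * I) ^ 2 = 2 * (E + h) + 2 * μ - 2 * I ^ 2 := by
      rw [innerSpeed, Real.sq_sqrt hs.le, h2]; norm_num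
    -- The denominator in `innerShift` is the modulus of the number whose argument is `innerAngle`,
    -- so the arccosine recovers that argument up to sign and the reflection arccos(-x) = π - arccos
    -- x.
    have hn : ‖(⟨μ - (√2 * I) ^ 2 / 1, √2 * I * innerSpeed E h μ 1 (√2 * I)⟩ : ℂ)‖ =
        √(4 * (E + h) * I ^ 2 + μ ^ 2) := by
      rw [Complex.norm_eq_sqrt_sq_add_sq]
      simp only [h2, mul_pow (√2 * I), hp2]
      ring_nf
    have hneg : (2 * I ^ 2 - μ) / √(4 * (E + h) * I ^ 2 + μ ^ 2) =
        -((μ - (√2 * I) ^ 2 / 1) / √(4 * (E + h) * I ^ 2 + μ ^ 2)) := by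
      rw [h2]; ring
    have h20 : 0 < √(2 : ℝ) := Real.sqrt_pos.2 (by norm_num)
    rw [innerAngle, innerShift]
    split_ifs with h0 h1
    · subst h0
      have : Complex.arg ⟨μ, 0⟩ = 0 := Complex.arg_ofReal_of_nonneg hμ.le
      simp [this]
    · rw [Complex.arg_of_im_nonneg_of_ne_zero (by simp only; positivity), hn, hneg,
        Real.arccos_neg]
      · ring
      · exact fun hz => (by positivity : √2 * I * innerSpeed E h μ 1 (√2 * I) ≠ 0)
          (congrArg Complex.im hz)
    · have h3 : I < 0 := lt_of_le_of_ne (not_lt.1 h1) h0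
      rw [Complex.arg_of_im_neg (mul_neg_of_neg_of_pos (mul_neg_of_pos_of_neg h20 h3) hp), hn,
        hneg, Real.arccos_neg]
      ring
  rw [totalShift, ho, hi]
  ring

end RefractionBilliard

/-! ### Velocities and orbit branches relative to a near-circular curve. -/

namespace RefractionBilliard

open Set Filter Topology

variable {Λ r₁ r₂ δ M : ℝ} {P Θ Q : ℝ → ℝ → ℝ} {ρ : ℝ → ℝ}

/-- The velocity with radial component `a` and angular momentum `L` at the point `γ(ξ)`. -/
noncomputable def orbitVelocity (ρ : ℝ → ℝ) (ξ a L : ℝ) : ℂ :=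
  ⟨a, L / ρ ξ⟩ * Complex.exp (ξ * Complex.I)

theorem inner_mul_exp (z w : ℂ) (ξ : ℝ) :
    inner ℝ (z * Complex.exp (ξ * Complex.I)) (w * Complex.exp (ξ * Complex.I)) =
      z.re * w.re + z.im * w.im := by
  have h : Complex.exp (ξ * Complex.I) * (starRingEnd ℂ) (Complex.exp (ξ * Complex.I)) = 1 := by
    rw [Complex.mul_conj, Complex.normSq_eq_norm_sq, Complex.norm_exp_ofReal_mul_I]
    simp
  have e : w * Complex.exp (ξ * Complex.I) *
      (starRingEnd ℂ) (z * Complex.exp (ξ * Complex.I)) = w * (starRingEnd ℂ) z := by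
    rw [map_mul]
    linear_combination (w * (starRingEnd ℂ) z) * h
  rw [Complex.inner, e]
  simp
  ring

theorem exp_add_period (ξ : ℝ) (n : ℤ) :
    Complex.exp (((ξ + n * (2 * Real.pi) : ℝ) : ℂ) * Complex.I) =
      Complex.exp (ξ * Complex.I) := by
  rw [Complex.exp_eq_exp_iff_exists_int]
  exact ⟨n, by push_cast; ring⟩

theorem exists_period_of_exp_eq {ξ η : ℝ}
    (h : Complex.exp (ξ * Complex.I) = Complex.exp (η * Complex.I)) :
    ∃ n : ℤ, ξ = η + n * (2 * Real.pi) := by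
  obtain ⟨n, hn⟩ := Complex.exp_eq_exp_iff_exists_int.1 h
  refine ⟨n, ?_⟩
  have := congrArg Complex.im hn
  simpa using this

theorem exists_period_of_mul_exp_eq {r s ξ η : ℝ} (hr : 0 < r) (hs : 0 < s)
    (h : (r : ℂ) * Complex.exp (ξ * Complex.I) = s * Complex.exp (η * Complex.I)) :
    ∃ n : ℤ, ξ = η + n * (2 * Real.pi) := by
  have h1 : r = s := by
    have := congrArg norm h
    simpa [Complex.norm_exp_ofReal_mul_I, abs_of_pos hr, abs_of_pos hs] using this
  subst h1
  exact exists_period_of_exp_eq (mul_left_cancel₀ (Complex.ofReal_ne_zero.2 hr.ne') h)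

theorem periodic_arg (hρ : Function.Periodic ρ (2 * Real.pi)) {r : ℝ} (hr : 0 < r) (φ : ℝ) :
    ρ (Complex.arg (r * Complex.exp (φ * Complex.I))) = ρ φ := by
  set z := (r : ℂ) * Complex.exp (φ * Complex.I) with hz
  have hn : 0 < ‖z‖ := by
    rw [norm_pos_iff]
    exact mul_ne_zero (Complex.ofReal_ne_zero.2 hr.ne') (Complex.exp_ne_zero _)
  obtain ⟨n, h⟩ := exists_period_of_mul_exp_eq hn hr ((Complex.norm_mul_exp_arg_mul_I z).trans hz)
  rw [h, hρ.int_mul n]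

namespace NearCircle

theorem tangentVec_eq (N : NearCircle r₁ r₂ δ ρ) (ξ : ℝ) :
    tangentVec ρ ξ = ⟨deriv ρ ξ, ρ ξ⟩ * Complex.exp (ξ * Complex.I) := by
  have h1 : HasDerivAt (fun ξ : ℝ => (ρ ξ : ℂ)) ((deriv ρ ξ : ℝ) : ℂ) ξ :=
    (N.differentiable ξ).hasDerivAt.ofReal_comp
  have h2 : HasDerivAt (fun ξ : ℝ => Complex.exp (ξ * Complex.I))
      (Complex.exp (ξ * Complex.I) * (1 * Complex.I)) ξ :=
    ((hasDerivAt_id ξ).ofReal_comp.mul_const Complex.I).cexp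
  rw [tangentVec]
  refine (h1.mul h2).deriv.trans ?_
  rw [Complex.mk_eq_add_mul_I]
  ring

theorem normalVec_eq (N : NearCircle r₁ r₂ δ ρ) (ξ : ℝ) :
    normalVec ρ ξ = ⟨ρ ξ, -deriv ρ ξ⟩ * Complex.exp (ξ * Complex.I) := by
  rw [normalVec, N.tangentVec_eq, Complex.mk_eq_add_mul_I, Complex.mk_eq_add_mul_I]
  push_cast
  linear_combination (-(ρ ξ : ℂ) * Complex.exp (ξ * Complex.I)) * Complex.I_mul_I

theorem boundaryCurve_add_period (N : NearCircle r₁ r₂ δ ρ) (ξ : ℝ) (n : ℤ) :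
    boundaryCurve ρ (ξ + n * (2 * Real.pi)) = boundaryCurve ρ ξ := by
  rw [boundaryCurve, boundaryCurve, N.periodic.int_mul n, exp_add_period]

theorem tangentVec_add_period (N : NearCircle r₁ r₂ δ ρ) (ξ : ℝ) (n : ℤ) :
    tangentVec ρ (ξ + n * (2 * Real.pi)) = tangentVec ρ ξ := by
  rw [N.tangentVec_eq, N.tangentVec_eq, N.periodic.int_mul n, N.deriv_periodic.int_mul n,
    exp_add_period]

theorem normalVec_add_period (N : NearCircle r₁ r₂ δ ρ) (ξ : ℝ) (n : ℤ) :
    normalVec ρ (ξ + n * (2 * Real.pi)) = normalVec ρ ξ := by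
  rw [normalVec, normalVec, N.tangentVec_add_period]

theorem inner_orbitVelocity_tangentVec (N : NearCircle r₁ r₂ δ ρ) (ξ a L : ℝ) :
    inner ℝ (orbitVelocity ρ ξ a L) (tangentVec ρ ξ) = L + a * deriv ρ ξ := by
  have := (N.radius_pos ξ).ne'
  rw [orbitVelocity, N.tangentVec_eq, inner_mul_exp]
  field_simp
  ring

theorem inner_orbitVelocity_normalVec (N : NearCircle r₁ r₂ δ ρ) (ξ a L : ℝ) :
    inner ℝ (orbitVelocity ρ ξ a L) (normalVec ρ ξ) = a * ρ ξ - L / ρ ξ * deriv ρ ξ := by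
  rw [orbitVelocity, N.normalVec_eq, inner_mul_exp]
  ring

theorem exists_eq_orbitVelocity (N : NearCircle r₁ r₂ δ ρ) (ξ : ℝ) (v : ℂ) :
    ∃ a L, v = orbitVelocity ρ ξ a L := by
  have := (N.radius_pos ξ).ne'
  refine ⟨(v * Complex.exp (-(ξ * Complex.I))).re, (v * Complex.exp (-(ξ * Complex.I))).im * ρ ξ,
    ?_⟩
  rw [orbitVelocity, mul_div_cancel_right₀ _ this, Complex.eta, mul_assoc, ← Complex.exp_add]
  simp

theorem norm_boundaryCurve (N : NearCircle r₁ r₂ δ ρ) (ξ : ℝ) : ‖boundaryCurve ρ ξ‖ = ρ ξ := by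
  rw [boundaryCurve, norm_mul, Complex.norm_exp_ofReal_mul_I, mul_one,
    Complex.norm_of_nonneg (N.radius_pos ξ).le]

theorem exists_period_of_boundaryCurve_eq (N : NearCircle r₁ r₂ δ ρ) {ξ η : ℝ}
    (h : boundaryCurve ρ ξ = boundaryCurve ρ η) :
    ∃ n : ℤ, ξ = η + n * (2 * Real.pi) :=
  exists_period_of_mul_exp_eq (N.radius_pos ξ) (N.radius_pos η) h

theorem radius_arg_boundaryCurve (N : NearCircle r₁ r₂ δ ρ) (ξ : ℝ) :
    ρ (Complex.arg (boundaryCurve ρ ξ)) = ‖boundaryCurve ρ ξ‖ := by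
  rw [N.norm_boundaryCurve, boundaryCurve, periodic_arg N.periodic (N.radius_pos ξ)]

end NearCircle

theorem norm_sq_orbitVelocity (ξ a L : ℝ) :
    ‖orbitVelocity ρ ξ a L‖ ^ 2 = a ^ 2 + L ^ 2 / ρ ξ ^ 2 := by
  rw [orbitVelocity, norm_mul, Complex.norm_exp_ofReal_mul_I, mul_one,
    ← Complex.normSq_eq_norm_sq, Complex.normSq_mk]
  ring

namespace SectionChart

/-- This is |Q s| < 1 with denominators cleared. It is the transversality that lets the radial speed
decide the sign of the normal component. -/
theorem abs_mul_lt {p : ℝ → ℝ → ℝ} (D : SectionChart Λ r₁ r₂ δ M p Θ (speedDeriv p))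
    {r L s : ℝ} (hr₁ : 0 < r₁) (hr : r ∈ Icc r₁ r₂) (hL : L ∈ Icc (-Λ) Λ) (hs : |s| < δ)
    (hp : 0 < p r L) : |L * s| < r ^ 2 * p r L := by
  have h := D.abs_mul_lt_one hr hL hs
  have hr0 : 0 < r := hr₁.trans_le hr.1
  have hpos : 0 < r ^ 2 * p r L := by positivity
  rw [speedDeriv, div_mul_eq_mul_div, abs_div, abs_of_pos hpos, div_lt_one hpos] at h
  simpa [abs_mul] using h

theorem inner_normalVec_pos {p : ℝ → ℝ → ℝ}
    (D : SectionChart Λ r₁ r₂ δ M p Θ (speedDeriv p)) (N : NearCircle r₁ r₂ δ ρ) {ξ L : ℝ}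
    (hL : L ∈ Icc (-Λ) Λ) (hp : 0 < p (ρ ξ) L) :
    0 < inner ℝ (orbitVelocity ρ ξ (p (ρ ξ) L) L) (normalVec ρ ξ) := by
  have h := abs_lt.1 (D.abs_mul_lt N.pos (N.mem_Icc ξ) hL (N.abs_deriv_lt ξ) hp)
  have hr := N.radius_pos ξ
  rw [N.inner_orbitVelocity_normalVec]
  have : L / ρ ξ * deriv ρ ξ < p (ρ ξ) L * ρ ξ := by
    rw [div_mul_eq_mul_div, div_lt_iff₀ hr]
    nlinarith [h.2]
  linarith

theorem inner_normalVec_neg {p : ℝ → ℝ → ℝ}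
    (D : SectionChart Λ r₁ r₂ δ M p Θ (speedDeriv p)) (N : NearCircle r₁ r₂ δ ρ) {ξ L : ℝ}
    (hL : L ∈ Icc (-Λ) Λ) (hp : 0 < p (ρ ξ) L) :
    inner ℝ (orbitVelocity ρ ξ (-p (ρ ξ) L) L) (normalVec ρ ξ) < 0 := by
  have h := abs_lt.1 (D.abs_mul_lt N.pos (N.mem_Icc ξ) hL (N.abs_deriv_lt ξ) hp)
  have hr := N.radius_pos ξ
  rw [N.inner_orbitVelocity_normalVec]
  have : -(p (ρ ξ) L * ρ ξ) < L / ρ ξ * deriv ρ ξ := by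
    rw [div_mul_eq_mul_div, lt_div_iff₀ hr]
    nlinarith [h.1]
  linarith

/-- On an energy level, a velocity with small tangential component is determined by that component
and by the side of the curve to which it points. -/
theorem eq_orbitVelocity {p : ℝ → ℝ → ℝ} {W : ℝ → ℝ}
    (D : SectionChart Λ r₁ r₂ δ M p Θ (speedDeriv p)) (N : NearCircle r₁ r₂ δ ρ)
    (hW : ∀ r L, p r L = √(W r - L ^ 2 / r ^ 2))
    (hpos : ∀ r ∈ Icc r₁ r₂, ∀ L ∈ Icc (-Λ) Λ, 0 < p r L) {ξ J : ℝ} {v : ℂ}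
    (hv : ‖v‖ ^ 2 = W (ρ ξ)) (hJ : inner ℝ v (tangentVec ρ ξ) = J) (hJΛ : |J| + δ * M < Λ) :
    (0 < inner ℝ v (normalVec ρ ξ) →
      v = orbitVelocity ρ ξ (p (ρ ξ) (solveMomentum p Λ (ρ ξ) (deriv ρ ξ) J))
        (solveMomentum p Λ (ρ ξ) (deriv ρ ξ) J)) ∧
    (inner ℝ v (normalVec ρ ξ) < 0 →
      v = orbitVelocity ρ ξ (-p (ρ ξ) (solveMomentum (-p) Λ (ρ ξ) (deriv ρ ξ) J))
        (solveMomentum (-p) Λ (ρ ξ) (deriv ρ ξ) J)) := by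
  obtain ⟨a, L, rfl⟩ := N.exists_eq_orbitVelocity ξ v
  have hr := N.mem_Icc ξ
  have hs := N.abs_deriv_lt ξ
  have hδM : 0 ≤ δ * M := mul_nonneg ((abs_nonneg _).trans hs.le) D.nonneg
  rw [norm_sq_orbitVelocity] at hv
  rw [N.inner_orbitVelocity_tangentVec] at hJ
  -- The energy bounds the radial component by the radial speed at L = 0, which `M` bounds. Only
  -- with this can `L = J - a ρ'` be located in the range of the chart.
  have ha : |a| ≤ M := by
    have h0 : (0 : ℝ) ∈ Icc (-Λ) Λ := by constructor <;> linarith [abs_nonneg J]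
    refine le_trans ?_ (D.abs_P_le _ hr 0 h0)
    rw [hW, abs_of_nonneg (Real.sqrt_nonneg _)]
    refine Real.abs_le_sqrt ?_
    have : 0 ≤ L ^ 2 / ρ ξ ^ 2 := by positivity
    rw [← hv]
    norm_num
    linarith
  have h1 : |a * deriv ρ ξ| ≤ δ * M := by
    rw [abs_mul, mul_comm]
    exact mul_le_mul hs.le ha (abs_nonneg _) ((abs_nonneg _).trans hs.le)
  have hL : L ∈ Icc (-Λ) Λ := by
    rw [mem_Icc, ← abs_le]
    have : |L| = |J - a * deriv ρ ξ| := by congr 1; linarith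
    linarith [abs_sub J (a * deriv ρ ξ)]
  have hp := hpos _ hr _ hL
  have hpa : p (ρ ξ) L = |a| := by
    rw [hW, ← Real.sqrt_sq_eq_abs]
    congr 1
    linarith
  -- The energy fixes |a|; the two signs give velocities pointing to opposite sides of the curve.
  have hn := D.inner_normalVec_neg N hL hp
  have hn' := D.inner_normalVec_pos N hL hp
  constructor
  · intro h
    have hap : a = p (ρ ξ) L := by
      rcases abs_choice a with h2 | h2
      · rw [hpa, h2]
      · rw [show a = -p (ρ ξ) L by rw [hpa, h2, neg_neg]] at h
        exact absurd h hn.not_gt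
    subst hap
    rw [← D.eq_solveMomentum hr hs hJΛ hL hJ]
  · intro h
    have hap : a = -p (ρ ξ) L := by
      rcases abs_choice a with h2 | h2
      · rw [show a = p (ρ ξ) L by rw [hpa, h2]] at h
        exact absurd h hn'.not_gt
      · rw [hpa, h2, neg_neg]
    subst hap
    rw [← D.neg.eq_solveMomentum hr hs hJΛ hL hJ]

/-- On one half of an orbit the polar angle at distance r is g - Θ(r, L), so the derivative is again
1 + Q ρ' > 0. Hence such a half crosses the curve at most once. -/
theorem strictMonoOn_radius (D : SectionChart Λ r₁ r₂ δ M P Θ Q) (N : NearCircle r₁ r₂ δ ρ)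
    {L : ℝ} (hL : L ∈ Icc (-Λ) Λ) (g : ℝ) :
    StrictMonoOn (fun r => r - ρ (g - Θ r L)) (Icc r₁ r₂) := by
  have hd : ∀ r ∈ Icc r₁ r₂, HasDerivAt (fun r => r - ρ (g - Θ r L))
      (1 + Q r L * deriv ρ (g - Θ r L)) r := by
    intro r hr
    have h1 := (N.differentiable (g - Θ r L)).hasDerivAt.comp r
      ((D.hasDerivAt_Θ r hr L hL).const_sub g)
    convert! (hasDerivAt_id r).sub h1 using 1
    ring
  refine strictMonoOn_of_deriv_pos (convex_Icc _ _)
    (fun r hr => (hd r hr).continuousAt.continuousWithinAt) fun r hr => ?_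
  have hr' := interior_subset hr
  rw [(hd r hr').deriv]
  exact D.one_add_mul_pos hr' hL (N.abs_deriv_lt _)

/-- Beyond `r₂` the chart is not available, but there the bound on the curve itself suffices. -/
theorem radius_lt_of_lt (D : SectionChart Λ r₁ r₂ δ M P Θ Q) (N : NearCircle r₁ r₂ δ ρ)
    {L g ξ r : ℝ} (hL : L ∈ Icc (-Λ) Λ) (h : ξ + Θ (ρ ξ) L = g) (hr : ρ ξ < r) :
    ρ (g - Θ r L) < r := by
  rcases le_or_gt r r₂ with h2 | h2
  · have := D.strictMonoOn_radius N hL g (N.mem_Icc ξ) ⟨(N.mem_Icc ξ).1.trans hr.le, h2⟩ hr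
    have h3 : g - Θ (ρ ξ) L = ξ := by linarith
    simp only [h3, sub_self, sub_pos] at this
    exact this
  · exact (N.mem_Ioo _).2.trans h2

theorem lt_radius_of_lt (D : SectionChart Λ r₁ r₂ δ M P Θ Q) (N : NearCircle r₁ r₂ δ ρ)
    {L g ξ r : ℝ} (hL : L ∈ Icc (-Λ) Λ) (h : ξ + Θ (ρ ξ) L = g) (hr : r < ρ ξ) :
    r < ρ (g - Θ r L) := by
  rcases le_or_gt r₁ r with h2 | h2
  · have := D.strictMonoOn_radius N hL g ⟨h2, hr.le.trans (N.mem_Icc ξ).2⟩ (N.mem_Icc ξ) hr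
    have h3 : g - Θ (ρ ξ) L = ξ := by linarith
    simp only [h3, sub_self, sub_neg] at this
    exact this
  · exact h2.trans (N.mem_Ioo _).1

end SectionChart

end RefractionBilliard

/-! ### Elliptic orbits of the outer potential. -/

namespace RefractionBilliard

open Set Filter Topology

variable {E h μ ω Λ r₁ r₂ δ M : ℝ} {ρ : ℝ → ℝ}

theorem hasGradientAt_outerPotential (z : ℂ) :
    HasGradientAt (outerPotential E ω) (-ω ^ 2 • z) z := by
  rw [hasGradientAt_iff_hasFDerivAt]
  have h1 := (((hasStrictFDerivAt_norm_sq z).hasFDerivAt).const_mul (ω ^ 2 / 2)).const_sub E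
  refine h1.congr_fderiv ?_
  ext w
  simp only [neg_apply, smul_apply, innerSL_apply_apply,
    InnerProductSpace.toDual_apply_apply, real_inner_smul_left, smul_eq_mul, nsmul_eq_mul]
  push_cast
  ring

theorem hasGradientAt_innerPotential {z : ℂ} (hz : z ≠ 0) :
    HasGradientAt (innerPotential E h μ) ((-μ / ‖z‖ ^ 3) • z) z := by
  rw [hasGradientAt_iff_hasFDerivAt]
  have hn : 0 < ‖z‖ := norm_pos_iff.2 hz
  have h1 : HasFDerivAt (fun w : ℂ => μ / √(‖w‖ ^ 2)) _ z :=
    HasDerivAt.comp_hasFDerivAt z (h₂ := fun t : ℝ => μ / √t) (h₂' := -μ / (2 * ‖z‖ ^ 3))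
      (by
        have := (hasDerivAt_const (‖z‖ ^ 2) μ).fun_div (Real.hasDerivAt_sqrt (x := ‖z‖ ^ 2)
          (by positivity)) (by positivity)
        rw [Real.sqrt_sq hn.le] at this
        convert! this using 1
        field_simp
        ring)
      (hasStrictFDerivAt_norm_sq z).hasFDerivAt
  simp only [Real.sqrt_sq (norm_nonneg _)] at h1
  refine (h1.const_add (E + h)).congr_fderiv ?_
  ext w
  simp only [smul_apply, innerSL_apply_apply,
    InnerProductSpace.toDual_apply_apply, real_inner_smul_left, smul_eq_mul, nsmul_eq_mul]
  push_cast
  field_simp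

/-- A positive real part puts arg U in (-π/2, π/2), so doubling it does not leave the principal
branch. Both axis angles are read off from squares in this way. -/
theorem arg_mul_sq {z U : ℂ} {c : ℝ} (hU : 0 < U.re) (hc : 0 < c) (hz : z = c * U ^ 2) :
    Complex.arg z = 2 * Complex.arg U := by
  have hθ := abs_lt.1 (Complex.abs_arg_lt_pi_div_two_iff.2 (Or.inl hU))
  have hn : 0 < ‖U‖ := norm_pos_iff.2 fun h0 => by simp [h0] at hU
  have e : z = ((c * ‖U‖ ^ 2 : ℝ) : ℂ) * (Complex.cos ((2 * Complex.arg U : ℝ) : ℂ) +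
      Complex.sin ((2 * Complex.arg U : ℝ) : ℂ) * Complex.I) := by
    rw [← Complex.exp_mul_I, hz]
    conv_lhs => rw [← Complex.norm_mul_exp_arg_mul_I U]
    rw [mul_pow, ← Complex.exp_nat_mul]
    push_cast
    rw [mul_assoc]
    congr 3
    ring
  rw [e]
  exact Complex.arg_mul_cos_add_sin_mul_I (by positivity) ⟨by linarith, by linarith⟩

/-- A point at the eccentric anomaly `s` of the ellipse with semiaxes `X` and `Y`. -/
noncomputable def ellipsePoint (X Y s : ℝ) : ℂ := ⟨X * Real.cos s, Y * Real.sin s⟩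

/-- The derivative of `ellipsePoint X Y`. -/
noncomputable def ellipseTangent (X Y s : ℝ) : ℂ := ⟨-X * Real.sin s, Y * Real.cos s⟩

theorem hasDerivAt_ellipsePoint (X Y s : ℝ) :
    HasDerivAt (ellipsePoint X Y) (ellipseTangent X Y s) s := by
  refine hasDerivAt_mk ?_ ((Real.hasDerivAt_sin s).const_mul Y)
  simpa using (Real.hasDerivAt_cos s).const_mul X

theorem hasDerivAt_ellipseTangent (X Y s : ℝ) :
    HasDerivAt (ellipseTangent X Y) (-ellipsePoint X Y s) s := by
  have := hasDerivAt_mk ((Real.hasDerivAt_sin s).const_mul (-X))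
    ((Real.hasDerivAt_cos s).const_mul Y)
  convert! this using 1
  simp [ellipsePoint, Complex.ext_iff]

theorem norm_sq_ellipsePoint (X Y s : ℝ) :
    ‖ellipsePoint X Y s‖ ^ 2 = X ^ 2 - (X ^ 2 - Y ^ 2) * Real.sin s ^ 2 := by
  rw [← Complex.normSq_eq_norm_sq, ellipsePoint, Complex.normSq_mk]
  linear_combination X ^ 2 * Real.sin_sq_add_cos_sq s

/-- The semiaxes of an elliptic orbit with energy `E` and angular momentum `L`. -/
structure IsSemiaxes (E ω L X Y : ℝ) : Prop where
  pos : 0 < X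
  sq_lt : Y ^ 2 < X ^ 2
  momentum : ω * (X * Y) = L
  energy : ω ^ 2 * (X ^ 2 + Y ^ 2) = 2 * E

/-- X² and Y² have sum 2E/ω² and product L²/ω², so they are (E ± Δ)/ω² with Δ² = E² - ω²L²; Y
carries the sign of L. -/
theorem exists_isSemiaxes (hω : 0 < ω) (hE : 0 < E) {r L : ℝ} (hr : 0 < r)
    (hq : 0 < 2 * E - ω ^ 2 * r ^ 2 - L ^ 2 / r ^ 2) : ∃ X Y, IsSemiaxes E ω L X Y := by
  have hq' : 0 < (2 * E - ω ^ 2 * r ^ 2 - L ^ 2 / r ^ 2) * r ^ 2 := by positivity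
  have e : (2 * E - ω ^ 2 * r ^ 2 - L ^ 2 / r ^ 2) * r ^ 2 =
      2 * E * r ^ 2 - ω ^ 2 * r ^ 4 - L ^ 2 := by field_simp
  rw [e] at hq'
  -- Completing the square: E² - ω²L² = (ω²r² - E)² + ω²(2Er² - ω²r⁴ - L²).
  have hD : 0 < E ^ 2 - ω ^ 2 * L ^ 2 := by
    nlinarith [sq_nonneg (ω ^ 2 * r ^ 2 - E), mul_pos (pow_pos hω 2) hq']
  set Δ := √(E ^ 2 - ω ^ 2 * L ^ 2) with hΔ
  have hΔ0 : 0 < Δ := Real.sqrt_pos.2 hD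
  have hΔ2 : Δ ^ 2 = E ^ 2 - ω ^ 2 * L ^ 2 := Real.sq_sqrt hD.le
  have hX0 : 0 < √(E + Δ) := Real.sqrt_pos.2 (by linarith)
  have hX2 : √(E + Δ) ^ 2 = E + Δ := Real.sq_sqrt (by linarith)
  have hY : (L / √(E + Δ)) ^ 2 = (E - Δ) / ω ^ 2 := by
    rw [div_pow, hX2, div_eq_div_iff (by positivity) (by positivity)]
    linear_combination hΔ2
  have hX : (√(E + Δ) / ω) ^ 2 = (E + Δ) / ω ^ 2 := by rw [div_pow, hX2]
  refine ⟨√(E + Δ) / ω, L / √(E + Δ), by positivity, ?_, ?_, ?_⟩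
  · rw [hX, hY]
    gcongr
    linarith
  · field_simp
  · rw [hX, hY]
    field_simp
    ring

namespace IsSemiaxes

variable {L X Y : ℝ}

/-- On this quarter, which runs inwards from the apocentre s = 0, the radial speed is ω(X² - Y²) sin
s cos s / r. The number inside `outerAngle` is then a positive multiple of the square of the ellipse
point, which explains the division by 2 there. -/
theorem outer_polar (S : IsSemiaxes E ω L X Y) (hω : 0 < ω) {s : ℝ}
    (h0 : 0 ≤ s) (h1 : s < Real.pi / 2) {r : ℝ} (hr : r = ‖ellipsePoint X Y s‖) :
    0 < r ∧ ellipsePoint X Y s = r * Complex.exp (outerAngle E ω r L * Complex.I) ∧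
      ω * ellipseTangent X Y s =
        ⟨-outerSpeed E ω r L, L / r⟩ * Complex.exp (outerAngle E ω r L * Complex.I) := by
  have hX := S.pos
  have hXY := S.sq_lt
  have hL := S.momentum
  have hE := S.energy
  have hcs := Real.sin_sq_add_cos_sq s
  have hc : 0 < Real.cos s := Real.cos_pos_of_mem_Ioo ⟨by linarith, h1⟩
  have hs : 0 ≤ Real.sin s := Real.sin_nonneg_of_nonneg_of_le_pi h0 (by linarith)
  have hre : 0 < (ellipsePoint X Y s).re := mul_pos hX hc
  have hr0 : 0 < r := by
    rw [hr]
    exact norm_pos_iff.2 fun h => by simp [h] at hre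
  have hr2 : r ^ 2 = X ^ 2 * Real.cos s ^ 2 + Y ^ 2 * Real.sin s ^ 2 := by
    rw [hr, norm_sq_ellipsePoint]
    linear_combination -X ^ 2 * hcs
  have hp : outerSpeed E ω r L = ω * (X ^ 2 - Y ^ 2) * (Real.sin s * Real.cos s) / r := by
    have key : 2 * E - ω ^ 2 * r ^ 2 - L ^ 2 / r ^ 2 =
        (ω * (X ^ 2 - Y ^ 2) * (Real.sin s * Real.cos s) / r) ^ 2 := by
      rw [div_pow, eq_div_iff (by positivity), sub_mul, div_mul_cancel₀ _ (by positivity), hr2,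
        ← hL, ← hE]
      linear_combination (-ω ^ 2 * (X ^ 2 * (X ^ 2 - Y ^ 2) * Real.cos s ^ 2 -
        X ^ 2 * Y ^ 2 * (1 - Real.sin s ^ 2 - Real.cos s ^ 2) -
        Y ^ 2 * (X ^ 2 - Y ^ 2) * Real.sin s ^ 2)) * hcs
    rw [outerSpeed, key, Real.sqrt_sq]
    have : 0 ≤ X ^ 2 - Y ^ 2 := by linarith
    positivity
  have harg : outerAngle E ω r L = Complex.arg (ellipsePoint X Y s) := by
    have hd : 0 < X ^ 2 - Y ^ 2 := by linarith
    rw [outerAngle, arg_mul_sq (c := ω ^ 2 * (X ^ 2 - Y ^ 2) / 2 / r ^ 2) hre (by positivity)]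
    · ring
    · rw [hp, ellipsePoint, Complex.ext_iff]
      simp only [sq (⟨_, _⟩ : ℂ), Complex.mul_re, Complex.mul_im, Complex.ofReal_re,
        Complex.ofReal_im]
      constructor
      · field_simp
        linear_combination 2 * E * hr2 -
          (X ^ 2 * Real.cos s ^ 2 + Y ^ 2 * Real.sin s ^ 2) * hE +
          2 * (ω * (X * Y) + L) * hL + 2 * ω ^ 2 * X ^ 2 * Y ^ 2 * hcs
      · rw [← hL]
        field_simp
        ring
  have hpol : ellipsePoint X Y s = r * Complex.exp (outerAngle E ω r L * Complex.I) := by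
    rw [harg, hr, Complex.norm_mul_exp_arg_mul_I]
  refine ⟨hr0, hpol, ?_⟩
  have hexp : Complex.exp (outerAngle E ω r L * Complex.I) = ellipsePoint X Y s / r := by
    rw [hpol, mul_div_cancel_left₀ _ (Complex.ofReal_ne_zero.2 hr0.ne')]
  rw [hexp, hp, eq_comm, mul_div_assoc', div_eq_iff (Complex.ofReal_ne_zero.2 hr0.ne')]
  rw [ellipsePoint, ellipseTangent, Complex.ext_iff]
  simp only [Complex.mul_re, Complex.mul_im, Complex.ofReal_re, Complex.ofReal_im]
  constructor
  · field_simp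
    linear_combination Real.sin s * Y * hL + ω * X * Real.sin s * hr2 +
      ω * X * Real.sin s * Y ^ 2 * hcs
  · field_simp
    linear_combination -(X * Real.cos s) * hL - ω * Y * Real.cos s * hr2 -
      ω * Y * Real.cos s * X ^ 2 * hcs

end IsSemiaxes
end RefractionBilliard

/-! ### Existence and uniqueness of outer arcs. -/

namespace RefractionBilliard

open Set Filter Topology

variable {E h μ ω Λ r₁ r₂ δ M : ℝ} {ρ : ℝ → ℝ}

theorem norm_mk_mul_exp {r : ℝ} (hr : 0 < r) (φ : ℝ) :
    ‖(r : ℂ) * Complex.exp (φ * Complex.I)‖ = r := by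
  rw [norm_mul, Complex.norm_exp_ofReal_mul_I, mul_one, Complex.norm_of_nonneg hr.le]

theorem mem_exteriorDomain (N : NearCircle r₁ r₂ δ ρ) {r φ : ℝ} (hr : 0 < r) (h : ρ φ < r) :
    (r : ℂ) * Complex.exp (φ * Complex.I) ∈ exteriorDomain ρ := by
  rw [exteriorDomain, mem_ofPred_eq, norm_mk_mul_exp hr, periodic_arg N.periodic hr]
  exact h

theorem mem_interiorDomain (N : NearCircle r₁ r₂ δ ρ) {r φ : ℝ} (hr : 0 < r) (h : r < ρ φ) :
    (r : ℂ) * Complex.exp (φ * Complex.I) ∈ interiorDomain ρ := by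
  rw [interiorDomain, mem_ofPred_eq, norm_mk_mul_exp hr, periodic_arg N.periodic hr]
  exact h

theorem conj_exp_mul_I (θ : ℝ) : (starRingEnd ℂ) (Complex.exp (θ * Complex.I)) =
    Complex.exp (((-θ : ℝ) : ℂ) * Complex.I) := by
  rw [← Complex.exp_conj]
  simp

theorem exp_mul_mul_exp (g θ : ℝ) (c : ℂ) :
    Complex.exp (g * Complex.I) * (c * Complex.exp (θ * Complex.I)) =
      c * Complex.exp (((g + θ : ℝ) : ℂ) * Complex.I) := by
  rw [mul_left_comm, ← Complex.exp_add]
  push_cast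
  ring_nf

theorem norm_mk_sq (a b : ℝ) : ‖(⟨a, b⟩ : ℂ)‖ ^ 2 = a ^ 2 + b ^ 2 := by
  rw [← Complex.normSq_eq_norm_sq, Complex.normSq_mk]
  ring

theorem ellipsePoint_neg (X Y s : ℝ) :
    ellipsePoint X Y (-s) = (starRingEnd ℂ) (ellipsePoint X Y s) := by
  simp [ellipsePoint, Complex.ext_iff]

theorem ellipseTangent_neg (X Y s : ℝ) :
    ellipseTangent X Y (-s) = -(starRingEnd ℂ) (ellipseTangent X Y s) := by
  simp [ellipseTangent, Complex.ext_iff]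

namespace IsSemiaxes

variable {L X Y : ℝ}

theorem incoming (S : IsSemiaxes E ω L X Y) (hω : 0 < ω) {s : ℝ} (h0 : 0 ≤ s)
    (h1 : s < Real.pi / 2) (g : ℝ) {r : ℝ} (hr : r = ‖ellipsePoint X Y s‖) :
    Complex.exp (g * Complex.I) * ellipsePoint X Y s =
        r * Complex.exp (((g + outerAngle E ω r L : ℝ) : ℂ) * Complex.I) ∧
      Complex.exp (g * Complex.I) * (ω * ellipseTangent X Y s) = ⟨-outerSpeed E ω r L, L / r⟩ *
        Complex.exp (((g + outerAngle E ω r L : ℝ) : ℂ) * Complex.I) := by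
  obtain ⟨-, h2, h3⟩ := S.outer_polar hω h0 h1 hr
  rw [h2, h3, exp_mul_mul_exp, exp_mul_mul_exp]
  exact ⟨rfl, rfl⟩

theorem outgoing (S : IsSemiaxes E ω L X Y) (hω : 0 < ω) {s : ℝ} (h0 : 0 ≤ s)
    (h1 : s < Real.pi / 2) (g : ℝ) {r : ℝ} (hr : r = ‖ellipsePoint X Y s‖) :
    Complex.exp (g * Complex.I) * ellipsePoint X Y (-s) =
        r * Complex.exp (((g - outerAngle E ω r L : ℝ) : ℂ) * Complex.I) ∧
      Complex.exp (g * Complex.I) * (ω * ellipseTangent X Y (-s)) = ⟨outerSpeed E ω r L, L / r⟩ *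
        Complex.exp (((g - outerAngle E ω r L : ℝ) : ℂ) * Complex.I) := by
  obtain ⟨-, h2, h3⟩ := S.outer_polar hω h0 h1 hr
  have h4 : ω * ellipseTangent X Y (-s) = ⟨outerSpeed E ω r L, L / r⟩ *
      Complex.exp (((-outerAngle E ω r L : ℝ) : ℂ) * Complex.I) := by
    have := congrArg (starRingEnd ℂ) h3
    rw [map_mul, map_mul, conj_exp_mul_I, Complex.conj_ofReal] at this
    rw [ellipseTangent_neg, mul_neg, this, ← neg_mul]
    congr 1
    simp [Complex.ext_iff]
  rw [h4, ellipsePoint_neg, h2, map_mul, Complex.conj_ofReal, conj_exp_mul_I,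
    exp_mul_mul_exp, exp_mul_mul_exp, ← sub_eq_add_neg]
  exact ⟨rfl, rfl⟩

theorem norm_lt_norm (S : IsSemiaxes E ω L X Y) {s t : ℝ} (hs : 0 ≤ s) (hst : s < t)
    (ht : t < Real.pi / 2) : ‖ellipsePoint X Y t‖ < ‖ellipsePoint X Y s‖ := by
  refine lt_of_pow_lt_pow_left₀ 2 (norm_nonneg _) ?_
  rw [norm_sq_ellipsePoint, norm_sq_ellipsePoint]
  have h1 : 0 ≤ Real.sin s := Real.sin_nonneg_of_nonneg_of_le_pi hs (by linarith)
  have h2 : Real.sin s < Real.sin t :=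
    Real.sin_lt_sin_of_lt_of_le_pi_div_two (by linarith) ht.le hst
  have := S.sq_lt
  have : Real.sin s ^ 2 < Real.sin t ^ 2 := by gcongr
  nlinarith

theorem exists_norm_eq (S : IsSemiaxes E ω L X Y) (hω : 0 < ω) {r : ℝ} (hr : 0 < r)
    (hq : 0 < 2 * E - ω ^ 2 * r ^ 2 - L ^ 2 / r ^ 2) :
    ∃ s ∈ Ioo 0 (Real.pi / 2), r = ‖ellipsePoint X Y s‖ := by
  have hd := S.sq_lt
  -- The squared radial speed times r² is ω²(X² - r²)(r² - Y²), so r lies strictly between |Y| and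
  -- X.
  have h1 : 0 < (X ^ 2 - r ^ 2) * (r ^ 2 - Y ^ 2) := by
    have e : (2 * E - ω ^ 2 * r ^ 2 - L ^ 2 / r ^ 2) * r ^ 2 =
        ω ^ 2 * ((X ^ 2 - r ^ 2) * (r ^ 2 - Y ^ 2)) := by
      rw [sub_mul _ (L ^ 2 / r ^ 2), div_mul_cancel₀ _ (by positivity), ← S.energy, ← S.momentum]
      ring
    have h2 : 0 < ω ^ 2 * ((X ^ 2 - r ^ 2) * (r ^ 2 - Y ^ 2)) := by
      rw [← e]; positivity
    exact (mul_pos_iff_of_pos_left (by positivity)).1 h2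
  have h2 : 0 < X ^ 2 - r ^ 2 ∧ 0 < r ^ 2 - Y ^ 2 := by
    rcases mul_pos_iff.1 h1 with h | h
    · exact h
    · linarith [h.1, h.2]
  set q := √((X ^ 2 - r ^ 2) / (X ^ 2 - Y ^ 2)) with hqdef
  have hfrac : 0 < (X ^ 2 - r ^ 2) / (X ^ 2 - Y ^ 2) := div_pos h2.1 (by linarith)
  have hq0 : 0 < q := Real.sqrt_pos.2 hfrac
  have hq1 : q < 1 := by
    rw [hqdef, Real.sqrt_lt' one_pos, div_lt_iff₀ (by linarith)]
    linarith [h2.2]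
  refine ⟨Real.arcsin q, ⟨Real.arcsin_pos.2 hq0, Real.arcsin_lt_pi_div_two.2 hq1⟩, ?_⟩
  rw [← sq_eq_sq₀ hr.le (norm_nonneg _), norm_sq_ellipsePoint,
    Real.sin_arcsin (by linarith) hq1.le, hqdef, Real.sq_sqrt hfrac.le,
    mul_div_cancel₀ _ (by linarith)]
  ring

end IsSemiaxes

/-- The outer arc of the orbit with angular momentum `L` and apocentre in the direction `g`. -/
theorem exists_isOuterArc (hω : 0 < ω) (hE : 0 < E)
    (D : SectionChart Λ r₁ r₂ δ M (outerSpeed E ω) (outerAngle E ω) (speedDeriv (outerSpeed E ω)))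
    (N : NearCircle r₁ r₂ δ ρ)
    (hq : ∀ r ∈ Icc r₁ r₂, ∀ L ∈ Icc (-Λ) Λ, 0 < 2 * E - ω ^ 2 * r ^ 2 - L ^ 2 / r ^ 2)
    {L g ξ η : ℝ} (hL : L ∈ Icc (-Λ) Λ) (hξ : ξ + outerAngle E ω (ρ ξ) L = g)
    (hη : η + (-outerAngle E ω) (ρ η) L = g) :
    ∃ (T : ℝ) (z v : ℝ → ℂ), IsOuterArc E ω ρ T z v ∧
      z 0 = boundaryCurve ρ ξ ∧ v 0 = orbitVelocity ρ ξ (outerSpeed E ω (ρ ξ) L) L ∧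
      z T = boundaryCurve ρ η ∧ v T = orbitVelocity ρ η (-outerSpeed E ω (ρ η) L) L := by
  obtain ⟨X, Y, S⟩ := exists_isSemiaxes hω hE (N.radius_pos ξ) (hq _ (N.mem_Icc ξ) L hL)
  obtain ⟨s₁, hs₁, hr₁⟩ := S.exists_norm_eq hω (N.radius_pos ξ) (hq _ (N.mem_Icc ξ) L hL)
  obtain ⟨s₂, hs₂, hr₂⟩ := S.exists_norm_eq hω (N.radius_pos η) (hq _ (N.mem_Icc η) L hL)
  have hηg : g + outerAngle E ω (ρ η) L = η := by
    simp only [Pi.neg_apply] at hη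
    linarith
  have hξg : g - outerAngle E ω (ρ ξ) L = ξ := by linarith
  obtain ⟨a1, a2⟩ := S.outgoing hω hs₁.1.le hs₁.2 g hr₁
  obtain ⟨b1, b2⟩ := S.incoming hω hs₂.1.le hs₂.2 g hr₂
  rw [hξg] at a1 a2
  rw [hηg] at b1 b2
  have e1 : ω * ((s₁ + s₂) / ω) - s₁ = s₂ := by field_simp; ring
  -- The eccentric anomaly runs from -s₁ at the exit through 0 at the apocentre to s₂ at the return.
  refine ⟨(s₁ + s₂) / ω, fun t => Complex.exp (g * Complex.I) * ellipsePoint X Y (ω * t - s₁),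
    fun t => Complex.exp (g * Complex.I) * (ω * ellipseTangent X Y (ω * t - s₁)),
    ⟨by have := hs₁.1; have := hs₂.1; positivity, ?_, ?_⟩, ?_, ?_, ?_, ?_⟩
  · intro t _
    have hl : HasDerivAt (fun t : ℝ => ω * t - s₁) ω t := by
      simpa using ((hasDerivAt_id t).const_mul ω).sub_const s₁
    refine ⟨?_, ?_, ?_⟩
    · have := ((hasDerivAt_ellipsePoint X Y (ω * t - s₁)).scomp t hl).const_mul
        (Complex.exp (g * Complex.I))
      simpa using this.hasDerivWithinAt
    · have := (((hasDerivAt_ellipseTangent X Y (ω * t - s₁)).scomp t hl).const_mul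
        (ω : ℂ)).const_mul (Complex.exp (g * Complex.I))
      rw [(hasGradientAt_outerPotential _).gradient]
      convert! this.hasDerivWithinAt using 1
      simp only [Complex.real_smul]
      push_cast
      ring
    · simp only [outerPotential, norm_mul, Complex.norm_exp_ofReal_mul_I,
        Complex.norm_of_nonneg hω.le, one_mul]
      rw [mul_pow, ellipsePoint, ellipseTangent,
        norm_mk_sq, norm_mk_sq]
      linear_combination S.energy / 2 +
        ω ^ 2 / 2 * (X ^ 2 + Y ^ 2) * Real.sin_sq_add_cos_sq (ω * t - s₁)
  · intro t ht
    -- Every point is farther out than the endpoint of its own half, so monotonicity along that half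
    -- keeps it outside the curve.
    rcases le_total 0 (ω * t - s₁) with h0 | h0
    · have h2 : ω * t - s₁ < s₂ := by
        have := (lt_div_iff₀ hω).1 ht.2
        linarith
      have h3 := S.norm_lt_norm h0 h2 hs₂.2
      have h4 := (S.incoming hω h0 (h2.trans hs₂.2) g rfl).1
      simp only
      rw [h4]
      refine mem_exteriorDomain N (by rw [← hr₂] at h3; exact (N.radius_pos η).trans h3) ?_
      have := D.neg.radius_lt_of_lt N hL hη (r := ‖ellipsePoint X Y (ω * t - s₁)‖) (hr₂ ▸ h3)
      simpa using this
    · have h1 : s₁ - ω * t < s₁ := by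
        have := mul_pos hω ht.1
        linarith
      have h0' : 0 ≤ s₁ - ω * t := by linarith
      have h3 := S.norm_lt_norm h0' h1 hs₁.2
      have h4 := (S.outgoing hω h0' (h1.trans hs₁.2) g rfl).1
      simp only
      rw [← neg_sub s₁, h4]
      refine mem_exteriorDomain N (by rw [← hr₁] at h3; exact (N.radius_pos ξ).trans h3) ?_
      exact D.radius_lt_of_lt N hL hξ (hr₁ ▸ h3)
  · simpa [boundaryCurve] using a1
  · simpa [orbitVelocity] using a2
  · simp only [e1]
    exact b1
  · simp only [e1]
    exact b2

theorem eq_of_hasDerivWithinAt_zero {F : Type*} [NormedAddCommGroup F] [NormedSpace ℝ F]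
    {J : Set ℝ} (hJ : Convex ℝ J) {f : ℝ → F} (h : ∀ x ∈ J, HasDerivWithinAt f 0 J x) {x y : ℝ}
    (hx : x ∈ J) (hy : y ∈ J) : f y = f x := by
  have := hJ.norm_image_sub_le_of_norm_hasDerivWithin_le (C := 0) h (by simp) hx hy
  rw [zero_mul] at this
  exact sub_eq_zero.1 (norm_le_zero_iff.1 this)

theorem IsMotion.mono {V : ℂ → ℝ} {J J' : Set ℝ} {z v : ℝ → ℂ} (H : IsMotion V J z v)
    (hJ : J' ⊆ J) : IsMotion V J' z v := fun s hs =>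
  ⟨(H s (hJ hs)).1.mono hJ, (H s (hJ hs)).2.1.mono hJ, (H s (hJ hs)).2.2⟩

/-- The force is linear, so the difference of two motions conserves |Δv|² + ω²|Δz|², which starts at
0. -/
theorem outerMotion_unique (hω : 0 < ω) {T : ℝ} {z v z' v' : ℝ → ℂ}
    (H : IsMotion (outerPotential E ω) (Icc 0 T) z v)
    (H' : IsMotion (outerPotential E ω) (Icc 0 T) z' v') (hz : z 0 = z' 0) (hv : v 0 = v' 0)
    {t : ℝ} (ht : t ∈ Icc 0 T) : z t = z' t ∧ v t = v' t := by
  have hd : ∀ s ∈ Icc 0 T, HasDerivWithinAt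
      (fun s => ‖v s - v' s‖ ^ 2 + ω ^ 2 * ‖z s - z' s‖ ^ 2) 0 (Icc 0 T) s := by
    intro s hs
    obtain ⟨h1, h2, -⟩ := H s hs
    obtain ⟨h1', h2', -⟩ := H' s hs
    have := (h2.sub h2').norm_sq.add ((h1.sub h1').norm_sq.const_mul (ω ^ 2))
    convert! this using 1
    rw [(hasGradientAt_outerPotential _).gradient, (hasGradientAt_outerPotential _).gradient]
    have e : -ω ^ 2 • z s - -ω ^ 2 • z' s = (-ω ^ 2) • (z s - z' s) := (smul_sub _ _ _).symm
    simp only [Pi.sub_apply]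
    rw [e, real_inner_smul_right, real_inner_comm]
    ring
  have h0 := eq_of_hasDerivWithinAt_zero (convex_Icc 0 T) hd
    (left_mem_Icc.2 (ht.1.trans ht.2)) ht
  simp only [hz, hv, sub_self, norm_zero] at h0
  have h1 : ‖v t - v' t‖ ^ 2 = 0 := by
    nlinarith [sq_nonneg ‖v t - v' t‖, sq_nonneg (ω * ‖z t - z' t‖)]
  have h2 : ‖z t - z' t‖ ^ 2 = 0 := by
    have : ω ^ 2 * ‖z t - z' t‖ ^ 2 = 0 := by linarith
    exact (mul_eq_zero.1 this).resolve_left (by positivity)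
  constructor
  · simpa [sub_eq_zero] using h2
  · simpa [sub_eq_zero] using h1

/-- A longer arc would be strictly outside at the moment when the shorter one is on the curve. -/
theorem IsOuterArc.le_of_eq (hω : 0 < ω) {T T' : ℝ} {z v z' v' : ℝ → ℂ}
    (H : IsOuterArc E ω ρ T z v) (H' : IsOuterArc E ω ρ T' z' v') (hz : z 0 = z' 0)
    (hv : v 0 = v' 0) (hT : ρ (Complex.arg (z T)) = ‖z T‖) : T' ≤ T := by
  by_contra! hlt
  have h1 := outerMotion_unique hω H.2.1 (H'.2.1.mono (Icc_subset_Icc_right hlt.le)) hz hv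
    (right_mem_Icc.2 H.1.le)
  have h2 : ρ (Complex.arg (z' T)) < ‖z' T‖ := H'.2.2 T ⟨H.1, hlt⟩
  rw [← h1.1, hT] at h2
  exact lt_irrefl _ h2

theorem IsOuterArc.end_unique (hω : 0 < ω) {T T' : ℝ} {z v z' v' : ℝ → ℂ}
    (H : IsOuterArc E ω ρ T z v) (H' : IsOuterArc E ω ρ T' z' v') (hz : z 0 = z' 0)
    (hv : v 0 = v' 0) (hT : ρ (Complex.arg (z T)) = ‖z T‖)
    (hT' : ρ (Complex.arg (z' T')) = ‖z' T'‖) : z T = z' T' ∧ v T = v' T' := by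
  obtain rfl : T = T' := le_antisymm (H'.le_of_eq hω H hz.symm hv.symm hT')
    (H.le_of_eq hω H' hz hv hT)
  exact outerMotion_unique hω H.2.1 H'.2.1 hz hv (right_mem_Icc.2 H.1.le)

end RefractionBilliard

/-! ### Inner orbits in the Levi-Civita plane. -/

namespace RefractionBilliard

open Set Filter Topology

variable {E h μ ω Λ r₁ r₂ δ M : ℝ} {ρ : ℝ → ℝ}

/-- A point of a hyperbola in the Levi-Civita plane, with `κ τ` as the hyperbolic angle. -/
noncomputable def hyperbolaPoint (κ X Y τ : ℝ) : ℂ :=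
  ⟨-Y * Real.sinh (κ * τ), X * Real.cosh (κ * τ)⟩

/-- The derivative of `hyperbolaPoint κ X Y` is `κ` times this vector. -/
noncomputable def hyperbolaTangent (κ X Y τ : ℝ) : ℂ :=
  ⟨-Y * Real.cosh (κ * τ), X * Real.sinh (κ * τ)⟩

/-- The physical time along a regularised orbit. -/
noncomputable def keplerTime (κ X Y τ : ℝ) : ℝ :=
  ((X ^ 2 + Y ^ 2) * Real.sinh (2 * κ * τ) / (2 * κ) + (X ^ 2 - Y ^ 2) * τ) / 2

theorem hasDerivAt_hyperbolaPoint (κ X Y τ : ℝ) :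
    HasDerivAt (hyperbolaPoint κ X Y) (κ * hyperbolaTangent κ X Y τ) τ := by
  have hl : HasDerivAt (fun t : ℝ => κ * t) κ τ := by
    simpa using (hasDerivAt_id τ).const_mul κ
  have := hasDerivAt_mk (hl.sinh.const_mul (-Y)) (hl.cosh.const_mul X)
  convert! this using 1
  simp [hyperbolaTangent, Complex.ext_iff]
  constructor <;> ring

theorem hasDerivAt_hyperbolaTangent (κ X Y τ : ℝ) :
    HasDerivAt (hyperbolaTangent κ X Y) (κ * hyperbolaPoint κ X Y τ) τ := by
  have hl : HasDerivAt (fun t : ℝ => κ * t) κ τ := by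
    simpa using (hasDerivAt_id τ).const_mul κ
  have := hasDerivAt_mk (hl.cosh.const_mul (-Y)) (hl.sinh.const_mul X)
  convert! this using 1
  simp [hyperbolaPoint, Complex.ext_iff]
  constructor <;> ring

theorem hyperbolaPoint_neg (κ X Y τ : ℝ) :
    hyperbolaPoint κ X Y (-τ) = -(starRingEnd ℂ) (hyperbolaPoint κ X Y τ) := by
  simp [hyperbolaPoint, Complex.ext_iff]

theorem hyperbolaTangent_neg (κ X Y τ : ℝ) :
    hyperbolaTangent κ X Y (-τ) = (starRingEnd ℂ) (hyperbolaTangent κ X Y τ) := by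
  simp [hyperbolaTangent, Complex.ext_iff]

theorem normSq_hyperbolaPoint (κ X Y τ : ℝ) : Complex.normSq (hyperbolaPoint κ X Y τ) =
    X ^ 2 + (X ^ 2 + Y ^ 2) * Real.sinh (κ * τ) ^ 2 := by
  rw [hyperbolaPoint, Complex.normSq_mk]
  linear_combination X ^ 2 * Real.cosh_sq (κ * τ)

theorem normSq_hyperbolaTangent (κ X Y τ : ℝ) : Complex.normSq (hyperbolaTangent κ X Y τ) =
    Y ^ 2 + (X ^ 2 + Y ^ 2) * Real.sinh (κ * τ) ^ 2 := by
  rw [hyperbolaTangent, Complex.normSq_mk]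
  linear_combination Y ^ 2 * Real.cosh_sq (κ * τ)

theorem hasDerivAt_keplerTime {κ : ℝ} (hκ : 0 < κ) (X Y τ : ℝ) :
    HasDerivAt (keplerTime κ X Y) (Complex.normSq (hyperbolaPoint κ X Y τ)) τ := by
  have hl : HasDerivAt (fun t : ℝ => 2 * κ * t) (2 * κ) τ := by
    simpa using (hasDerivAt_id τ).const_mul (2 * κ)
  have h1 := (((hl.sinh.const_mul (X ^ 2 + Y ^ 2)).div_const (2 * κ)).add
    ((hasDerivAt_id τ).const_mul (X ^ 2 - Y ^ 2))).div_const 2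
  convert! h1 using 1
  have h2 : Real.cosh (2 * κ * τ) = 1 + 2 * Real.sinh (κ * τ) ^ 2 := by
    rw [mul_assoc, Real.cosh_two_mul, Real.cosh_sq]
    ring
  rw [normSq_hyperbolaPoint, h2]
  field_simp
  ring

theorem keplerTime_neg (κ X Y τ : ℝ) : keplerTime κ X Y (-τ) = -keplerTime κ X Y τ := by
  simp only [keplerTime, mul_neg, Real.sinh_neg]
  ring

/-- For X = 0 the derivative vanishes at the collision τ = 0, so its sign is used only for τ > 0 and
oddness supplies the other half. -/
theorem strictMono_keplerTime {κ X Y : ℝ} (hκ : 0 < κ) (hY : 0 < Y) :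
    StrictMono (keplerTime κ X Y) := by
  refine strictMono_of_odd_strictMonoOn_nonneg (keplerTime_neg κ X Y) ?_
  refine strictMonoOn_of_deriv_pos (convex_Ici 0)
    (fun τ _ => (hasDerivAt_keplerTime hκ X Y τ).continuousAt.continuousWithinAt) fun τ hτ => ?_
  rw [interior_Ici] at hτ
  rw [(hasDerivAt_keplerTime hκ X Y τ).deriv, normSq_hyperbolaPoint]
  have : 0 < Real.sinh (κ * τ) := Real.sinh_pos_iff.2 (mul_pos hκ hτ)
  positivity

theorem surjective_keplerTime {κ X Y : ℝ} (hκ : 0 < κ) (hY : 0 < Y) :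
    Function.Surjective (keplerTime κ X Y) := by
  have hc : Continuous (keplerTime κ X Y) :=
    continuous_iff_continuousAt.2 fun τ => (hasDerivAt_keplerTime hκ X Y τ).continuousAt
  have ht : Tendsto (keplerTime κ X Y) atTop atTop := by
    have h1 : Tendsto (fun τ => Y ^ 2 / (4 * κ) * (2 * κ * τ + -(9 / 4))) atTop atTop :=
      (tendsto_atTop_add_const_right _ _
        (tendsto_id.const_mul_atTop (by positivity : 0 < 2 * κ))).const_mul_atTop (by positivity)
    refine tendsto_atTop_mono' _ ?_ h1
    filter_upwards [eventually_ge_atTop 0] with τ hτ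
    -- With x = 2κτ, the bounds exp x ≥ 1 + x + x²/2 and exp(-x) ≤ 1 leave (x/2 - 3/2)² ≥ 0; the
    -- constant 9/4 completes the square.
    have h2 : 2 * κ * τ + -(9 / 4) ≤ Real.sinh (2 * κ * τ) - 2 * κ * τ := by
      have hx : 0 ≤ 2 * κ * τ := by positivity
      generalize 2 * κ * τ = x at hx
      have h3 := Real.quadratic_le_exp_of_nonneg hx
      have h4 : Real.exp (-x) ≤ 1 := Real.exp_le_one_iff.2 (by linarith)
      rw [Real.sinh_eq]
      nlinarith [sq_nonneg (x / 2 - 3 / 2)]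
    have h5 : 0 ≤ Real.sinh (2 * κ * τ) := Real.sinh_nonneg_iff.2 (by positivity)
    have h6 : keplerTime κ X Y τ = Y ^ 2 / (4 * κ) * (Real.sinh (2 * κ * τ) - 2 * κ * τ) +
        X ^ 2 / (4 * κ) * (Real.sinh (2 * κ * τ) + 2 * κ * τ) := by
      rw [keplerTime]
      field_simp
      ring
    have h7 : 0 ≤ X ^ 2 / (4 * κ) * (Real.sinh (2 * κ * τ) + 2 * κ * τ) := by positivity
    rw [h6]
    have := mul_le_mul_of_nonneg_left h2 (by positivity : 0 ≤ Y ^ 2 / (4 * κ))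
    linarith
  refine hc.surjective ht ?_
  have h8 := tendsto_neg_atTop_atBot.comp (ht.comp tendsto_neg_atBot_atTop)
  refine h8.congr fun τ => ?_
  simp [keplerTime_neg]

/-- Parameters of a regularised orbit with energy `E + h` and angular momentum `L`. -/
structure IsKeplerAxes (E h μ L κ X Y : ℝ) : Prop where
  rate_pos : 0 < κ
  pos : 0 < Y
  momentum : 2 * κ * (X * Y) = L
  energy : 2 * κ ^ 2 = E + h
  mass : 2 * κ ^ 2 * (Y ^ 2 - X ^ 2) = μ

/-- Y² and -X² are the roots of t² - m t - b² with m = μ/(E + h) and b = L/(2κ). Taking Y² as the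
positive root keeps Y > 0, so L = 0 corresponds to X = 0. -/
theorem exists_isKeplerAxes (hEh : 0 < E + h) (hμ : 0 < μ) (L : ℝ) :
    ∃ κ X Y, IsKeplerAxes E h μ L κ X Y := by
  set κ := √((E + h) / 2) with hκ
  have hκ0 : 0 < κ := Real.sqrt_pos.2 (by positivity)
  have hκ2 : 2 * κ ^ 2 = E + h := by
    rw [hκ, Real.sq_sqrt (by positivity)]
    ring
  set m := μ / (E + h) with hm
  have hm0 : 0 < m := by positivity
  set b := L / (2 * κ) with hb
  set q := √(m ^ 2 + 4 * b ^ 2) with hq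
  have hq2 : q ^ 2 = m ^ 2 + 4 * b ^ 2 := Real.sq_sqrt (by positivity)
  have hq0 : 0 ≤ q := Real.sqrt_nonneg _
  set Y := √((m + q) / 2) with hY
  have hY0 : 0 < Y := Real.sqrt_pos.2 (by positivity)
  have hY2 : Y ^ 2 = (m + q) / 2 := Real.sq_sqrt (by positivity)
  have hX2 : (b / Y) ^ 2 = (q - m) / 2 := by
    rw [div_pow, hY2, div_eq_div_iff (by positivity) (by positivity)]
    linear_combination -hq2 / 2
  refine ⟨κ, b / Y, Y, hκ0, hY0, ?_, hκ2, ?_⟩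
  · rw [div_mul_cancel₀ _ hY0.ne', hb]
    field_simp
  · rw [hX2, hY2, hκ2, hm]
    field_simp
    ring

namespace IsKeplerAxes

variable {L κ X Y : ℝ}

/-- Before the pericentre the Levi-Civita point U has positive real part, and the number inside
`innerAngle` is a positive multiple of U². So the polar angle of the position U² is exactly
`innerAngle`. -/
theorem inner_polar (S : IsKeplerAxes E h μ L κ X Y) {s : ℝ} (hs : 0 < s) {r : ℝ}
    (hr : r = Complex.normSq (hyperbolaPoint κ X Y (-s))) :
    0 < r ∧ hyperbolaPoint κ X Y (-s) ^ 2 =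
        r * Complex.exp (innerAngle E h μ r L * Complex.I) ∧
      2 * κ * hyperbolaTangent κ X Y (-s) / (starRingEnd ℂ) (hyperbolaPoint κ X Y (-s)) =
        ⟨-innerSpeed E h μ r L, L / r⟩ * Complex.exp (innerAngle E h μ r L * Complex.I) := by
  have hκ := S.rate_pos
  have hY := S.pos
  have hcs := Real.cosh_sq (κ * s)
  have hC : 0 < Real.cosh (κ * s) := Real.cosh_pos _
  have hS : 0 < Real.sinh (κ * s) := Real.sinh_pos_iff.2 (mul_pos hκ hs)
  set U := hyperbolaPoint κ X Y (-s) with hU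
  have hUe : U = ⟨Y * Real.sinh (κ * s), X * Real.cosh (κ * s)⟩ := by
    simp [hU, hyperbolaPoint]
  have hre : 0 < U.re := by rw [hUe]; positivity
  have hr2 : r = X ^ 2 + (X ^ 2 + Y ^ 2) * Real.sinh (κ * s) ^ 2 := by
    rw [hr, normSq_hyperbolaPoint]
    simp
  have hr0 : 0 < r := by rw [hr2]; positivity
  have hUc : U * (starRingEnd ℂ) U = r := by rw [Complex.mul_conj, hr]
  have hp : innerSpeed E h μ r L =
      2 * κ * (X ^ 2 + Y ^ 2) * (Real.sinh (κ * s) * Real.cosh (κ * s)) / r := by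
    have key : 2 * (E + h) + 2 * μ / r - L ^ 2 / r ^ 2 =
        (2 * κ * (X ^ 2 + Y ^ 2) * (Real.sinh (κ * s) * Real.cosh (κ * s)) / r) ^ 2 := by
      rw [div_pow, ← S.energy, ← S.mass, ← S.momentum]
      field_simp
      rw [hr2, hcs]
      ring
    rw [innerSpeed, key, Real.sqrt_sq (by positivity)]
  have harg : innerAngle E h μ r L = 2 * Complex.arg U := by
    refine arg_mul_sq (c := 2 * κ ^ 2 * (X ^ 2 + Y ^ 2) / r) hre (by positivity) ?_
    rw [hp, hUe, Complex.ext_iff]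
    simp only [sq (⟨_, _⟩ : ℂ), Complex.mul_re, Complex.mul_im, Complex.ofReal_re,
      Complex.ofReal_im]
    constructor
    · rw [← S.mass, ← S.momentum]
      field_simp
      rw [hr2, hcs]
      ring
    · rw [← S.momentum]
      field_simp
      ring
  have hnorm : (‖U‖ : ℂ) ^ 2 = r := by
    rw [hr, Complex.normSq_eq_norm_sq]
    push_cast
    rfl
  have hpol : U ^ 2 = r * Complex.exp (innerAngle E h μ r L * Complex.I) := by
    rw [harg]
    conv_lhs => rw [← Complex.norm_mul_exp_arg_mul_I U]
    rw [mul_pow, ← Complex.exp_nat_mul, hnorm]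
    push_cast
    ring_nf
  refine ⟨hr0, hpol, ?_⟩
  have hr0' : (r : ℂ) ≠ 0 := Complex.ofReal_ne_zero.2 hr0.ne'
  have hU0 : U ≠ 0 := fun h0 => by simp [h0] at hre
  have hUc0 : (starRingEnd ℂ) U ≠ 0 := by simpa using hU0
  have hexp : Complex.exp (innerAngle E h μ r L * Complex.I) = U / (starRingEnd ℂ) U := by
    rw [eq_div_iff hUc0, ← mul_right_inj' hr0', ← mul_assoc, ← hpol, ← hUc]
    ring
  rw [hexp, mul_div_assoc']
  congr 1
  rw [hp, hUe, hyperbolaTangent, Complex.ext_iff]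
  simp only [Complex.mul_re, Complex.mul_im, Complex.ofReal_re, Complex.ofReal_im, mul_neg,
    Real.cosh_neg, Real.sinh_neg, Complex.re_ofNat, Complex.im_ofNat]
  rw [← S.momentum]
  constructor
  · field_simp
    rw [hr2]
    ring
  · field_simp
    rw [hr2, hcs]
    ring

theorem exists_normSq_eq (S : IsKeplerAxes E h μ L κ X Y) {r : ℝ} (hr : 0 < r)
    (hq : 0 < 2 * (E + h) + 2 * μ / r - L ^ 2 / r ^ 2) :
    X ^ 2 < r ∧ ∃ s, 0 < s ∧ r = Complex.normSq (hyperbolaPoint κ X Y (-s)) := by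
  have hκ := S.rate_pos
  have hY := S.pos
  have h1 : 0 < (2 * (E + h) + 2 * μ / r - L ^ 2 / r ^ 2) * r ^ 2 := by positivity
  -- This factorisation identifies X² as the pericentre distance.
  have h2 : (2 * (E + h) + 2 * μ / r - L ^ 2 / r ^ 2) * r ^ 2 =
      4 * κ ^ 2 * (r + Y ^ 2) * (r - X ^ 2) := by
    rw [← S.energy, ← S.mass, ← S.momentum]
    field_simp
    ring
  rw [h2, mul_pos_iff_of_pos_left (by positivity)] at h1
  refine ⟨by linarith, Real.arsinh (√((r - X ^ 2) / (X ^ 2 + Y ^ 2))) / κ, ?_, ?_⟩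
  · refine div_pos (Real.arsinh_pos_iff.2 (Real.sqrt_pos.2 ?_)) hκ
    positivity
  · rw [normSq_hyperbolaPoint, mul_neg, mul_div_cancel₀ _ hκ.ne', Real.sinh_neg,
      Real.sinh_arsinh, neg_sq, Real.sq_sqrt (by positivity), mul_div_cancel₀ _ (by positivity)]
    ring

theorem normSq_lt_normSq (S : IsKeplerAxes E h μ L κ X Y) {s t : ℝ} (hs : 0 ≤ s) (hst : s < t) :
    Complex.normSq (hyperbolaPoint κ X Y s) < Complex.normSq (hyperbolaPoint κ X Y t) := by
  have hκ := S.rate_pos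
  have hY := S.pos
  have h1 : 0 ≤ Real.sinh (κ * s) := Real.sinh_nonneg_iff.2 (by positivity)
  have h2 : Real.sinh (κ * s) < Real.sinh (κ * t) := Real.sinh_lt_sinh.2 (by gcongr)
  rw [normSq_hyperbolaPoint, normSq_hyperbolaPoint]
  have : 0 < X ^ 2 + Y ^ 2 := by positivity
  gcongr

end IsKeplerAxes

/-- The position on a regularised Kepler orbit with axis in the direction `g`. -/
noncomputable def keplerPosition (g κ X Y τ : ℝ) : ℂ :=
  Complex.exp (g * Complex.I) * hyperbolaPoint κ X Y τ ^ 2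

/-- The physical velocity on a regularised Kepler orbit. -/
noncomputable def keplerVelocity (g κ X Y τ : ℝ) : ℂ :=
  Complex.exp (g * Complex.I) *
    (2 * κ * hyperbolaTangent κ X Y τ / (starRingEnd ℂ) (hyperbolaPoint κ X Y τ))

theorem norm_keplerPosition (g κ X Y τ : ℝ) :
    ‖keplerPosition g κ X Y τ‖ = Complex.normSq (hyperbolaPoint κ X Y τ) := by
  rw [keplerPosition, norm_mul, Complex.norm_exp_ofReal_mul_I, one_mul, norm_pow,
    Complex.normSq_eq_norm_sq]

/-- The factor |U|² is dt/dτ; the change of clock in `isMotion` cancels it. -/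
theorem hasDerivAt_keplerPosition (g κ X Y τ : ℝ) (h0 : hyperbolaPoint κ X Y τ ≠ 0) :
    HasDerivAt (keplerPosition g κ X Y)
      (Complex.normSq (hyperbolaPoint κ X Y τ) • keplerVelocity g κ X Y τ) τ := by
  have h1 := ((hasDerivAt_hyperbolaPoint κ X Y τ).pow 2).const_mul (Complex.exp (g * Complex.I))
  convert! h1 using 1
  have hc : (starRingEnd ℂ) (hyperbolaPoint κ X Y τ) ≠ 0 := by simpa using h0
  rw [keplerVelocity, Complex.real_smul, ← Complex.mul_conj]
  field_simp
  simp
  ring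

namespace IsKeplerAxes

variable {L κ X Y : ℝ}

theorem hasDerivAt_keplerVelocity (S : IsKeplerAxes E h μ L κ X Y) (g τ : ℝ)
    (h0 : hyperbolaPoint κ X Y τ ≠ 0) :
    HasDerivAt (keplerVelocity g κ X Y)
      (Complex.normSq (hyperbolaPoint κ X Y τ) •
        ((-μ / ‖keplerPosition g κ X Y τ‖ ^ 3) • keplerPosition g κ X Y τ)) τ := by
  have hc : (starRingEnd ℂ) (hyperbolaPoint κ X Y τ) ≠ 0 := by simpa using h0
  have d1 : HasDerivAt (fun τ => (starRingEnd ℂ) (hyperbolaPoint κ X Y τ))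
      ((starRingEnd ℂ) (κ * hyperbolaTangent κ X Y τ)) τ :=
    HasFDerivAt.comp_hasDerivAt τ Complex.conjCLE.hasFDerivAt (hasDerivAt_hyperbolaPoint κ X Y τ)
  have d2 := (((hasDerivAt_hyperbolaTangent κ X Y τ).const_mul (2 * κ : ℂ)).fun_div d1
    hc).const_mul (Complex.exp (g * Complex.I))
  convert! d2 using 1
  rw [norm_keplerPosition, keplerPosition, Complex.real_smul, Complex.real_smul]
  -- This is energy conservation in the Levi-Civita plane: the squared moduli of tangent and point
  -- differ by the constant Y² - X².
  have e1 : hyperbolaTangent κ X Y τ * (starRingEnd ℂ) (hyperbolaTangent κ X Y τ) =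
      hyperbolaPoint κ X Y τ * (starRingEnd ℂ) (hyperbolaPoint κ X Y τ) + Y ^ 2 - X ^ 2 := by
    rw [Complex.mul_conj, Complex.mul_conj, normSq_hyperbolaPoint, normSq_hyperbolaTangent]
    push_cast
    ring
  have e2 : (μ : ℂ) = 2 * κ ^ 2 * (Y ^ 2 - X ^ 2) := by
    rw [← S.mass]
    push_cast
    rfl
  push_cast
  rw [← Complex.mul_conj, map_mul, Complex.conj_ofReal, e2]
  field_simp
  linear_combination (κ : ℂ) ^ 2 * e1

theorem energy_kepler (S : IsKeplerAxes E h μ L κ X Y) (g τ : ℝ)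
    (h0 : hyperbolaPoint κ X Y τ ≠ 0) :
    ‖keplerVelocity g κ X Y τ‖ ^ 2 / 2 - innerPotential E h μ (keplerPosition g κ X Y τ) = 0 := by
  have hn : 0 < Complex.normSq (hyperbolaPoint κ X Y τ) := Complex.normSq_pos.2 h0
  have hκ := S.rate_pos
  rw [innerPotential, norm_keplerPosition, keplerVelocity, norm_mul,
    Complex.norm_exp_ofReal_mul_I, one_mul, norm_div, norm_mul, norm_mul,
    Complex.norm_of_nonneg hκ.le, Complex.norm_two, RCLike.norm_conj, div_pow, mul_pow,
    ← Complex.normSq_eq_norm_sq, ← Complex.normSq_eq_norm_sq, ← S.energy, ← S.mass]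
  have e1 : Complex.normSq (hyperbolaTangent κ X Y τ) =
      Complex.normSq (hyperbolaPoint κ X Y τ) + Y ^ 2 - X ^ 2 := by
    rw [normSq_hyperbolaPoint, normSq_hyperbolaTangent]
    ring
  rw [e1]
  field_simp
  ring

theorem kepler_incoming (S : IsKeplerAxes E h μ L κ X Y) (g : ℝ) {s : ℝ} (hs : 0 < s) {r : ℝ}
    (hr : r = Complex.normSq (hyperbolaPoint κ X Y (-s))) :
    keplerPosition g κ X Y (-s) =
        r * Complex.exp (((g + innerAngle E h μ r L : ℝ) : ℂ) * Complex.I) ∧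
      keplerVelocity g κ X Y (-s) = ⟨-innerSpeed E h μ r L, L / r⟩ *
        Complex.exp (((g + innerAngle E h μ r L : ℝ) : ℂ) * Complex.I) := by
  obtain ⟨-, h2, h3⟩ := S.inner_polar hs hr
  rw [keplerPosition, keplerVelocity, h2, h3, exp_mul_mul_exp, exp_mul_mul_exp]
  exact ⟨rfl, rfl⟩

theorem kepler_outgoing (S : IsKeplerAxes E h μ L κ X Y) (g : ℝ) {s : ℝ} (hs : 0 < s) {r : ℝ}
    (hr : r = Complex.normSq (hyperbolaPoint κ X Y (-s))) :
    keplerPosition g κ X Y s =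
        r * Complex.exp (((g - innerAngle E h μ r L : ℝ) : ℂ) * Complex.I) ∧
      keplerVelocity g κ X Y s = ⟨innerSpeed E h μ r L, L / r⟩ *
        Complex.exp (((g - innerAngle E h μ r L : ℝ) : ℂ) * Complex.I) := by
  obtain ⟨-, h2, h3⟩ := S.inner_polar hs hr
  have e1 : hyperbolaPoint κ X Y s = -(starRingEnd ℂ) (hyperbolaPoint κ X Y (-s)) := by
    rw [← hyperbolaPoint_neg, neg_neg]
  have e2 : hyperbolaTangent κ X Y s = (starRingEnd ℂ) (hyperbolaTangent κ X Y (-s)) := by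
    rw [← hyperbolaTangent_neg, neg_neg]
  have h2' : hyperbolaPoint κ X Y s ^ 2 =
      r * Complex.exp (((-innerAngle E h μ r L : ℝ) : ℂ) * Complex.I) := by
    rw [e1, neg_sq, ← map_pow, h2, map_mul, Complex.conj_ofReal, conj_exp_mul_I]
  have h3' : 2 * κ * hyperbolaTangent κ X Y s / (starRingEnd ℂ) (hyperbolaPoint κ X Y s) =
      ⟨innerSpeed E h μ r L, L / r⟩ *
        Complex.exp (((-innerAngle E h μ r L : ℝ) : ℂ) * Complex.I) := by
    have := congrArg (starRingEnd ℂ) h3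
    rw [map_mul, conj_exp_mul_I, map_div₀, map_mul, ← e2, map_mul, Complex.conj_ofReal] at this
    rw [e1, map_neg, div_neg, ← map_ofNat (starRingEnd ℂ) 2, this, ← neg_mul]
    congr 1
    simp [Complex.ext_iff]
  rw [keplerPosition, keplerVelocity, h2', h3', exp_mul_mul_exp, exp_mul_mul_exp,
    ← sub_eq_add_neg]
  exact ⟨rfl, rfl⟩

/-- The physical time as an increasing bijection. -/
noncomputable def clock (S : IsKeplerAxes E h μ L κ X Y) : ℝ ≃o ℝ :=
  (strictMono_keplerTime (X := X) S.rate_pos S.pos).orderIsoOfSurjective _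
    (surjective_keplerTime S.rate_pos S.pos)

theorem clock_neg (S : IsKeplerAxes E h μ L κ X Y) (τ : ℝ) : S.clock (-τ) = -S.clock τ :=
  keplerTime_neg κ X Y τ

theorem clock_symm_neg (S : IsKeplerAxes E h μ L κ X Y) (t : ℝ) :
    S.clock.symm (-t) = -S.clock.symm t := by
  rw [OrderIso.symm_apply_eq, clock_neg, OrderIso.apply_symm_apply]

theorem hasDerivAt_clock_symm (S : IsKeplerAxes E h μ L κ X Y) (t : ℝ)
    (h0 : hyperbolaPoint κ X Y (S.clock.symm t) ≠ 0) :
    HasDerivAt S.clock.symm (Complex.normSq (hyperbolaPoint κ X Y (S.clock.symm t)))⁻¹ t :=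
  HasDerivAt.of_local_left_inverse S.clock.symm.continuous.continuousAt
    (hasDerivAt_keplerTime S.rate_pos X Y _) (Complex.normSq_pos.2 h0).ne'
    (Eventually.of_forall S.clock.apply_symm_apply)

/-- Only collision times need to be excluded from `J`, so this serves classical and
ejection-collision arcs alike. -/
theorem isMotion (S : IsKeplerAxes E h μ L κ X Y) (g t₀ : ℝ) {J : Set ℝ}
    (hJ : ∀ t ∈ J, hyperbolaPoint κ X Y (S.clock.symm (t - t₀)) ≠ 0) :
    IsMotion (innerPotential E h μ) J (fun t => keplerPosition g κ X Y (S.clock.symm (t - t₀)))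
      (fun t => keplerVelocity g κ X Y (S.clock.symm (t - t₀))) := by
  intro t ht
  have h0 := hJ t ht
  have hn := (Complex.normSq_pos.2 h0).ne'
  have h1 : HasDerivAt (fun t => S.clock.symm (t - t₀)) _ t :=
    (S.hasDerivAt_clock_symm _ h0).comp_sub_const t t₀
  refine ⟨?_, ?_, S.energy_kepler g _ h0⟩
  · have := (hasDerivAt_keplerPosition g κ X Y _ h0).scomp t h1
    rw [smul_smul, inv_mul_cancel₀ hn, one_smul] at this
    exact this.hasDerivWithinAt
  · have := (S.hasDerivAt_keplerVelocity g _ h0).scomp t h1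
    rw [smul_smul, inv_mul_cancel₀ hn, one_smul] at this
    rw [(hasGradientAt_innerPotential _).gradient]
    · exact this.hasDerivWithinAt
    · rw [← norm_pos_iff, norm_keplerPosition]
      exact Complex.normSq_pos.2 h0

end IsKeplerAxes
end RefractionBilliard

/-! ### Existence of inner arcs. -/

namespace RefractionBilliard

open Set Filter Topology

variable {E h μ ω Λ r₁ r₂ δ M : ℝ} {ρ : ℝ → ℝ}

theorem innerAngle_zero (hμ : 0 < μ) (r : ℝ) : innerAngle E h μ r 0 = 0 := by
  have : Complex.arg ⟨μ, 0⟩ = 0 := Complex.arg_ofReal_of_nonneg hμ.le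
  simpa [innerAngle] using this

theorem hyperbolaPoint_ne_zero {κ X Y τ : ℝ} (hκ : 0 < κ) (hY : 0 < Y) (h : X ≠ 0 ∨ τ ≠ 0) :
    hyperbolaPoint κ X Y τ ≠ 0 := by
  rw [← Complex.normSq_pos, normSq_hyperbolaPoint]
  rcases h with h | h
  · positivity
  · have : Real.sinh (κ * τ) ≠ 0 := Real.sinh_ne_zero.2 (mul_ne_zero hκ.ne' h)
    positivity

theorem mem_interiorDomain_of_norm_lt (N : NearCircle r₁ r₂ δ ρ) {z : ℂ} (hz : ‖z‖ < r₁) :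
    z ∈ interiorDomain ρ := hz.trans (N.mem_Ioo _).1

/-- The inner arc of the orbit with angular momentum `L` and pericentre opposite to `g`. -/
theorem exists_isInnerArc (hEh : 0 < E + h) (hμ : 0 < μ)
    (D : SectionChart Λ r₁ r₂ δ M (innerSpeed E h μ) (innerAngle E h μ)
      (speedDeriv (innerSpeed E h μ)))
    (N : NearCircle r₁ r₂ δ ρ)
    (hq : ∀ r ∈ Icc r₁ r₂, ∀ L ∈ Icc (-Λ) Λ, 0 < 2 * (E + h) + 2 * μ / r - L ^ 2 / r ^ 2)
    {L g ξ η : ℝ} (hL : L ∈ Icc (-Λ) Λ) (hη : η + (-innerAngle E h μ) (ρ η) L = g)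
    (hξ : ξ + innerAngle E h μ (ρ ξ) L = g) :
    ∃ (T : ℝ) (z v : ℝ → ℂ), IsInnerArc E h μ ρ T z v ∧
      z 0 = boundaryCurve ρ η ∧ v 0 = orbitVelocity ρ η (-innerSpeed E h μ (ρ η) L) L ∧
      z T = boundaryCurve ρ ξ ∧ v T = orbitVelocity ρ ξ (innerSpeed E h μ (ρ ξ) L) L := by
  obtain ⟨κ, X, Y, S⟩ := exists_isKeplerAxes hEh hμ L
  have hκ := S.rate_pos
  have hY := S.pos
  have hr₁ : r₁ ∈ Icc r₁ r₂ := ⟨le_rfl, (N.mem_Icc 0).1.trans (N.mem_Icc 0).2⟩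
  have hXr : X ^ 2 < r₁ := (S.exists_normSq_eq N.pos (hq _ hr₁ L hL)).1
  obtain ⟨-, s₁, hs₁, e₁⟩ := S.exists_normSq_eq (N.radius_pos η) (hq _ (N.mem_Icc η) L hL)
  obtain ⟨-, s₂, hs₂, e₂⟩ := S.exists_normSq_eq (N.radius_pos ξ) (hq _ (N.mem_Icc ξ) L hL)
  obtain ⟨a1, a2⟩ := S.kepler_incoming g hs₁ e₁
  obtain ⟨b1, b2⟩ := S.kepler_outgoing g hs₂ e₂
  have hηg : g + innerAngle E h μ (ρ η) L = η := by
    simp only [Pi.neg_apply] at hη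
    linarith
  have hξg : g - innerAngle E h μ (ρ ξ) L = ξ := by linarith
  rw [hηg] at a1 a2
  rw [hξg] at b1 b2
  have hn : ∀ s, Complex.normSq (hyperbolaPoint κ X Y (-s)) =
      Complex.normSq (hyperbolaPoint κ X Y s) := fun s => by
    rw [hyperbolaPoint_neg, Complex.normSq_neg, Complex.normSq_conj]
  have hclock0 : S.clock 0 = 0 := by
    have := S.clock_neg 0
    rw [neg_zero] at this
    linarith
  have hc1 : 0 < S.clock s₁ := hclock0 ▸ S.clock.strictMono hs₁
  have hc2 : 0 < S.clock s₂ := hclock0 ▸ S.clock.strictMono hs₂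
  have hsymm0 : S.clock.symm 0 = 0 := S.clock.symm_apply_eq.2 hclock0.symm
  refine ⟨S.clock s₁ + S.clock s₂, fun t => keplerPosition g κ X Y (S.clock.symm (t - S.clock s₁)),
    fun t => keplerVelocity g κ X Y (S.clock.symm (t - S.clock s₁)), ⟨by positivity, ?_, ?_⟩,
    ?_, ?_, ?_, ?_⟩
  -- X = 0 forces L = 0 and a collision. The axis angle is then 0, so entry and exit coincide, `s₁ =
  -- s₂`, and the collision happens at half of the total time.
  · rcases eq_or_ne X 0 with hX | hX
    · right
      have hL0 : L = 0 := by rw [← S.momentum, hX]; ring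
      have hηξ : η = ξ := by
        rw [hL0, Pi.neg_apply, Pi.neg_apply, innerAngle_zero hμ] at hη
        rw [hL0, innerAngle_zero hμ] at hξ
        linarith
      have hss : s₁ = s₂ := by
        rw [hn] at e₁ e₂
        rcases lt_trichotomy s₁ s₂ with hlt | heq | hlt
        · have := S.normSq_lt_normSq hs₁.le hlt
          rw [← e₁, ← e₂, hηξ] at this
          exact absurd this (lt_irrefl _)
        · exact heq
        · have := S.normSq_lt_normSq hs₂.le hlt
          rw [← e₁, ← e₂, hηξ] at this
          exact absurd this (lt_irrefl _)
      subst hss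
      have hhalf : (S.clock s₁ + S.clock s₁) / 2 = S.clock s₁ := by ring
      rw [IsEjectionCollision, hhalf]
      have hne : ∀ t ∈ Icc 0 (S.clock s₁ + S.clock s₁) \ {S.clock s₁},
          hyperbolaPoint κ X Y (S.clock.symm (t - S.clock s₁)) ≠ 0 := by
        intro t ht
        refine hyperbolaPoint_ne_zero hκ hY (Or.inr fun h0 => ht.2 ?_)
        rw [OrderIso.symm_apply_eq, hclock0] at h0
        exact sub_eq_zero.1 h0
      refine ⟨?_, ?_, ?_, S.isMotion g _ hne, ?_⟩
      · have h1 : Continuous (hyperbolaPoint κ X Y) := continuous_iff_continuousAt.2 fun τ =>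
          (hasDerivAt_hyperbolaPoint κ X Y τ).continuousAt
        have h2 : Continuous (keplerPosition g κ X Y) := continuous_const.mul (h1.pow 2)
        exact (h2.comp (S.clock.symm.continuous.comp
          (continuous_id.sub continuous_const))).continuousOn
      · rw [sub_self, hsymm0]
        simp [keplerPosition, hyperbolaPoint, hX, Complex.ext_iff]
      · intro t ht
        rw [← norm_pos_iff, norm_keplerPosition]
        exact Complex.normSq_pos.2 (hne t ht)
      · intro t _
        rw [show S.clock s₁ + S.clock s₁ - t - S.clock s₁ = -(t - S.clock s₁) by ring,
          S.clock_symm_neg]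
        generalize S.clock.symm (t - S.clock s₁) = τ
        simp [keplerPosition, hyperbolaPoint, hX, Complex.ext_iff, sq]
    · left
      have hne : ∀ t ∈ Icc 0 (S.clock s₁ + S.clock s₂),
          hyperbolaPoint κ X Y (S.clock.symm (t - S.clock s₁)) ≠ 0 := fun t _ =>
        hyperbolaPoint_ne_zero hκ hY (Or.inl hX)
      refine ⟨S.isMotion g _ hne, fun t ht => ?_⟩
      simp only
      rw [← norm_pos_iff, norm_keplerPosition]
      exact Complex.normSq_pos.2 (hne t ht)
  · intro t ht
    simp only
    have hlo : -s₁ < S.clock.symm (t - S.clock s₁) := by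
      rw [OrderIso.lt_symm_apply, S.clock_neg]
      linarith [ht.1]
    have hhi : S.clock.symm (t - S.clock s₁) < s₂ := by
      rw [OrderIso.symm_apply_lt]
      linarith [ht.2]
    generalize S.clock.symm (t - S.clock s₁) = τ at hlo hhi
    rcases lt_trichotomy τ 0 with h0 | h0 | h0
    · obtain ⟨s, rfl⟩ : ∃ s, τ = -s := ⟨-τ, (neg_neg τ).symm⟩
      have hs : 0 < s := by linarith
      have h4 := (S.kepler_incoming g hs rfl).1
      have h5 := S.normSq_lt_normSq hs.le (neg_lt_neg_iff.1 hlo)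
      rw [← hn, ← hn s₁, ← e₁] at h5
      rw [h4]
      refine mem_interiorDomain N (S.inner_polar hs rfl).1 ?_
      have := D.neg.lt_radius_of_lt N hL hη h5
      simpa using this
    -- At the pericentre neither half applies; its distance X² is below `r₁`.
    · refine mem_interiorDomain_of_norm_lt N ?_
      rw [norm_keplerPosition, normSq_hyperbolaPoint, h0]
      simpa using hXr
    · have h4 := (S.kepler_outgoing g h0 rfl).1
      have h5 := S.normSq_lt_normSq h0.le hhi
      rw [← hn, ← hn s₂, ← e₂] at h5
      rw [h4]
      exact mem_interiorDomain N (S.inner_polar h0 rfl).1 (D.lt_radius_of_lt N hL hξ h5)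
  · simpa [← S.clock_neg, boundaryCurve] using a1
  · simpa [← S.clock_neg, orbitVelocity] using a2
  · simpa [boundaryCurve] using b1
  · simpa [orbitVelocity] using b2

end RefractionBilliard

/-! ### Conservation laws and uniqueness of inner arcs. -/

namespace RefractionBilliard

open Set Filter Topology

variable {E h μ ω Λ r₁ r₂ δ M : ℝ} {ρ : ℝ → ℝ}

/-- The angular momentum of a particle at `z` with velocity `v`. -/
noncomputable def angularMomentum (z v : ℂ) : ℝ := ((starRingEnd ℂ) z * v).im

/-- The Laplace-Runge-Lenz vector, for the value `L` of the angular momentum. -/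
noncomputable def lenzVector (μ L : ℝ) (z v : ℂ) : ℂ := (μ / ‖z‖) • z + L • (Complex.I * v)

section Conservation

variable {J : Set ℝ} {z v : ℝ → ℂ} {s : ℝ}

theorem hasDerivWithinAt_angularMomentum (H : IsMotion (innerPotential E h μ) J z v) (hs : s ∈ J)
    (hz : z s ≠ 0) :
    HasDerivWithinAt (fun s => angularMomentum (z s) (v s)) 0 J s := by
  obtain ⟨h1, h2, -⟩ := H s hs
  rw [(hasGradientAt_innerPotential hz).gradient] at h2
  have h3 : HasDerivWithinAt (fun s => (starRingEnd ℂ) (z s)) ((starRingEnd ℂ) (v s)) J s :=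
    HasFDerivAt.comp_hasDerivWithinAt s Complex.conjCLE.hasFDerivAt h1
  have h4 : HasDerivWithinAt (fun s => ((starRingEnd ℂ) (z s) * v s).im) _ J s :=
    HasFDerivAt.comp_hasDerivWithinAt s Complex.imCLM.hasFDerivAt (h3.fun_mul h2)
  generalize -μ / ‖z s‖ ^ 3 = c at h4
  convert! h4 using 1
  simp
  ring

theorem hasDerivWithinAt_lenzVector (H : IsMotion (innerPotential E h μ) J z v) (hs : s ∈ J)
    (hz : z s ≠ 0) {L : ℝ} (hL : angularMomentum (z s) (v s) = L) :
    HasDerivWithinAt (fun s => lenzVector μ L (z s) (v s)) 0 J s := by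
  obtain ⟨h1, h2, -⟩ := H s hs
  have hg := hasGradientAt_innerPotential (E := E) (h := h) (μ := μ) hz
  rw [hg.gradient] at h2
  have h3 : HasDerivWithinAt (fun s => innerPotential E h μ (z s)) _ J s :=
    hg.hasFDerivAt.comp_hasDerivWithinAt s h1
  have h4 : HasDerivWithinAt (fun s => μ / ‖z s‖)
      ((InnerProductSpace.toDual ℝ ℂ) ((-μ / ‖z s‖ ^ 3) • z s) (v s)) J s :=
    (h3.sub_const (E + h)).congr (fun s _ => by simp [innerPotential]) (by simp [innerPotential])
  have h5 := (h4.fun_smul h1).fun_add ((h2.const_mul Complex.I).fun_const_smul L)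
  refine h5.congr_deriv ?_
  have hn : (‖z s‖ : ℂ) ≠ 0 := by simpa using hz
  have e1 : (‖z s‖ : ℂ) ^ 2 = z s * (starRingEnd ℂ) (z s) := by
    rw [Complex.mul_conj, Complex.normSq_eq_norm_sq]
    push_cast
    rfl
  have e2 : (starRingEnd ℂ) (z s) * v s = (inner ℝ (z s) (v s) : ℝ) + L * Complex.I := by
    rw [← hL, Complex.inner, angularMomentum, mul_comm (v s), Complex.re_add_im]
  rw [InnerProductSpace.toDual_apply_apply, real_inner_smul_left]
  simp only [Complex.real_smul]
  push_cast
  field_simp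
  linear_combination (μ : ℂ) * v s * e1 + (μ : ℂ) * z s * e2

/-- This is the Lagrange-Jacobi identity. When E + h and μ are positive it makes z · v strictly
increasing, which excludes a return to the initial state. -/
theorem hasDerivWithinAt_inner (H : IsMotion (innerPotential E h μ) J z v) (hs : s ∈ J)
    (hz : z s ≠ 0) :
    HasDerivWithinAt (fun s => inner ℝ (z s) (v s)) (2 * (E + h) + μ / ‖z s‖) J s := by
  obtain ⟨h1, h2, h3⟩ := H s hs
  rw [(hasGradientAt_innerPotential hz).gradient] at h2
  refine (h1.inner ℝ h2).congr_deriv ?_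
  rw [innerPotential] at h3
  have hn : ‖z s‖ ≠ 0 := by simpa using hz
  rw [real_inner_smul_right, real_inner_self_eq_norm_sq, real_inner_self_eq_norm_sq]
  have : -μ / ‖z s‖ ^ 3 * ‖z s‖ ^ 2 = -(μ / ‖z s‖) := by field_simp
  rw [this]
  linarith

end Conservation

theorem angularMomentum_boundary (N : NearCircle r₁ r₂ δ ρ) (ξ a L : ℝ) :
    angularMomentum (boundaryCurve ρ ξ) (orbitVelocity ρ ξ a L) = L := by
  have hr := N.radius_pos ξ
  rw [angularMomentum, boundaryCurve, orbitVelocity, map_mul, conj_exp_mul_I, mul_mul_mul_comm,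
    ← Complex.exp_add]
  simp
  field_simp

theorem inner_boundary (ξ a L : ℝ) :
    inner ℝ (boundaryCurve ρ ξ) (orbitVelocity ρ ξ a L) = ρ ξ * a := by
  rw [boundaryCurve, orbitVelocity, inner_mul_exp]
  simp

theorem lenzVector_boundary (N : NearCircle r₁ r₂ δ ρ) (ξ a L : ℝ) :
    lenzVector μ L (boundaryCurve ρ ξ) (orbitVelocity ρ ξ a L) =
      ⟨μ - L ^ 2 / ρ ξ, L * a⟩ * Complex.exp (ξ * Complex.I) := by
  have hr := N.radius_pos ξ
  rw [lenzVector, N.norm_boundaryCurve, boundaryCurve, orbitVelocity, Complex.real_smul,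
    Complex.real_smul, Complex.mk_eq_add_mul_I, Complex.mk_eq_add_mul_I]
  have hr' : (ρ ξ : ℂ) ≠ 0 := Complex.ofReal_ne_zero.2 hr.ne'
  push_cast
  field_simp
  linear_combination (L : ℂ) ^ 2 * Complex.I_sq

theorem orbitVelocity_add_period (hρ : Function.Periodic ρ (2 * Real.pi)) (ξ a L : ℝ) (n : ℤ) :
    orbitVelocity ρ (ξ + n * (2 * Real.pi)) a L = orbitVelocity ρ ξ a L := by
  rw [orbitVelocity, orbitVelocity, hρ.int_mul n, exp_add_period]

theorem lenz_polar (hμ : 0 < μ) {r L : ℝ} (hq : 0 < 2 * (E + h) + 2 * μ / r - L ^ 2 / r ^ 2) :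
    ∃ c : ℝ, 0 < c ∧
      (⟨μ - L ^ 2 / r, L * innerSpeed E h μ r L⟩ : ℂ) =
        c * Complex.exp (innerAngle E h μ r L * Complex.I) ∧
      (⟨μ - L ^ 2 / r, L * -innerSpeed E h μ r L⟩ : ℂ) =
        c * Complex.exp (((-innerAngle E h μ r L : ℝ) : ℂ) * Complex.I) := by
  have hs := innerAngle_mem_slitPlane hμ hq
  refine ⟨_, norm_pos_iff.2 (Complex.slitPlane_ne_zero hs),
    (Complex.norm_mul_exp_arg_mul_I _).symm, ?_⟩
  have := congrArg (starRingEnd ℂ) (Complex.norm_mul_exp_arg_mul_I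
    ⟨μ - L ^ 2 / r, L * innerSpeed E h μ r L⟩)
  rw [map_mul, Complex.conj_ofReal, conj_exp_mul_I] at this
  rw [innerAngle, this]
  simp [Complex.ext_iff]

/-- The energy leaves two signs for the final radial speed, and equality of the Lenz vectors then
fixes the angle modulo 2π. The plus sign is the claimed exit; with the minus sign the end would
repeat the initial position and velocity, against the strict growth of z · v. -/
theorem IsClassicalKepler.end_unique (hEh : 0 < E + h) (hμ : 0 < μ)
    (D : SectionChart Λ r₁ r₂ δ M (innerSpeed E h μ) (innerAngle E h μ)
      (speedDeriv (innerSpeed E h μ)))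
    (N : NearCircle r₁ r₂ δ ρ)
    (hq : ∀ r ∈ Icc r₁ r₂, ∀ L ∈ Icc (-Λ) Λ, 0 < 2 * (E + h) + 2 * μ / r - L ^ 2 / r ^ 2)
    {L η ζ : ℝ} (hL : L ∈ Icc (-Λ) Λ) {T : ℝ} {z v : ℝ → ℂ} (hT : 0 < T)
    (H : IsClassicalKepler E h μ T z v) (hz : z 0 = boundaryCurve ρ η)
    (hv : v 0 = orbitVelocity ρ η (-innerSpeed E h μ (ρ η) L) L) (hzT : z T = boundaryCurve ρ ζ) :
    (∃ n : ℤ, ζ + innerAngle E h μ (ρ ζ) L =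
      η - innerAngle E h μ (ρ η) L + n * (2 * Real.pi)) ∧
      v T = orbitVelocity ρ ζ (innerSpeed E h μ (ρ ζ) L) L := by
  obtain ⟨Hm, H0⟩ := H
  have m0 : (0 : ℝ) ∈ Icc 0 T := left_mem_Icc.2 hT.le
  have mT : T ∈ Icc 0 T := right_mem_Icc.2 hT.le
  have hmom : ∀ s ∈ Icc 0 T, angularMomentum (z s) (v s) = L := fun s hs => by
    have := eq_of_hasDerivWithinAt_zero (convex_Icc 0 T)
      (fun s hs => hasDerivWithinAt_angularMomentum Hm hs (H0 s hs)) m0 hs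
    rw [this, hz, hv, angularMomentum_boundary N]
  have hlenz := eq_of_hasDerivWithinAt_zero (convex_Icc 0 T)
    (fun s hs => hasDerivWithinAt_lenzVector Hm hs (H0 s hs) (hmom s hs)) m0 mT
  have hmono : StrictMonoOn (fun s => inner ℝ (z s) (v s)) (Icc 0 T) := by
    refine strictMonoOn_of_deriv_pos (convex_Icc 0 T)
      (fun s hs => (hasDerivWithinAt_inner Hm hs (H0 s hs)).continuousWithinAt) fun s hs => ?_
    rw [interior_Icc] at hs
    have hs' := Ioo_subset_Icc_self hs
    rw [((hasDerivWithinAt_inner Hm hs' (H0 s hs')).hasDerivAt (Icc_mem_nhds hs.1 hs.2)).deriv]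
    positivity
  have hlt := hmono m0 mT hT
  obtain ⟨a, L', hvT⟩ := N.exists_eq_orbitVelocity ζ (v T)
  have hL' : L' = L := by
    rw [← hmom T mT, hzT, hvT, angularMomentum_boundary N]
  subst hL'
  have hqζ := hq _ (N.mem_Icc ζ) _ hL
  have hqη := hq _ (N.mem_Icc η) _ hL
  have ha : innerSpeed E h μ (ρ ζ) L' = |a| := by
    have he := (Hm T mT).2.2
    rw [hvT, norm_sq_orbitVelocity, hzT, innerPotential, N.norm_boundaryCurve] at he
    rw [innerSpeed, ← Real.sqrt_sq_eq_abs]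
    congr 1
    linear_combination -2 * he
  rw [hz, hv, hzT, hvT, lenzVector_boundary N, lenzVector_boundary N] at hlenz
  simp only [hz, hv, hzT, hvT, inner_boundary] at hlt
  obtain ⟨c, hc, -, hcη⟩ := lenz_polar hμ hqη
  obtain ⟨d, hd, hdζ, hdζ'⟩ := lenz_polar hμ hqζ
  rw [hcη] at hlenz
  rcases abs_choice a with h2 | h2
  · rw [h2] at ha
    rw [← ha, hdζ, mul_assoc, mul_assoc, ← Complex.exp_add, ← Complex.exp_add, ← add_mul,
      ← add_mul, ← Complex.ofReal_add, ← Complex.ofReal_add] at hlenz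
    obtain ⟨n, hn⟩ := exists_period_of_mul_exp_eq hd hc hlenz
    exact ⟨⟨n, by linarith⟩, by rw [hvT, ha]⟩
  · exfalso
    have ha' : a = -innerSpeed E h μ (ρ ζ) L' := by rw [ha, h2, neg_neg]
    rw [ha', hdζ', mul_assoc, mul_assoc, ← Complex.exp_add, ← Complex.exp_add, ← add_mul,
      ← add_mul, ← Complex.ofReal_add, ← Complex.ofReal_add] at hlenz
    obtain ⟨n, hn⟩ := exists_period_of_mul_exp_eq hd hc hlenz
    have e1 : ρ (η + n * (2 * Real.pi)) = ρ η := N.periodic.int_mul n η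
    have e2 : ζ = η + n * (2 * Real.pi) := by
      refine (D.neg.strictMono_angle N hL).injective ?_
      simp only [Pi.neg_apply, e1]
      linarith
    rw [ha', e2, e1] at hlt
    exact lt_irrefl _ hlt

/-- Before the collision L² ≤ |z|²|v|² = 2(E + h)|z|² + 2μ|z|, which tends to 0, so the constant L
vanishes. Differentiating z(T - s) = z(s) at s = 0 gives v(T) = -v(0). -/
theorem IsEjectionCollision.end_unique
    (N : NearCircle r₁ r₂ δ ρ) {L η ζ : ℝ} {T : ℝ} {z v : ℝ → ℂ} (hT : 0 < T)
    (H : IsEjectionCollision E h μ T z v) (hz : z 0 = boundaryCurve ρ η)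
    (hv : v 0 = orbitVelocity ρ η (-innerSpeed E h μ (ρ η) L) L) (hzT : z T = boundaryCurve ρ ζ) :
    L = 0 ∧ (∃ n : ℤ, ζ = η + n * (2 * Real.pi)) ∧
      v T = orbitVelocity ρ ζ (innerSpeed E h μ (ρ ζ) L) L := by
  obtain ⟨Hc, Hhalf, H0, Hm, Hsymm⟩ := H
  have hJ : Ico 0 (T / 2) ⊆ Icc 0 T \ {T / 2} := fun s hs =>
    ⟨⟨hs.1, by linarith [hs.2]⟩, fun h0 => by rw [mem_singleton_iff] at h0; linarith [hs.2]⟩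
  have hL : L = 0 := by
    have hmom : ∀ s ∈ Ico 0 (T / 2), angularMomentum (z s) (v s) = L := fun s hs => by
      have := eq_of_hasDerivWithinAt_zero (convex_Ico 0 (T / 2)) (fun s hs =>
        hasDerivWithinAt_angularMomentum (Hm.mono hJ) hs (H0 s (hJ hs)))
        (left_mem_Ico.2 (by linarith)) hs
      rw [this, hz, hv, angularMomentum_boundary N]
    have hbound : ∀ s ∈ Ico 0 (T / 2), L ^ 2 ≤ 2 * (E + h) * ‖z s‖ ^ 2 + 2 * μ * ‖z s‖ := by
      intro s hs
      have he := (Hm s (hJ hs)).2.2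
      rw [innerPotential] at he
      have hn : 0 < ‖z s‖ := norm_pos_iff.2 (H0 s (hJ hs))
      have h1 : |L| ≤ ‖z s‖ * ‖v s‖ := by
        rw [← hmom s hs, angularMomentum]
        refine (Complex.abs_im_le_norm _).trans_eq ?_
        rw [norm_mul, RCLike.norm_conj]
      calc L ^ 2 = |L| ^ 2 := (sq_abs L).symm
        _ ≤ (‖z s‖ * ‖v s‖) ^ 2 := by gcongr
        _ = ‖z s‖ ^ 2 * (2 * (E + h + μ / ‖z s‖)) := by
            rw [mul_pow, show ‖v s‖ ^ 2 = 2 * (E + h + μ / ‖z s‖) by linarith]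
        _ = 2 * (E + h) * ‖z s‖ ^ 2 + 2 * μ * ‖z s‖ := by field_simp
    have ht : Tendsto z (𝓝[Ico 0 (T / 2)] (T / 2)) (𝓝 0) := by
      rw [← Hhalf]
      exact (Hc (T / 2) ⟨by linarith, by linarith⟩).mono (hJ.trans sdiff_subset)
    have ht' : Tendsto (fun s => 2 * (E + h) * ‖z s‖ ^ 2 + 2 * μ * ‖z s‖)
        (𝓝[Ico 0 (T / 2)] (T / 2)) (𝓝 0) := by
      have := ((ht.norm.pow 2).const_mul (2 * (E + h))).add (ht.norm.const_mul (2 * μ))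
      simpa using this
    have : (𝓝[Ico 0 (T / 2)] (T / 2)).NeBot := right_nhdsWithin_Ico_neBot (by linarith)
    have hle : L ^ 2 ≤ 0 := ge_of_tendsto ht' (by
      filter_upwards [self_mem_nhdsWithin] with s hs using hbound s hs)
    exact pow_eq_zero_iff two_ne_zero |>.1 (le_antisymm hle (sq_nonneg L))
  have hz0 : z T = z 0 := by simpa using Hsymm 0 (left_mem_Icc.2 hT.le)
  obtain ⟨n, hn⟩ := N.exists_period_of_boundaryCurve_eq ((hzT.symm.trans hz0).trans hz)
  have m0 : (0 : ℝ) ∈ Icc 0 T \ {T / 2} :=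
    ⟨left_mem_Icc.2 hT.le, fun h0 => by rw [mem_singleton_iff] at h0; linarith⟩
  have mT : T ∈ Icc 0 T \ {T / 2} :=
    ⟨right_mem_Icc.2 hT.le, fun h0 => by rw [mem_singleton_iff] at h0; linarith⟩
  have hvT : v T = -v 0 := by
    have hmaps : MapsTo (fun s => T - s) (Icc 0 T \ {T / 2}) (Icc 0 T \ {T / 2}) := by
      intro s hs
      refine ⟨⟨by linarith [hs.1.2], by linarith [hs.1.1]⟩, fun h0 => hs.2 ?_⟩
      rw [mem_singleton_iff] at h0 ⊢
      linarith
    have h1 : HasDerivWithinAt z (v T) (Icc 0 T \ {T / 2}) (T - 0) := by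
      rw [sub_zero]
      exact (Hm T mT).1
    have h2 := (h1.scomp 0 ((hasDerivWithinAt_id 0 _).const_sub T) hmaps).congr
      (f₁ := z) (fun s hs => (Hsymm s hs.1).symm) (Hsymm 0 m0.1).symm
    have hu : UniqueDiffWithinAt ℝ (Icc 0 T \ {T / 2}) 0 :=
      (uniqueDiffOn_Ico 0 (T / 2) 0 (left_mem_Ico.2 (by linarith))).mono hJ
    have h3 := hu.eq_deriv _ (Hm 0 m0).1 h2
    rw [h3]
    simp
  refine ⟨hL, ⟨n, hn⟩, ?_⟩
  rw [hvT, hv, hn, orbitVelocity_add_period N.periodic, N.periodic.int_mul n, hL, orbitVelocity,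
    orbitVelocity, ← neg_mul]
  congr 1
  simp [Complex.ext_iff]

theorem IsInnerArc.end_unique (hEh : 0 < E + h) (hμ : 0 < μ)
    (D : SectionChart Λ r₁ r₂ δ M (innerSpeed E h μ) (innerAngle E h μ)
      (speedDeriv (innerSpeed E h μ)))
    (N : NearCircle r₁ r₂ δ ρ)
    (hq : ∀ r ∈ Icc r₁ r₂, ∀ L ∈ Icc (-Λ) Λ, 0 < 2 * (E + h) + 2 * μ / r - L ^ 2 / r ^ 2)
    {L g ξ η ζ : ℝ} (hL : L ∈ Icc (-Λ) Λ) (hη : η + (-innerAngle E h μ) (ρ η) L = g)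
    (hξ : ξ + innerAngle E h μ (ρ ξ) L = g) {T : ℝ} {z v : ℝ → ℂ}
    (H : IsInnerArc E h μ ρ T z v) (hz : z 0 = boundaryCurve ρ η)
    (hv : v 0 = orbitVelocity ρ η (-innerSpeed E h μ (ρ η) L) L) (hzT : z T = boundaryCurve ρ ζ) :
    (∃ n : ℤ, ζ = ξ + n * (2 * Real.pi)) ∧
      v T = orbitVelocity ρ ζ (innerSpeed E h μ (ρ ζ) L) L := by
  obtain ⟨hT, H | H, -⟩ := H
  · obtain ⟨⟨n, hn⟩, hvT⟩ := H.end_unique hEh hμ D N hq hL hT hz hv hzT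
    refine ⟨⟨n, (D.strictMono_angle N hL).injective ?_⟩, hvT⟩
    have e1 : ρ (ξ + n * (2 * Real.pi)) = ρ ξ := N.periodic.int_mul n ξ
    simp only [Pi.neg_apply] at hη
    simp only [e1]
    linarith
  · obtain ⟨rfl, ⟨n, hn⟩, hvT⟩ := H.end_unique N hT hz hv hzT
    rw [Pi.neg_apply, Pi.neg_apply, innerAngle_zero hμ] at hη
    rw [innerAngle_zero hμ] at hξ
    exact ⟨⟨n, by linarith⟩, hvT⟩

end RefractionBilliard

/-! ### The arc maps and their composition, the return map. -/

namespace RefractionBilliard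

open Set Filter Topology

variable {E h μ ω Λ r₁ r₂ δ M : ℝ} {P Θ Q : ℝ → ℝ → ℝ} {ρ : ℝ → ℝ}

/-- The map from the position and tangential momentum at the start of an arc to those at its end,
when the arc is symmetric about its axis. -/
noncomputable def arcMap (P Θ : ℝ → ℝ → ℝ) (Λ : ℝ) (ρ : ℝ → ℝ) (p : ℝ × ℝ) : ℝ × ℝ :=
  ofOrbit (-P) (-Θ) ρ (toOrbit P Θ Λ ρ p)

/-- The first return map in angle-action coordinates. -/
noncomputable def returnMap (E h μ ω Λ : ℝ) (ρ : ℝ → ℝ) (p : ℝ × ℝ) : ℝ × ℝ :=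
  let q := arcMap (-innerSpeed E h μ) (-innerAngle E h μ) Λ ρ
    (arcMap (outerSpeed E ω) (outerAngle E ω) Λ ρ (p.1, √2 * p.2))
  (q.1, q.2 / √2)

namespace SectionChart

theorem toOrbit_mem (D : SectionChart Λ r₁ r₂ δ M P Θ Q) (N : NearCircle r₁ r₂ δ ρ) {p : ℝ × ℝ}
    (hJ : |p.2| + δ * M < Λ) :
    (toOrbit P Θ Λ ρ p).2 ∈ Ioo (-Λ) Λ ∧ |(toOrbit P Θ Λ ρ p).2 - p.2| ≤ δ * M := by
  have h1 := D.abs_solveMomentum_sub_le (N.mem_Icc p.1) (N.abs_deriv_lt p.1) hJ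
  refine ⟨abs_lt.1 ?_, h1⟩
  have := abs_sub_abs_le_abs_sub (toOrbit P Θ Λ ρ p).2 p.2
  have h2 : |(toOrbit P Θ Λ ρ p).2 - p.2| ≤ δ * M := h1
  linarith

/-- J and L differ by P ρ', at most `δ * M`, at each of the two ends of the arc. -/
theorem abs_arcMap_sub_le (D : SectionChart Λ r₁ r₂ δ M P Θ Q) (N : NearCircle r₁ r₂ δ ρ)
    {p : ℝ × ℝ} (hJ : |p.2| + δ * M < Λ) :
    |(arcMap P Θ Λ ρ p).2 - p.2| ≤ 2 * (δ * M) := by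
  obtain ⟨h1, h2⟩ := D.toOrbit_mem N hJ
  have h3 := D.neg.abs_P_mul_le
    (N.mem_Icc (solveAngle (-Θ) ρ (toOrbit P Θ Λ ρ p).1 (toOrbit P Θ Λ ρ p).2))
    (Ioo_subset_Icc_self h1)
    (N.abs_deriv_lt (solveAngle (-Θ) ρ (toOrbit P Θ Λ ρ p).1 (toOrbit P Θ Λ ρ p).2))
  have h4 := (abs_add_le _ _).trans (add_le_add h2 h3)
  refine le_trans (le_of_eq ?_) (h4.trans_eq (two_mul _).symm)
  congr 1
  rw [arcMap, ofOrbit]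
  ring

theorem arcMap_add_period (D : SectionChart Λ r₁ r₂ δ M P Θ Q) (N : NearCircle r₁ r₂ δ ρ)
    {p : ℝ × ℝ} (hJ : |p.2| + δ * M < Λ) :
    arcMap P Θ Λ ρ (p + (2 * Real.pi, 0)) = arcMap P Θ Λ ρ p + (2 * Real.pi, 0) := by
  have h1 := Ioo_subset_Icc_self (D.toOrbit_mem N hJ).1
  have e1 : toOrbit P Θ Λ ρ (p + (2 * Real.pi, 0)) =
      ((toOrbit P Θ Λ ρ p).1 + (1 : ℤ) * (2 * Real.pi), (toOrbit P Θ Λ ρ p).2) := by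
    simp only [toOrbit, Prod.fst_add, Prod.snd_add, add_zero, N.periodic p.1,
      N.deriv_periodic p.1]
    refine Prod.ext ?_ rfl
    push_cast
    ring
  rw [arcMap, arcMap, e1]
  simp only [ofOrbit, D.neg.solveAngle_add_period N h1, N.periodic.int_mul 1 _,
    N.deriv_periodic.int_mul 1 _]
  simp

theorem arcMap_one (D : SectionChart Λ r₁ r₂ δ M P Θ Q) (N : NearCircle r₁ r₂ δ fun _ => 1)
    {p : ℝ × ℝ} (hJ : |p.2| + δ * M < Λ) :
    arcMap P Θ Λ (fun _ => 1) p = (p.1 + 2 * Θ 1 p.2, p.2) := by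
  have h2 := (D.solveMomentum_spec (N.mem_Icc p.1) (N.abs_deriv_lt p.1) hJ).2
  have h1 := Ioo_subset_Icc_self (D.toOrbit_mem N hJ).1
  rw [deriv_const, mul_zero, add_zero] at h2
  have e1 : toOrbit P Θ Λ (fun _ => 1) p = (p.1 + Θ 1 p.2, p.2) := by
    rw [toOrbit, deriv_const, h2]
  rw [e1] at h1
  have h3 := D.neg.solveAngle_spec N h1 (p.1 + Θ 1 p.2)
  simp only [Pi.neg_apply] at h3
  rw [arcMap, e1, ofOrbit, deriv_const]
  refine Prod.ext ?_ (by simp)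
  simp only
  linarith

theorem contDiffAt_arcMap (D : SectionChart Λ r₁ r₂ δ M P Θ Q) {n : WithTop ℕ∞} (hn : n ≠ 0)
    {ρ : ℝ → ℝ → ℝ} {ε : ℝ} (S : SmoothFamilyAt n r₁ r₂ δ ρ ε) {p : ℝ × ℝ}
    (hJ : |p.2| + δ * M < Λ) :
    ContDiffAt ℝ n (fun x : (ℝ × ℝ) × ℝ => arcMap P Θ Λ (ρ x.2) x.1) (p, ε) :=
  ContDiffAt.comp (f := fun x : (ℝ × ℝ) × ℝ => (toOrbit P Θ Λ (ρ x.2) x.1, x.2)) (p, ε)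
    (D.neg.contDiffAt_ofOrbit hn S (D.toOrbit_mem S.nearCircle.self_of_nhds hJ).1)
    ((D.contDiffAt_toOrbit hn S hJ).prodMk contDiffAt_snd)

theorem exists_det_arcMap (D : SectionChart Λ r₁ r₂ δ M P Θ Q) {n : WithTop ℕ∞} (hn : n ≠ 0)
    {ρ : ℝ → ℝ → ℝ} {ε : ℝ} (S : SmoothFamilyAt n r₁ r₂ δ ρ ε) {p : ℝ × ℝ}
    (hJ : |p.2| + δ * M < Λ) :
    ∃ T : ℝ × ℝ →L[ℝ] ℝ × ℝ, HasFDerivAt (arcMap P Θ Λ (ρ ε)) T p ∧ T.det = 1 := by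
  obtain ⟨T₁, h1, d1⟩ := D.exists_det_toOrbit hn S (ξ := p.1) hJ
  obtain ⟨T₂, h2, d2⟩ := D.neg.exists_det_ofOrbit hn S (g := (toOrbit P Θ Λ (ρ ε) p).1)
    (D.toOrbit_mem S.nearCircle.self_of_nhds hJ).1
  refine ⟨T₂.comp T₁, HasFDerivAt.comp p h2 h1, ?_⟩
  exact (LinearMap.det_comp _ _).trans (by
    rw [show LinearMap.det (T₂ : ℝ × ℝ →ₗ[ℝ] ℝ × ℝ) = 1 from d2,
      show LinearMap.det (T₁ : ℝ × ℝ →ₗ[ℝ] ℝ × ℝ) = 1 from d1, one_mul])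

end SectionChart

/-- The charts for both potentials, on a common range. -/
structure ReturnSetting (E h μ ω Λ r₁ r₂ δ M : ℝ) : Prop where
  frequency_pos : 0 < ω
  mass_pos : 0 < μ
  outer_energy_pos : 0 < E
  inner_energy_pos : 0 < E + h
  potential_lt : E - ω ^ 2 / 2 < E + h + μ
  range : TransversalRange E h μ ω Λ r₁ r₂
  outer : SectionChart Λ r₁ r₂ δ M (outerSpeed E ω) (outerAngle E ω) (speedDeriv (outerSpeed E ω))
  inner : SectionChart Λ r₁ r₂ δ M (innerSpeed E h μ) (innerAngle E h μ)
    (speedDeriv (innerSpeed E h μ))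

namespace ReturnSetting

theorem abs_lt_of_abs_sub_le {x y c : ℝ} (h : |y - x| ≤ c) {Λ d : ℝ} (hx : |x| + (c + d) < Λ) :
    |y| + d < Λ := by
  have := abs_sub_abs_le_abs_sub y x
  linarith

/-- The five margins are spent as two on each arc and one on the final launch to the outside. -/
theorem outerMap_lt (R : ReturnSetting E h μ ω Λ r₁ r₂ δ M) (N : NearCircle r₁ r₂ δ ρ) {p : ℝ × ℝ}
    (hJ : |p.2| + 5 * (δ * M) < Λ) :
    |p.2| + δ * M < Λ ∧ |(arcMap (outerSpeed E ω) (outerAngle E ω) Λ ρ p).2| + 3 * (δ * M) < Λ ∧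
      |(arcMap (outerSpeed E ω) (outerAngle E ω) Λ ρ p).2| + δ * M < Λ := by
  have h0 : 0 ≤ δ * M := mul_nonneg ((abs_nonneg _).trans (N.abs_deriv_lt 0).le) R.outer.nonneg
  have h1 : |p.2| + δ * M < Λ := by linarith
  have h2 : |(arcMap (outerSpeed E ω) (outerAngle E ω) Λ ρ p).2| + 3 * (δ * M) < Λ :=
    abs_lt_of_abs_sub_le (R.outer.abs_arcMap_sub_le N h1) (by linarith)
  exact ⟨h1, h2, by linarith⟩

theorem contDiffAt_returnMap (R : ReturnSetting E h μ ω Λ r₁ r₂ δ M) {n : WithTop ℕ∞} (hn : n ≠ 0)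
    {ρ : ℝ → ℝ → ℝ} {ε : ℝ} (S : SmoothFamilyAt n r₁ r₂ δ ρ ε) {p : ℝ × ℝ}
    (hJ : |√2 * p.2| + 5 * (δ * M) < Λ) :
    ContDiffAt ℝ n (fun x : (ℝ × ℝ) × ℝ => returnMap E h μ ω Λ (ρ x.2) x.1) (p, ε) := by
  obtain ⟨h1, -, h2⟩ := R.outerMap_lt (p := (p.1, √2 * p.2)) S.nearCircle.self_of_nhds hJ
  have c1 : ContDiffAt ℝ n (fun x : (ℝ × ℝ) × ℝ =>
      arcMap (outerSpeed E ω) (outerAngle E ω) Λ (ρ x.2) (x.1.1, √2 * x.1.2)) (p, ε) :=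
    ContDiffAt.comp (f := fun x : (ℝ × ℝ) × ℝ => ((x.1.1, √2 * x.1.2), x.2)) (p, ε)
      (R.outer.contDiffAt_arcMap hn S h1) (by fun_prop)
  have c2 : ContDiffAt ℝ n (fun x : (ℝ × ℝ) × ℝ =>
      arcMap (-innerSpeed E h μ) (-innerAngle E h μ) Λ (ρ x.2)
        (arcMap (outerSpeed E ω) (outerAngle E ω) Λ (ρ x.2) (x.1.1, √2 * x.1.2))) (p, ε) :=
    ContDiffAt.comp (f := fun x : (ℝ × ℝ) × ℝ =>
      (arcMap (outerSpeed E ω) (outerAngle E ω) Λ (ρ x.2) (x.1.1, √2 * x.1.2), x.2)) (p, ε)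
      (R.inner.neg.contDiffAt_arcMap hn S h2) (c1.prodMk contDiffAt_snd)
  exact c2.fst.prodMk (c2.snd.div_const _)

theorem exists_det_returnMap (R : ReturnSetting E h μ ω Λ r₁ r₂ δ M) {n : WithTop ℕ∞} (hn : n ≠ 0)
    {ρ : ℝ → ℝ → ℝ} {ε : ℝ} (S : SmoothFamilyAt n r₁ r₂ δ ρ ε) {p : ℝ × ℝ}
    (hJ : |√2 * p.2| + 5 * (δ * M) < Λ) :
    ∃ T : ℝ × ℝ →L[ℝ] ℝ × ℝ, HasFDerivAt (returnMap E h μ ω Λ (ρ ε)) T p ∧ T.det = 1 := by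
  obtain ⟨h1, -, h2⟩ := R.outerMap_lt (p := (p.1, √2 * p.2)) S.nearCircle.self_of_nhds hJ
  obtain ⟨T₁, t1, d1⟩ := R.outer.exists_det_arcMap hn S h1
  obtain ⟨T₂, t2, d2⟩ := R.inner.neg.exists_det_arcMap hn S h2
  have hs : HasFDerivAt (fun p : ℝ × ℝ => (p.1, √2 * p.2))
      ((ContinuousLinearMap.fst ℝ ℝ ℝ).prod (√2 • ContinuousLinearMap.snd ℝ ℝ ℝ)) p :=
    hasFDerivAt_fst.prodMk (hasFDerivAt_snd.const_mul _)
  have hu : ∀ q : ℝ × ℝ, HasFDerivAt (fun p : ℝ × ℝ => (p.1, p.2 / √2))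
      ((ContinuousLinearMap.fst ℝ ℝ ℝ).prod ((√2)⁻¹ • ContinuousLinearMap.snd ℝ ℝ ℝ)) q :=
    fun q => by
      simp only [div_eq_inv_mul]
      exact hasFDerivAt_fst.prodMk (hasFDerivAt_snd.const_mul _)
  have h3 := (t2.comp (f := arcMap (outerSpeed E ω) (outerAngle E ω) Λ (ρ ε)) _ t1).comp
    (f := fun p : ℝ × ℝ => (p.1, √2 * p.2)) p hs
  refine ⟨_, (hu _).comp p h3, ?_⟩
  -- Passing from I to J = √2 I and back contributes reciprocal factors, so only the two arc maps
  -- matter.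
  have hd : (T₂.comp T₁).det = 1 := (LinearMap.det_comp _ _).trans (by
    rw [show LinearMap.det (T₂ : ℝ × ℝ →ₗ[ℝ] ℝ × ℝ) = 1 from d2,
      show LinearMap.det (T₁ : ℝ × ℝ →ₗ[ℝ] ℝ × ℝ) = 1 from d1, one_mul])
  generalize T₂.comp T₁ = T at hd
  have e : T (0, √2) = √2 • T (0, 1) := by rw [← map_smul]; simp
  rw [det_prod_real] at hd ⊢
  have h2 : √2 ≠ 0 := by positivity
  simp [e]
  field_simp
  linarith

theorem returnMap_add_period (R : ReturnSetting E h μ ω Λ r₁ r₂ δ M) (N : NearCircle r₁ r₂ δ ρ)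
    {p : ℝ × ℝ} (hJ : |√2 * p.2| + 5 * (δ * M) < Λ) :
    returnMap E h μ ω Λ ρ (p + (2 * Real.pi, 0)) =
      returnMap E h μ ω Λ ρ p + (2 * Real.pi, 0) := by
  obtain ⟨h1, -, h2⟩ := R.outerMap_lt (p := (p.1, √2 * p.2)) N hJ
  have e : ((p + (2 * Real.pi, 0)).1, √2 * (p + (2 * Real.pi, 0)).2) =
      ((p.1, √2 * p.2) + (2 * Real.pi, 0) : ℝ × ℝ) := by simp
  rw [returnMap, returnMap, e, R.outer.arcMap_add_period N h1, R.inner.neg.arcMap_add_period N h2]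
  simp

theorem returnMap_one (R : ReturnSetting E h μ ω Λ r₁ r₂ δ M)
    (N : NearCircle r₁ r₂ δ fun _ => 1) {p : ℝ × ℝ} (hJ : |√2 * p.2| + 5 * (δ * M) < Λ)
    (hp : p.2 ∈ actionInterval E ω) :
    returnMap E h μ ω Λ (fun _ => 1) p = (p.1 + totalShift E h μ ω p.2, p.2) := by
  obtain ⟨h1, -, h2⟩ := R.outerMap_lt (p := (p.1, √2 * p.2)) N hJ
  rw [totalShift_eq R.outer_energy_pos R.mass_pos R.potential_lt hp, returnMap,
    R.inner.neg.arcMap_one N h2, R.outer.arcMap_one N h1]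
  refine Prod.ext ?_ ?_
  · simp only [Pi.neg_apply]
    ring
  · simp

end ReturnSetting

end RefractionBilliard

/-! ### The return map is the first return map of the billiard. -/

namespace RefractionBilliard

open Set Filter Topology

variable {E h μ ω Λ r₁ r₂ δ M : ℝ} {P Θ Q : ℝ → ℝ → ℝ} {ρ : ℝ → ℝ}

theorem SectionChart.arcMap_spec (D : SectionChart Λ r₁ r₂ δ M P Θ Q) (N : NearCircle r₁ r₂ δ ρ)
    {p q : ℝ × ℝ} (hJ : |p.2| + δ * M < Λ) (hq : arcMap P Θ Λ ρ p = q) :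
    ∃ L ∈ Icc (-Λ) Λ, L = solveMomentum P Λ (ρ p.1) (deriv ρ p.1) p.2 ∧
      L + P (ρ p.1) L * deriv ρ p.1 = p.2 ∧
      q.1 + (-Θ) (ρ q.1) L = p.1 + Θ (ρ p.1) L ∧
      L + -P (ρ q.1) L * deriv ρ q.1 = q.2 := by
  have h1 := D.solveMomentum_spec (N.mem_Icc p.1) (N.abs_deriv_lt p.1) hJ
  refine ⟨_, h1.1, rfl, h1.2, ?_, ?_⟩
  · rw [← hq]
    exact D.neg.solveAngle_spec N h1.1 _
  · rw [← hq]
    rfl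

namespace ReturnSetting

theorem outerSpeed_pos (R : ReturnSetting E h μ ω Λ r₁ r₂ δ M) :
    ∀ r ∈ Icc r₁ r₂, ∀ L ∈ Icc (-Λ) Λ, 0 < outerSpeed E ω r L :=
  fun _ hr _ hL => Real.sqrt_pos.2 (R.range.outer_pos hr hL)

theorem innerSpeed_pos (R : ReturnSetting E h μ ω Λ r₁ r₂ δ M) :
    ∀ r ∈ Icc r₁ r₂, ∀ L ∈ Icc (-Λ) Λ, 0 < innerSpeed E h μ r L :=
  fun _ hr _ hL => Real.sqrt_pos.2 (R.range.inner_pos hr hL)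

theorem isLaunchVelocity (R : ReturnSetting E h μ ω Λ r₁ r₂ δ M) (N : NearCircle r₁ r₂ δ ρ)
    {p : ℝ × ℝ} {L : ℝ} (hL : L ∈ Icc (-Λ) Λ)
    (hp : L + outerSpeed E ω (ρ p.1) L * deriv ρ p.1 = √2 * p.2) :
    IsLaunchVelocity E ω ρ p (orbitVelocity ρ p.1 (outerSpeed E ω (ρ p.1) L) L) := by
  refine ⟨?_, R.outer.inner_normalVec_pos N hL (R.outerSpeed_pos _ (N.mem_Icc _) _ hL), ?_⟩
  · rw [norm_sq_orbitVelocity, outerSpeed,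
      Real.sq_sqrt (R.range.outer_pos (N.mem_Icc _) hL).le, outerPotential, N.norm_boundaryCurve]
    ring
  · rw [N.inner_orbitVelocity_tangentVec, hp]
    field_simp

theorem eq_of_isLaunchVelocity (R : ReturnSetting E h μ ω Λ r₁ r₂ δ M) (N : NearCircle r₁ r₂ δ ρ)
    {p : ℝ × ℝ} (hJ : |√2 * p.2| + δ * M < Λ) {v : ℂ} (hv : IsLaunchVelocity E ω ρ p v) :
    v = orbitVelocity ρ p.1
      (outerSpeed E ω (ρ p.1) (solveMomentum (outerSpeed E ω) Λ (ρ p.1) (deriv ρ p.1) (√2 * p.2)))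
      (solveMomentum (outerSpeed E ω) Λ (ρ p.1) (deriv ρ p.1) (√2 * p.2)) := by
  obtain ⟨h1, h2, h3⟩ := hv
  rw [outerPotential, N.norm_boundaryCurve] at h1
  refine (R.outer.eq_orbitVelocity (W := fun r => 2 * E - ω ^ 2 * r ^ 2) N (fun _ _ => rfl)
    R.outerSpeed_pos (by linarith) ?_ hJ).1 h2
  rw [h3]
  field_simp

theorem eq_of_inward (R : ReturnSetting E h μ ω Λ r₁ r₂ δ M) (N : NearCircle r₁ r₂ δ ρ)
    {η J : ℝ} (hJ : |J| + δ * M < Λ) {v : ℂ}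
    (hv : ‖v‖ ^ 2 / 2 - innerPotential E h μ (boundaryCurve ρ η) = 0)
    (hn : Inner.inner ℝ v (normalVec ρ η) < 0) (ht : Inner.inner ℝ v (tangentVec ρ η) = J) :
    v = orbitVelocity ρ η
      (-innerSpeed E h μ (ρ η) (solveMomentum (-innerSpeed E h μ) Λ (ρ η) (deriv ρ η) J))
      (solveMomentum (-innerSpeed E h μ) Λ (ρ η) (deriv ρ η) J) := by
  rw [innerPotential, N.norm_boundaryCurve] at hv
  refine (R.inner.eq_orbitVelocity (W := fun r => 2 * (E + h) + 2 * μ / r) N (fun _ _ => rfl)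
    R.innerSpeed_pos ?_ ht hJ).2 hn
  rw [mul_div_assoc]
  linarith

theorem returnMap_spec (R : ReturnSetting E h μ ω Λ r₁ r₂ δ M) (N : NearCircle r₁ r₂ δ ρ)
    {p q : ℝ × ℝ} (hJ : |√2 * p.2| + 5 * (δ * M) < Λ) (hq : returnMap E h μ ω Λ ρ p = q) :
    ∃ L ∈ Icc (-Λ) Λ, ∃ L' ∈ Icc (-Λ) Λ, ∃ η J g : ℝ,
      L = solveMomentum (outerSpeed E ω) Λ (ρ p.1) (deriv ρ p.1) (√2 * p.2) ∧
      L + outerSpeed E ω (ρ p.1) L * deriv ρ p.1 = √2 * p.2 ∧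
      η + (-outerAngle E ω) (ρ η) L = p.1 + outerAngle E ω (ρ p.1) L ∧
      L + -outerSpeed E ω (ρ η) L * deriv ρ η = J ∧
      |J| + δ * M < Λ ∧
      L' = solveMomentum (-innerSpeed E h μ) Λ (ρ η) (deriv ρ η) J ∧
      L' + -innerSpeed E h μ (ρ η) L' * deriv ρ η = J ∧
      η + (-innerAngle E h μ) (ρ η) L' = g ∧
      q.1 + innerAngle E h μ (ρ q.1) L' = g ∧
      L' + innerSpeed E h μ (ρ q.1) L' * deriv ρ q.1 = √2 * q.2 ∧
      |√2 * q.2| + δ * M < Λ := by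
  obtain ⟨h1, h2, h3⟩ := R.outerMap_lt (p := (p.1, √2 * p.2)) N hJ
  obtain ⟨L, hL, e1, e2, e3, e4⟩ := R.outer.arcMap_spec N h1 rfl
  obtain ⟨L', hL', f1, f2, f3, f4⟩ := R.inner.neg.arcMap_spec N h3 rfl
  have h4 := abs_lt_of_abs_sub_le (R.inner.neg.abs_arcMap_sub_le N h3) (Λ := Λ) (d := δ * M)
    (by linarith)
  have h5 : √2 * q.2 = (arcMap (-innerSpeed E h μ) (-innerAngle E h μ) Λ ρ
      (arcMap (outerSpeed E ω) (outerAngle E ω) Λ ρ (p.1, √2 * p.2))).2 := by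
    rw [← hq, returnMap]
    field_simp
  have h6 : q.1 = (arcMap (-innerSpeed E h μ) (-innerAngle E h μ) Λ ρ
      (arcMap (outerSpeed E ω) (outerAngle E ω) Λ ρ (p.1, √2 * p.2))).1 := by
    rw [← hq, returnMap]
  rw [← h6] at f3 f4
  rw [← h5] at f4 h4
  simp only [Pi.neg_apply, neg_neg] at f3 f4
  exact ⟨L, hL, L', hL', _, _, _, e1, e2, e3, e4, h3, f1, f2, rfl, f3, f4, h4⟩

theorem firstReturn_returnMap (R : ReturnSetting E h μ ω Λ r₁ r₂ δ M) (N : NearCircle r₁ r₂ δ ρ)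
    {p : ℝ × ℝ} (hJ : |√2 * p.2| + 5 * (δ * M) < Λ) :
    FirstReturn E h μ ω ρ p (returnMap E h μ ω Λ ρ p) := by
  obtain ⟨L, hL, L', hL', η, J, g, -, e2, e3, e4, -, -, f2, f3, f4, f5, f6⟩ :=
    R.returnMap_spec N hJ rfl
  obtain ⟨TE, zE, vE, hE, zE0, vE0, zET, vET⟩ := exists_isOuterArc R.frequency_pos
    R.outer_energy_pos R.outer N (fun r hr L hL => R.range.outer_pos hr hL) hL rfl e3
  obtain ⟨TI, zI, vI, hI, zI0, vI0, zIT, vIT⟩ := exists_isInnerArc R.inner_energy_pos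
    R.mass_pos R.inner N (fun r hr L hL => R.range.inner_pos hr hL) hL' f3 f4
  set q := returnMap E h μ ω Λ ρ p
  -- The last margin makes the final refraction possible: an outward velocity with this tangential
  -- momentum exists.
  have g1 := R.outer.solveMomentum_spec (N.mem_Icc q.1) (N.abs_deriv_lt q.1) f6
  refine ⟨zE, vE, zI, vI, TE, TI, η, _, hE, zE0, ?_, zET, hI, zI0, ?_, ?_, zIT,
    R.isLaunchVelocity N g1.1 g1.2, ?_⟩
  · rw [vE0]
    exact R.isLaunchVelocity N hL e2
  · rw [vI0]
    exact R.inner.inner_normalVec_neg N hL' (R.innerSpeed_pos _ (N.mem_Icc η) _ hL')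
  · rw [vI0, vET, N.inner_orbitVelocity_tangentVec, N.inner_orbitVelocity_tangentVec, e4, f2]
  · rw [vIT, N.inner_orbitVelocity_tangentVec, N.inner_orbitVelocity_tangentVec, f5, g1.2]

/-- Launch velocity, end of the outer arc, refracted velocity and end of the inner arc are forced in
turn; integers enter because a point fixes its angle only modulo 2π. -/
theorem firstReturn_unique (R : ReturnSetting E h μ ω Λ r₁ r₂ δ M) (N : NearCircle r₁ r₂ δ ρ)
    {p q : ℝ × ℝ} (hJ : |√2 * p.2| + 5 * (δ * M) < Λ) (H : FirstReturn E h μ ω ρ p q) :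
    q.2 = (returnMap E h μ ω Λ ρ p).2 ∧
      ∃ n : ℤ, q.1 = (returnMap E h μ ω Λ ρ p).1 + n * (2 * Real.pi) := by
  have hJ1 := (R.outerMap_lt (p := (p.1, √2 * p.2)) N hJ).1
  obtain ⟨L, hL, L', hL', η, J, g, e1, e2, e3, e4, e5, e6, f2, f3, f4, f5, f6⟩ :=
    R.returnMap_spec N hJ rfl
  obtain ⟨TE, zE, vE, hE, zE0, vE0, zET, vET⟩ := exists_isOuterArc R.frequency_pos
    R.outer_energy_pos R.outer N (fun r hr L hL => R.range.outer_pos hr hL) hL rfl e3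
  obtain ⟨zE', vE', z, v, TE', T, η', v₁, hE', zE0', hl, zET', hI, z0, hn, ht, zT, hl₁, ht₁⟩ := H
  have vE0' := R.eq_of_isLaunchVelocity N hJ1 hl
  rw [← e1, ← vE0] at vE0'
  obtain ⟨hz, hv⟩ := hE'.end_unique R.frequency_pos hE (zE0'.trans zE0.symm) vE0'
    (by rw [zET', N.radius_arg_boundaryCurve]) (by rw [zET, N.radius_arg_boundaryCurve])
  obtain ⟨n, rfl⟩ := N.exists_period_of_boundaryCurve_eq (zET'.symm.trans (hz.trans zET))
  rw [N.boundaryCurve_add_period] at z0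
  rw [N.normalVec_add_period] at hn
  rw [N.tangentVec_add_period, hv, vET, N.inner_orbitVelocity_tangentVec, e4] at ht
  have hen : ‖v 0‖ ^ 2 / 2 - innerPotential E h μ (boundaryCurve ρ η) = 0 := by
    rw [← z0]
    obtain ⟨hT, hI | hI, -⟩ := hI
    · exact (hI.1 0 (left_mem_Icc.2 hT.le)).2.2
    · refine (hI.2.2.2.1 0 ⟨left_mem_Icc.2 hT.le, fun h0 => ?_⟩).2.2
      rw [mem_singleton_iff] at h0
      linarith
  have v0 := R.eq_of_inward N e5 hen hn ht
  rw [← e6] at v0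
  obtain ⟨⟨m, hm⟩, hvT⟩ := hI.end_unique R.inner_energy_pos R.mass_pos R.inner N
    (fun r hr L hL => R.range.inner_pos hr hL) hL' f3 f4 z0 v0 zT
  refine ⟨?_, m, hm⟩
  rw [hl₁.2.2, ht₁, hvT, N.inner_orbitVelocity_tangentVec, hm, N.periodic.int_mul m,
    N.deriv_periodic.int_mul m, f5]
  field_simp

end ReturnSetting

end RefractionBilliard

/-! ### Small perturbations of the circle and persistence of the twist. -/

namespace RefractionBilliard

open Set Filter Topology

variable {E h μ ω Λ r₁ r₂ δ M : ℝ} {ρ : ℝ → ℝ}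

/-- A small perturbation `1 + ε f(ξ, ε)` of the unit circle with `f` of class `C^{m+1}` is a smooth
family of nearly circular curves. -/
theorem exists_smoothFamilyAt {m : ℕ} {C : ℝ} (hC : 0 < C) {f : ℝ → ℝ → ℝ}
    (hf : ContDiffOn ℝ (m + 1 : ℕ) (Function.uncurry f) (univ ×ˢ Icc (-C) C))
    (hper : ∀ ε ∈ Icc (-C) C, Function.Periodic (fun ξ => f ξ ε) (2 * Real.pi))
    (hr₁ : 0 < r₁) (h₁ : r₁ < 1) (h₂ : 1 < r₂) (hδ : 0 < δ) :
    ∃ ε₁ > 0, ∀ ε, |ε| < ε₁ → SmoothFamilyAt m r₁ r₂ δ (fun e ξ => 1 + e * f ξ e) ε := by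
  have hcd : ∀ x : ℝ × ℝ, |x.2| < C → ContDiffAt ℝ (m + 1 : ℕ) (Function.uncurry f) x := by
    intro x hx
    refine hf.contDiffAt (prod_mem_nhds univ_mem (Icc_mem_nhds ?_ ?_))
    · exact (abs_lt.1 hx).1
    · exact (abs_lt.1 hx).2
  set G : ℝ × ℝ → ℝ := fun x => fderiv ℝ (Function.uncurry f) x (1, 0) with hG
  have hcG : ∀ x : ℝ × ℝ, |x.2| < C → ContDiffAt ℝ m G x := fun x hx =>
    ((hcd x hx).fderiv_right (m := m) (by norm_cast)).clm_apply contDiffAt_const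
  have hderiv : ∀ ξ ε : ℝ, |ε| < C → HasDerivAt (fun ξ => f ξ ε) (G (ξ, ε)) ξ := by
    intro ξ ε hε
    exact HasFDerivAt.comp_hasDerivAt (l := Function.uncurry f) (f := fun t : ℝ => (t, ε)) ξ
      (((hcd (ξ, ε) hε).differentiableAt (by norm_cast)).hasFDerivAt)
      ((hasDerivAt_id ξ).prodMk (hasDerivAt_const ξ ε))
  have hsub : ∀ x ∈ Icc 0 (2 * Real.pi) ×ˢ Icc (-(C / 2)) (C / 2), |(x : ℝ × ℝ).2| < C :=
    fun x hx => (abs_le.2 hx.2).trans_lt (by linarith)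
  -- Half of the parameter interval stays where `f` is smooth on a full neighbourhood, and one
  -- period suffices for bounds on all angles.
  have hK : IsCompact (Icc 0 (2 * Real.pi) ×ˢ Icc (-(C / 2)) (C / 2)) :=
    isCompact_Icc.prod isCompact_Icc
  obtain ⟨B₁, hB₁⟩ := hK.exists_bound_of_continuousOn (f := Function.uncurry f)
    fun x hx => (hcd x (hsub x hx)).continuousAt.continuousWithinAt
  obtain ⟨B₂, hB₂⟩ := hK.exists_bound_of_continuousOn (f := G)
    fun x hx => (hcG x (hsub x hx)).continuousAt.continuousWithinAt
  have hb₁ : ∀ ξ ε : ℝ, |ε| ≤ C / 2 → |f ξ ε| ≤ B₁ := by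
    intro ξ ε hε
    obtain ⟨η, hη, e⟩ := (hper ε (abs_le.1 (hε.trans (by linarith)))).exists_mem_Ico₀
      Real.two_pi_pos ξ
    rw [e]
    exact hB₁ (η, ε) ⟨Ico_subset_Icc_self hη, abs_le.1 hε⟩
  have hb₂ : ∀ ξ ε : ℝ, |ε| ≤ C / 2 → |G (ξ, ε)| ≤ B₂ := by
    intro ξ ε hε
    have hεC : |ε| < C := hε.trans_lt (by linarith)
    have hp : Function.Periodic (fun ξ => G (ξ, ε)) (2 * Real.pi) := by
      intro ξ
      have h1 := (hderiv (ξ + 2 * Real.pi) ε hεC).comp_add_const ξ (2 * Real.pi)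
      rw [funext (hper ε (abs_le.1 hεC.le))] at h1
      exact h1.unique (hderiv ξ ε hεC)
    obtain ⟨η, hη, e⟩ := hp.exists_mem_Ico₀ Real.two_pi_pos ξ
    rw [e]
    exact hB₂ (η, ε) ⟨Ico_subset_Icc_self hη, abs_le.1 hε⟩
  set B := max B₁ B₂ with hB
  -- Keeping both ε f and ε ∂f/∂ξ below `d` gives r₁ < ρ < r₂ and |ρ'| < δ at once.
  set d := min δ (min (1 - r₁) (r₂ - 1)) with hd
  have hB0 : 0 ≤ B := ((abs_nonneg _).trans (hb₁ 0 0 (by simp; linarith))).trans (le_max_left _ _)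
  have hd0 : 0 < d := lt_min hδ (lt_min (by linarith) (by linarith))
  have hsmall : ∀ ε b : ℝ, |ε| < d / (B + 1) → |b| ≤ B → |ε * b| < d := by
    intro ε b hε hb
    rw [abs_mul]
    rw [lt_div_iff₀ (by linarith)] at hε
    nlinarith [abs_nonneg ε, abs_nonneg b]
  have hnear : ∀ e : ℝ, |e| < min (C / 2) (d / (B + 1)) →
      NearCircle r₁ r₂ δ (fun ξ => 1 + e * f ξ e) := by
    intro e he
    have he1 : |e| < C / 2 := he.trans_le (min_le_left _ _)
    have he2 : |e| < d / (B + 1) := he.trans_le (min_le_right _ _)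
    have hD : ∀ ξ, HasDerivAt (fun ξ => 1 + e * f ξ e) (e * G (ξ, e)) ξ := fun ξ =>
      ((hderiv ξ e (by linarith)).const_mul e).const_add 1
    refine ⟨hr₁, fun ξ => ?_, fun ξ => (hD ξ).differentiableAt, fun ξ => ?_, fun ξ => ?_⟩
    · have h1 := abs_lt.1 (hsmall e _ he2 ((hb₁ ξ e he1.le).trans (le_max_left _ _)))
      have h3 : d ≤ 1 - r₁ := (min_le_right _ _).trans (min_le_left _ _)
      have h4 : d ≤ r₂ - 1 := (min_le_right _ _).trans (min_le_right _ _)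
      exact ⟨by linarith, by linarith⟩
    · rw [(hD ξ).deriv]
      exact (hsmall e _ he2 ((hb₂ ξ e he1.le).trans (le_max_right _ _))).trans_le (min_le_left _ _)
    · have := hper e (abs_le.1 (by linarith)) ξ
      simp only at this ⊢
      rw [this]
  refine ⟨min (C / 2) (d / (B + 1)), lt_min (by linarith) (by positivity), fun ε hε => ?_⟩
  have hεC : |ε| < C := by linarith [hε.trans_le (min_le_left _ _)]
  refine ⟨?_, fun ξ => ?_, fun ξ => ?_⟩
  · filter_upwards [continuous_abs.continuousAt.eventually_lt continuousAt_const hε] with e he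
    exact hnear e he
  · have h1 : ContDiffAt ℝ m (Function.uncurry f) (ξ, ε) :=
      (hcd (ξ, ε) hεC).of_le (by norm_cast; omega)
    exact contDiffAt_const.add (contDiffAt_snd.mul h1)
  · refine (contDiffAt_snd.mul (hcG (ξ, ε) hεC)).congr_of_eventuallyEq ?_
    have : ∀ᶠ x : ℝ × ℝ in 𝓝 (ξ, ε), |x.2| < C :=
      ContinuousAt.eventually_lt (by fun_prop) continuousAt_const hεC
    filter_upwards [this] with x hx
    exact (((hderiv x.1 x.2 hx).const_mul x.2).const_add 1).deriv

namespace ReturnSetting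

/-- The twist of the first return map is uniformly preserved under small perturbations. -/
theorem eventually_twist (R : ReturnSetting E h μ ω Λ r₁ r₂ δ M) {n : WithTop ℕ∞} (hn : n ≠ 0)
    {ρ : ℝ → ℝ → ℝ} {ε₁ : ℝ} (hε₁ : 0 < ε₁)
    (S : ∀ ε, |ε| < ε₁ → SmoothFamilyAt n r₁ r₂ δ ρ ε) (hρ : ρ 0 = fun _ => 1) {a b : ℝ}
    (hJ : ∀ I ∈ Icc a b, |√2 * I| + 5 * (δ * M) < Λ)
    (hI : Icc a b ⊆ actionInterval E ω \ criticalActions E h μ ω) :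
    ∀ᶠ ε in 𝓝 (0 : ℝ), ∀ p ∈ (univ : Set ℝ) ×ˢ Icc a b,
      (fderiv ℝ (returnMap E h μ ω Λ (ρ ε)) p (0, 1)).1 ≠ 0 := by
  set Φ : (ℝ × ℝ) × ℝ → ℝ × ℝ := fun x => returnMap E h μ ω Λ (ρ x.2) x.1 with hΦ
  have hcd : ∀ ε, |ε| < ε₁ → ∀ p : ℝ × ℝ, p.2 ∈ Icc a b → ContDiffAt ℝ n Φ (p, ε) :=
    fun ε hε p hp => R.contDiffAt_returnMap hn (S ε hε) (hJ _ hp)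
  have hpart : ∀ ε, |ε| < ε₁ → ∀ p : ℝ × ℝ, p.2 ∈ Icc a b →
      HasFDerivAt (returnMap E h μ ω Λ (ρ ε))
        ((fderiv ℝ Φ (p, ε)).comp (ContinuousLinearMap.inl ℝ (ℝ × ℝ) ℝ)) p := fun ε hε p hp =>
    HasFDerivAt.comp (f := fun p : ℝ × ℝ => (p, ε)) p
      ((hcd ε hε p hp).differentiableAt hn).hasFDerivAt (hasFDerivAt_prodMk_left p ε)
  have hε0 : |(0 : ℝ)| < ε₁ := by simpa using hε₁
  -- For the circle this entry is the derivative of the total shift.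
  have hzero : ∀ p : ℝ × ℝ, p.2 ∈ Icc a b → (fderiv ℝ Φ (p, 0) ((0, 1), 0)).1 ≠ 0 := by
    intro p hp
    have h1 : HasDerivAt (fun t => (returnMap E h μ ω Λ (ρ 0) (p.1, t)).1)
        (fderiv ℝ Φ (p, 0) ((0, 1), 0)).1 p.2 :=
      (hpart 0 hε0 p hp).fst.comp_hasDerivAt (f := fun t => (p.1, t)) p.2
        ((hasDerivAt_const p.2 p.1).prodMk (hasDerivAt_id p.2))
    have h2 : ∀ᶠ t in 𝓝 p.2, t ∈ actionInterval E ω := isOpen_Ioo.mem_nhds (hI hp).1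
    have h3 : ∀ᶠ t in 𝓝 p.2, |√2 * t| + 5 * (δ * M) < Λ :=
      ContinuousAt.eventually_lt (by fun_prop) continuousAt_const (hJ _ hp)
    have N := (S 0 hε0).nearCircle.self_of_nhds
    rw [hρ] at N h1
    have h4 : (fun t => (returnMap E h μ ω Λ (fun _ => 1) (p.1, t)).1) =ᶠ[𝓝 p.2]
        fun t => p.1 + totalShift E h μ ω t := by
      filter_upwards [h2, h3] with t ht ht'
      rw [R.returnMap_one N (p := (p.1, t)) ht' ht]
    rw [← h1.deriv, h4.deriv_eq, deriv_const_add]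
    exact fun h0 => (hI hp).2 ⟨(hI hp).1, h0⟩
  have hK : IsCompact (Icc 0 (2 * Real.pi) ×ˢ Icc a b) := isCompact_Icc.prod isCompact_Icc
  have h5 : ∀ᶠ ε in 𝓝 (0 : ℝ), ∀ p ∈ Icc 0 (2 * Real.pi) ×ˢ Icc a b,
      (fderiv ℝ Φ (p, ε) ((0, 1), 0)).1 ≠ 0 := by
    refine hK.eventually_forall_of_forall_eventually fun p hp => ?_
    have h6 : ContinuousAt (fun x => (fderiv ℝ Φ x ((0, 1), 0)).1) (p, 0) :=
      ((((hcd 0 hε0 p hp.2).fderiv_right (m := 0) (by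
        simpa using ENat.one_le_iff_ne_zero_withTop.2 hn)).continuousAt).clm_apply
          continuousAt_const).fst
    exact (continuous_swap.continuousAt (x := ((0 : ℝ), p))).eventually
      (h6.eventually_ne (hzero p hp.2))
  filter_upwards [h5, continuous_abs.continuousAt.eventually_lt continuousAt_const hε0]
    with ε h7 hε p hp
  have N := (S ε hε).nearCircle.self_of_nhds
  -- The compactness argument covered one period of ξ; periodicity of the derivative extends it to
  -- the strip.
  have hper : Function.Periodic
      (fun ξ => fderiv ℝ (returnMap E h μ ω Λ (ρ ε)) (ξ, p.2)) (2 * Real.pi) := by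
    intro ξ
    have e1 : ((ξ + 2 * Real.pi, p.2) : ℝ × ℝ) = (ξ, p.2) + (2 * Real.pi, 0) := by simp
    have h3 : ∀ᶠ q : ℝ × ℝ in 𝓝 (ξ, p.2), |√2 * q.2| + 5 * (δ * M) < Λ :=
      ContinuousAt.eventually_lt (by fun_prop) continuousAt_const (hJ _ hp.2)
    have h4 : (fun q => returnMap E h μ ω Λ (ρ ε) (q + (2 * Real.pi, 0))) =ᶠ[𝓝 (ξ, p.2)]
        fun q => returnMap E h μ ω Λ (ρ ε) q + (2 * Real.pi, 0) := by
      filter_upwards [h3] with q hq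
      exact R.returnMap_add_period N hq
    simp only
    rw [e1, ← fderiv_comp_add_right, h4.fderiv_eq, fderiv_add_const]
  obtain ⟨η, hη, e⟩ := hper.exists_mem_Ico₀ Real.two_pi_pos p.1
  rw [show p = (p.1, p.2) from rfl, e, (hpart ε hε (η, p.2) hp.2).fderiv]
  exact h7 (η, p.2) ⟨Ico_subset_Icc_self hη, hp.2⟩

end ReturnSetting

/-- Actions in a compact subinterval leave room for the charts. -/
theorem exists_returnSetting (hμ : 0 < μ) (hω : 0 < ω) (hEh : 0 < E + h) (hE : ω ^ 2 < E)
    (hV : E - ω ^ 2 / 2 < E + h + μ) {a b : ℝ} (ha : a ∈ actionInterval E ω)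
    (hb : b ∈ actionInterval E ω) :
    ∃ Λ r₁ r₂ δ M, ReturnSetting E h μ ω Λ r₁ r₂ δ M ∧ 0 < δ ∧ r₁ < 1 ∧ 1 < r₂ ∧
      ∀ I ∈ Icc a b, |√2 * I| + 5 * (δ * M) < Λ := by
  set c := max |a| |b| with hc
  have hc1 : c < √(E - ω ^ 2 / 2) := max_lt (abs_lt.2 ha) (abs_lt.2 hb)
  have hc0 : 0 ≤ c := (abs_nonneg a).trans (le_max_left _ _)
  have hE0 : 0 < E := (sq_nonneg ω).trans_lt hE
  -- Λ will be √2 d, strictly between the momenta √2 |I| of the strip and the critical value √2 I_c.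
  obtain ⟨d, hcd, hd⟩ := exists_between hc1
  have h2 : 0 < √2 := by positivity
  have hd2 : d ^ 2 < E - ω ^ 2 / 2 := (Real.lt_sqrt (hc0.trans hcd.le)).1 hd
  have hΛ : (√2 * d) ^ 2 < 2 * E - ω ^ 2 := by
    rw [mul_pow, Real.sq_sqrt (by norm_num)]
    linarith
  have hlt : √2 * c < √2 * d := mul_lt_mul_of_pos_left hcd h2
  obtain ⟨r₁, r₂, hr₁, hr₂, T⟩ := exists_transversalRange hΛ hV
  obtain ⟨M, hM⟩ := T.exists_sectionChart hE0 hμ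
  have hM0 : 0 ≤ M := (hM 0 (by simp)).1
  -- `s` will bound `δ * M`: 1/2 keeps it below 1, and a sixth of the gap leaves room for five
  -- margins.
  set s := min (1 / 2) ((√2 * d - √2 * c) / 6) with hs
  have hs0 : 0 < s := lt_min (by norm_num) (by linarith)
  have hs1 : s ≤ 1 / 2 := min_le_left _ _
  have hs2 : s ≤ (√2 * d - √2 * c) / 6 := min_le_right _ _
  have hδM : s / (M + 1) * M ≤ s := by
    rw [div_mul_eq_mul_div, div_le_iff₀ (by linarith)]
    nlinarith
  obtain ⟨-, D₁, D₂⟩ := hM (s / (M + 1)) (by linarith)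
  refine ⟨_, r₁, r₂, _, M, ⟨hω, hμ, hE0, hEh, hV, T, D₁, D₂⟩, by positivity, hr₁, hr₂, ?_⟩
  intro I hI
  have h3 : |√2 * I| ≤ √2 * c := by
    rw [abs_mul, abs_of_pos h2]
    exact mul_le_mul_of_nonneg_left (abs_le_max_abs_abs hI.1 hI.2) h2.le
  linarith

end RefractionBilliard

/-! ### Proof of the proposition. -/

theorem mainTheorem8 (E h μ ω : ℝ) (hμ : 0 < μ) (hω : 0 < ω) (hEh : 0 < E + h)
    (hE : ω ^ 2 < E) (hV : E - ω ^ 2 / 2 < E + h + μ)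
    (k : ℕ) (hk : 2 ≤ k) (C : ℝ) (hC : 0 < C) (f : ℝ → ℝ → ℝ)
    (hf : ContDiffOn ℝ k (Function.uncurry f) (Set.univ ×ˢ Set.Icc (-C) C))
    (hper : ∀ ε ∈ Set.Icc (-C) C, Function.Periodic (fun ξ => f ξ ε) (2 * Real.pi))
    (a b : ℝ) (hab : a < b)
    (hI : Set.Icc a b ⊆
      RefractionBilliard.actionInterval E ω \ RefractionBilliard.criticalActions E h μ ω) :
    ∃ ε₀ : ℝ, 0 < ε₀ ∧ ∀ ε : ℝ, |ε| < ε₀ →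
      ∃ F : ℝ × ℝ → ℝ × ℝ,
        (∀ ξ : ℝ, ∀ I ∈ Set.Icc a b,
          RefractionBilliard.FirstReturn E h μ ω (fun θ => 1 + ε * f θ ε) (ξ, I) (F (ξ, I)) ∧
          (∀ q : ℝ × ℝ,
            RefractionBilliard.FirstReturn E h μ ω (fun θ => 1 + ε * f θ ε) (ξ, I) q →
              q.2 = (F (ξ, I)).2 ∧ ∃ n : ℤ, q.1 = (F (ξ, I)).1 + 2 * Real.pi * n) ∧
          F (ξ + 2 * Real.pi, I) = F (ξ, I) + (2 * Real.pi, 0)) ∧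
        ContDiffOn ℝ ((k - 2 : ℕ) : WithTop ℕ∞) F (Set.univ ×ˢ Set.Icc a b) ∧
        ∀ p ∈ (Set.univ : Set ℝ) ×ˢ Set.Icc a b,
          ∃ F' : ℝ × ℝ →L[ℝ] ℝ × ℝ,
            HasFDerivWithinAt F F' (Set.univ ×ˢ Set.Icc a b) p ∧
            F'.det = 1 ∧
            (F' (0, 1)).1 ≠ 0 := by
  -- The tangent of the curve costs one derivative, so the map is of class C^m with m ≥ 1. This
  -- gives differentiability even for k = 2, where C^(k-2) is mere continuity.
  obtain ⟨m, rfl⟩ : ∃ m, k = m + 1 := ⟨k - 1, by omega⟩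
  have hm : (m : WithTop ℕ∞) ≠ 0 := by
    norm_cast
    omega
  obtain ⟨Λ, r₁, r₂, δ, M, R, hδ, hr₁, hr₂, hJ⟩ := RefractionBilliard.exists_returnSetting hμ hω
    hEh hE hV (hI (Set.left_mem_Icc.2 hab.le)).1 (hI (Set.right_mem_Icc.2 hab.le)).1
  obtain ⟨ε₁, hε₁, S⟩ := RefractionBilliard.exists_smoothFamilyAt hC hf hper R.range.pos hr₁ hr₂ hδ
  obtain ⟨ε₂, hε₂, htwist⟩ := Metric.eventually_nhds_iff.1
    (R.eventually_twist hm hε₁ S (by simp) hJ hI)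
  refine ⟨min ε₁ ε₂, lt_min hε₁ hε₂, fun ε hε => ?_⟩
  have Sε := S ε (hε.trans_le (min_le_left _ _))
  have N := Sε.nearCircle.self_of_nhds
  have htw := htwist (show dist ε 0 < ε₂ by simpa using hε.trans_le (min_le_right _ _))
  refine ⟨RefractionBilliard.returnMap E h μ ω Λ fun θ => 1 + ε * f θ ε,
    fun ξ I hξ => ⟨R.firstReturn_returnMap N (hJ I hξ), fun q hq => ?_, ?_⟩, fun p hp => ?_,
    fun p hp => ?_⟩
  · obtain ⟨h1, n, h2⟩ := R.firstReturn_unique N (hJ I hξ) hq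
    exact ⟨h1, n, by rw [h2]; ring⟩
  · have := R.returnMap_add_period N (p := (ξ, I)) (hJ I hξ)
    simpa using this
  · have h1 : ContDiffAt ℝ m (RefractionBilliard.returnMap E h μ ω Λ fun θ => 1 + ε * f θ ε) p :=
      ContDiffAt.comp (f := fun p : ℝ × ℝ => (p, ε)) p
        (R.contDiffAt_returnMap hm Sε (hJ p.2 hp.2)) (by fun_prop)
    exact (h1.of_le (by norm_cast; omega)).contDiffWithinAt
  · obtain ⟨T, hT, hdet⟩ := R.exists_det_returnMap hm Sε (hJ p.2 hp.2)
    refine ⟨T, hT.hasFDerivWithinAt, hdet, ?_⟩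
    rw [← hT.fderiv]
    exact htw p hp
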